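/- Let $p\ge 1$. A $(p,2n)$-watermelon without wall condition (and without deviation) is a family of $p$ paths $W_1,\dots,W_p$ with steps $\pm1$ and of length $2n$, such that $W_i$ starts and ends at level $2i-2$ and the paths never touch each other, i.e. $W_1(k)<\cdots<W_p(k)$ for all integers $0\le k\le 2n$. Let $\widehat W^{(n)}$ be uniformly distributed on the finite set of these watermelons, and let $\widehat X^{(n)}(t)=\frac1{\sqrt{2n}}\widehat W^{(n)}(\lfloor 2nt\rfloor)\in\mathbb R^p$ for $t\in[0,1]$. Let $\widehat H$ be a $p\times p$ matrix from the Gaussian Unitary Ensemble with density proportional to $e^{-\operatorname{tr}H^2}$ (the diagonal entries and the real and imaginary parts of the entries above the diagonal are independent centred Gaussian variables, of variance $\frac12$ on the diagonal and $\frac14$ off it), and let $\widehat\Lambda=(\widehat\lambda_1,\dots,\widehat\lambda_p)$ be its eigenvalues in increasing order. Then for every $t\in[0,1]$, as $n\to\infty$, $\widehat X^{(n)}(t)$ converges in distribution to $\sqrt{2t(1-t)}\,\widehat\Lambda$. Moreover, for $t\in(0,1)$, the law of $\sqrt{2t(1-t)}\,\widehat\Lambda$ has the density $$\widehat f(t;x)=\frac{2^{-p/2}}{\pi^{p/2}\,(t(1-t))^{p^2/2}\,\prod_{i=1}^{p-1}i!}\prod_{1\le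 i<j\le p}(x_j-x_i)^2\;e^{-\frac{\|x\|^2}{2t(1-t)}}\,\mathbf 1_{x_1\le\cdots\le x_p}$$ with respect to Lebesgue measure on $\mathbb R^p$. -/

import Mathlib

open MeasureTheory ProbabilityTheory Filter Topology

noncomputable section

/-- Position after `k` steps of the Bernoulli path which starts at `a` and whose `j`-th step is
`+1` if `s j = true` and `-1` if `s j = false`. -/
def bernoulliPath {m : ℕ} (a : ℤ) (s : Fin m → Bool) (k : ℕ) : ℤ :=
  a + ∑ j : Fin m, if (j : ℕ) < k then (if s j then 1 else -1) else 0

/-- Position at time `k` of the `i`-th of `p` Bernoulli paths with steps `s`. The starting points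
are `0, 2, …, 2p - 2` (branches are numbered from `0`). -/
def branch {p m : ℕ} (s : Fin p → Fin m → Bool) (i : Fin p) (k : ℕ) : ℤ :=
  bernoulliPath (2 * (i : ℤ)) (s i) k

/-- The family of Bernoulli paths of length `m` with steps `s` is a `(p, m)`-watermelon without
deviation and without wall condition: each path ends at the level where it started, and the paths
do not touch each other. -/
def IsWatermelon {p m : ℕ} (s : Fin p → Fin m → Bool) : Prop :=
  (∀ i, branch s i m = 2 * (i : ℤ)) ∧
    ∀ k ≤ m, ∀ i j : Fin p, i < j → branch s i k < branch s j k

/-- The finite set of `(p, m)`-watermelons without deviation and without wall condition, each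
given by its steps, with the discrete measurable structure of `Fin p → Fin m → Bool`. -/
abbrev Watermelon (p m : ℕ) : Type := {s : Fin p → Fin m → Bool // IsWatermelon s}

/-- The rescaled `(p, 2n)`-watermelon at time `t`: the vector of `W_i(⌊2nt⌋) / √(2n)`. -/
def rescaledWatermelon {p n : ℕ} (w : Watermelon p (2 * n)) (t : ℝ) :
    EuclideanSpace ℝ (Fin p) :=
  WithLp.toLp 2 fun i => (branch w.1 i ⌊2 * (n : ℝ) * t⌋₊ : ℝ) / √(2 * (n : ℝ))

/-- Hermitian `p × p` matrices. -/
abbrev HermitianMatrix (p : ℕ) : Type := selfAdjoint (Matrix (Fin p) (Fin p) ℂ)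

/-- The `p²` free real coordinates of a Hermitian matrix: `Re H i j` for `i ≤ j`, and `Im H i j`
for `j < i`. -/
def hermitianCoord {p : ℕ} (H : HermitianMatrix p) (ij : Fin p × Fin p) : ℝ :=
  if ij.1 ≤ ij.2 then (H.1 ij.1 ij.2).re else (H.1 ij.1 ij.2).im

/-- `H` is a random matrix from the Gaussian Unitary Ensemble, with density proportional to
`exp (-tr H²)`: the diagonal entries and the real and imaginary parts of the entries off the
diagonal are independent centred Gaussian variables, of variance `1/2` on the diagonal and `1/4`
off the diagonal. -/
def IsGUE {p : ℕ} {Ω : Type*} [MeasurableSpace Ω] (H : Ω → HermitianMatrix p) (P : Measure Ω) :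
    Prop :=
  HasLaw (fun ω => hermitianCoord (H ω))
    (Measure.pi fun ij : Fin p × Fin p => gaussianReal 0 (if ij.1 = ij.2 then 1 / 2 else 1 / 4)) P

/-- The eigenvalues of a Hermitian matrix, with multiplicity, in increasing order. -/
def orderedEigenvalues {p : ℕ} (H : HermitianMatrix p) : EuclideanSpace ℝ (Fin p) :=
  have hH : H.1.IsHermitian := selfAdjoint.mem_iff.mp H.2
  WithLp.toLp 2 (hH.eigenvalues ∘ Tuple.sort hH.eigenvalues)

open Classical in
/-- The limit density at time `t`. -/
def limitDensity (p : ℕ) (t : ℝ) (x : EuclideanSpace ℝ (Fin p)) : ℝ :=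
  if Monotone (fun i => x i) then
    1 / (√(2 * Real.pi) ^ p * √(t * (1 - t)) ^ (p ^ 2) *
        ∏ i ∈ Finset.range p, (Nat.factorial i : ℝ)) *
      (∏ i : Fin p, ∏ j ∈ Finset.Ioi i, (x j - x i) ^ 2) *
      Real.exp (-‖x‖ ^ 2 / (2 * t * (1 - t)))
  else 0

end

/-!
At a fixed time the position of a uniform watermelon has an explicit probability, and this
probability has a local limit which is recognised as the eigenvalue density of the Gaussian Unitary
Ensemble. So there are two halves, a combinatorial and a random matrix one, which meet in
`limitDensity`.

**Watermelons.** Cutting a watermelon at time `k` gives two families of non-touching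
paths, the second one read backwards. Both are counted by the determinant of Karlin and McGregor
(`card_nontouching`, `card_nontouching_through`); it is proved by a recursion in the first step,
where touching families drop out because the determinant then has two equal rows. As the paths
start at `0, 2, …, 2p - 2`, the determinant is a Vandermonde product in the endpoints times
one factor for each endpoint (`pathDet_startLevel`). With Stirling's formula each factor tends to a
Gaussian (`tendsto_endpoint_factor`). Two Vandermonde products, one from each side of the cut, give
the square in the limit density, and the Gaussians for the times `t` and `1 - t` combine to
`exp (-x² / (2t(1-t)))` (`tendsto_smearedDensity`). Fatou's lemma turns this pointwise limit into a
lower bound for the probabilities of open sets (`withDensity_le_liminf`). By the portmanteau theorem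
this is convergence in distribution as soon as the limit density has total mass one, and that
follows from the second half.

**Eigenvalues.** The joint density of the eigenvalues is found by induction on the size of the
matrix, without integrating over the unitary group. A matrix of size `p + 1` is a matrix of size `p`
with a Gaussian border (`measurePreserving_borderCoord`). The law of the border is
invariant under unitary matrices, so the given matrix may be taken diagonal with entries `lam`, and
its characteristic polynomial after bordering depends only on the diagonal entry and on the squared
moduli of the border (`charpoly_border`), which are independent Gaussian and exponential variables
(`lintegral_gaussian_border`). For fixed `lam` these variables and the tuples `mu` which interlace
with `lam` correspond bijectively (`image_borderMap`, `borderMap_injOn`), with Jacobian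
`vdm mu / vdm lam` (`abs_det_borderJacobian`), and the exponent of the Gaussian weight is the
difference of the sums of squares of `mu` and `lam` (`Interlaced.sum_sq`). The induction
hypothesis contributes `vdm lam ^ 2`; one factor `vdm lam` is cancelled by the Jacobian and the
other one integrates to `vdm mu / p!` over the `lam` which interlace with `mu`
(`integral_vdm_interlaced`). This gives `lintegral_coordEigenvalues`, with its constant.

At the times `0` and `1` the watermelon is at its starting position, which tends to `0` after
rescaling.
-/


/-! ### Counting families of non-touching paths -/

/-- The number of sequences of `k` steps `±1` with sum `d`, as a real number. -/
def stepCount : ℕ → ℤ → ℝ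
  | 0, d => if d = 0 then 1 else 0
  | k + 1, d => stepCount k (d - 1) + stepCount k (d + 1)

theorem stepCount_neg (k : ℕ) (d : ℤ) : stepCount k (-d) = stepCount k d := by
  induction k generalizing d with
  | zero => simp [stepCount]
  | succ k ih =>
    rw [stepCount, stepCount, add_comm, ← ih (d + 1), ← ih (d - 1)]
    congr 2 <;> ring

theorem stepCount_eq_zero_of_lt (k m : ℕ) (h : k < m) : stepCount k (2 * (m : ℤ) - k) = 0 := by
  induction k generalizing m with
  | zero => simp only [stepCount]; rw [if_neg]; push_cast; omega
  | succ k ih =>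
    obtain ⟨m, rfl⟩ : ∃ m', m = m' + 1 := ⟨m - 1, by omega⟩
    rw [stepCount]
    have e1 : 2 * ((m + 1 : ℕ) : ℤ) - (k + 1 : ℕ) - 1 = 2 * (m : ℤ) - k := by push_cast; ring
    have e2 : 2 * ((m + 1 : ℕ) : ℤ) - (k + 1 : ℕ) + 1 = 2 * ((m + 1 : ℕ) : ℤ) - k := by
      push_cast; ring
    rw [e1, e2, ih m (by omega), ih (m + 1) (by omega), add_zero]

theorem stepCount_eq_choose (k m : ℕ) : stepCount k (2 * (m : ℤ) - k) = k.choose m := by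
  induction k generalizing m with
  | zero =>
    rcases m with _ | m
    · simp [stepCount]
    · simp only [stepCount, Nat.choose_zero_succ]; rw [if_neg] <;> [simp; (push_cast; omega)]
  | succ k ih =>
    rcases m with _ | m
    · rw [stepCount]
      have e1 : 2 * ((0 : ℕ) : ℤ) - (k + 1 : ℕ) - 1 = -(2 * ((k + 1 : ℕ) : ℤ) - k) := by
        push_cast; ring
      have e2 : 2 * ((0 : ℕ) : ℤ) - (k + 1 : ℕ) + 1 = 2 * ((0 : ℕ) : ℤ) - k := by
        push_cast; ring
      rw [e1, e2, ih 0, stepCount_neg, stepCount_eq_zero_of_lt k (k + 1) (by omega)]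
      simp
    · rw [stepCount, Nat.choose_succ_succ]
      have e1 : 2 * ((m + 1 : ℕ) : ℤ) - (k + 1 : ℕ) - 1 = 2 * (m : ℤ) - k := by push_cast; ring
      have e2 : 2 * ((m + 1 : ℕ) : ℤ) - (k + 1 : ℕ) + 1 = 2 * ((m + 1 : ℕ) : ℤ) - k := by
        push_cast; ring
      rw [e1, e2, ih m, ih (m + 1)]
      push_cast; ring

/-- The family of Bernoulli paths with starting points `a` and steps `s` never touches itself. -/
def IsNontouching {p m : ℕ} (a : Fin p → ℤ) (s : Fin p → Fin m → Bool) : Prop :=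
  ∀ k ≤ m, StrictMono fun i => bernoulliPath (a i) (s i) k

/-- The step `±1` encoded by a Boolean. -/
def stepSign (b : Bool) : ℤ := if b then 1 else -1

theorem bernoulliPath_zero {m : ℕ} (a : ℤ) (s : Fin m → Bool) : bernoulliPath a s 0 = a := by
  simp [bernoulliPath]

theorem bernoulliPath_cons {m : ℕ} (a : ℤ) (b : Bool) (s : Fin m → Bool) (k : ℕ) :
    bernoulliPath a (Fin.cons b s : Fin (m + 1) → Bool) (k + 1)
      = bernoulliPath (a + stepSign b) s k := by
  simp [bernoulliPath, Fin.sum_univ_succ, stepSign, add_assoc]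

theorem isNontouching_cons {p m : ℕ} (a : Fin p → ℤ) (d : Fin p → Bool)
    (s : Fin p → Fin m → Bool) :
    IsNontouching a (fun i => (Fin.cons (d i) (s i) : Fin (m + 1) → Bool)) ↔
      StrictMono a ∧ IsNontouching (fun i => a i + stepSign (d i)) s := by
  constructor
  · intro h
    refine ⟨by simpa [bernoulliPath_zero] using h 0 (Nat.zero_le _), fun k hk => ?_⟩
    simpa [bernoulliPath_cons] using h (k + 1) (by omega)
  · rintro ⟨h0, h⟩ k hk
    rcases k with _ | k
    · simpa [bernoulliPath_zero] using h0
    · simpa [bernoulliPath_cons] using h k (by omega)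

/-- Splitting off the first step of every path of a family. -/
def consStepsEquiv (p m : ℕ) :
    (Fin p → Bool) × (Fin p → Fin m → Bool) ≃ (Fin p → Fin (m + 1) → Bool) where
  toFun x := fun i => Fin.cons (x.1 i) (x.2 i)
  invFun s := (fun i => s i 0, fun i => Fin.tail (s i))
  left_inv x := by simp
  right_inv s := by simp

theorem sum_steps_succ {p m : ℕ} (f : (Fin p → Fin (m + 1) → Bool) → ℝ) :
    ∑ s, f s = ∑ d : Fin p → Bool, ∑ s : Fin p → Fin m → Bool,
      f fun i => (Fin.cons (d i) (s i) : Fin (m + 1) → Bool) := by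
  rw [← Fintype.sum_prod_type', ← (consStepsEquiv p m).sum_comp]
  rfl

/-- The determinant of one-path counts from the points `a` to the points `b`. -/
def pathDet {p : ℕ} (k : ℕ) (a b : Fin p → ℤ) : ℝ :=
  (Matrix.of fun i j => stepCount k (b j - a i)).det

theorem pathDet_succ {p : ℕ} (k : ℕ) (a b : Fin p → ℤ) :
    pathDet (k + 1) a b = ∑ d : Fin p → Bool, pathDet k (fun i => a i + stepSign (d i)) b := by
  have h := (Matrix.detRowAlternating (R := ℝ) (n := Fin p)).toMultilinearMap.map_sum
    (fun (i : Fin p) (d : Bool) (j : Fin p) => stepCount k (b j - (a i + stepSign d)))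
  refine Eq.trans ?_ h
  simp only [pathDet]
  change Matrix.det _ = Matrix.det _
  congr 1
  ext i j
  simp [stepCount, stepSign, sub_add_eq_sub_sub]

theorem pathDet_zero_self {p : ℕ} (a : Fin p → ℤ) (ha : StrictMono a) : pathDet 0 a a = 1 := by
  have : (Matrix.of fun i j => stepCount 0 (a j - a i)) = (1 : Matrix (Fin p) (Fin p) ℝ) := by
    ext i j
    simp only [Matrix.of_apply, stepCount, sub_eq_zero, ha.injective.eq_iff, Matrix.one_apply,
      eq_comm (a := i)]
  rw [pathDet, this, Matrix.det_one]

theorem pathDet_zero_of_ne {p : ℕ} (a b : Fin p → ℤ) (ha : StrictMono a) (hb : StrictMono b)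
    (hab : a ≠ b) : pathDet 0 a b = 0 := by
  rw [pathDet, Matrix.det_apply]
  refine Finset.sum_eq_zero fun σ _ => ?_
  by_contra hne
  have hprod : ∀ i, b i = a (σ i) := by
    intro i
    by_contra hi
    apply hne
    rw [Finset.prod_eq_zero (Finset.mem_univ i), smul_zero]
    simp [stepCount, sub_eq_zero, hi]
  have hσ : StrictMono σ := fun i j hij => by
    have := hb hij
    rw [hprod, hprod] at this
    exact ha.lt_iff_lt.mp this
  have hid : (σ : Fin p → Fin p) = id :=
    (StrictMono.range_inj hσ strictMono_id).1 (by simp [σ.surjective.range_eq])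
  apply hab
  funext i
  rw [hprod, hid, id]

/-- One simultaneous step of strictly ordered points of the same parity keeps their weak order;
if two of them meet, the determinant has two equal rows. -/
theorem pathDet_eq_zero_of_touching {p : ℕ} (k : ℕ) (a b : Fin p → ℤ) (ha : StrictMono a)
    (hpar : ∀ i j, (2 : ℤ) ∣ a i - a j) (d : Fin p → Bool)
    (hd : ¬ StrictMono fun i => a i + stepSign (d i)) :
    pathDet k (fun i => a i + stepSign (d i)) b = 0 := by
  have hmono : Monotone fun i => a i + stepSign (d i) := by
    intro i j hij
    rcases hij.eq_or_lt with rfl | hij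
    · rfl
    · have h1 := ha hij
      have h2 := hpar j i
      simp only [stepSign]
      split_ifs <;> omega
  have hinj : ¬ Function.Injective fun i => a i + stepSign (d i) := fun h =>
    hd (hmono.strictMono_of_injective h)
  simp only [Function.Injective, not_forall] at hinj
  obtain ⟨i, j, hij, hne⟩ := hinj
  refine Matrix.det_zero_of_row_eq hne ?_
  funext l
  simp only [Matrix.of_apply]
  rw [hij]

theorem two_dvd_step {p : ℕ} {a : Fin p → ℤ} (hpar : ∀ i j, (2 : ℤ) ∣ a i - a j)
    (d : Fin p → Bool) (i j : Fin p) :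
    (2 : ℤ) ∣ (a i + stepSign (d i)) - (a j + stepSign (d j)) := by
  have := hpar i j
  simp only [stepSign]
  split_ifs <;> omega

open Classical in
/-- Determinant formula of Karlin and McGregor: both sides satisfy the same recursion in
the first step. -/
theorem card_nontouching {p : ℕ} (m : ℕ) (a b : Fin p → ℤ) (ha : StrictMono a)
    (hb : StrictMono b) (hpar : ∀ i j, (2 : ℤ) ∣ a i - a j) :
    (∑ s : Fin p → Fin m → Bool, if IsNontouching a s ∧
      (fun i => bernoulliPath (a i) (s i) m) = b then (1 : ℝ) else 0) = pathDet m a b := by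
  induction m generalizing a with
  | zero =>
    have hN : ∀ s : Fin p → Fin 0 → Bool, IsNontouching a s := by
      intro s k hk
      obtain rfl : k = 0 := by omega
      simpa [bernoulliPath_zero] using ha
    simp only [hN, bernoulliPath_zero, true_and]
    by_cases hab : a = b
    · subst hab
      simp [pathDet_zero_self a ha]
    · rw [pathDet_zero_of_ne a b ha hb hab]
      simp [hab]
  | succ m ih =>
    rw [sum_steps_succ, pathDet_succ]
    refine Finset.sum_congr rfl fun d _ => ?_
    simp only [isNontouching_cons, bernoulliPath_cons, ha, true_and]
    by_cases hd : StrictMono fun i => a i + stepSign (d i)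
    · exact ih _ hd (two_dvd_step hpar d)
    · rw [pathDet_eq_zero_of_touching m a b ha hpar d hd]
      refine Finset.sum_eq_zero fun s _ => if_neg fun h => hd ?_
      simpa [bernoulliPath_zero] using h.1 0 (Nat.zero_le _)

open Classical in
/-- Families with prescribed positions at time `k` and at the final time `k + l`. -/
theorem card_nontouching_through {p : ℕ} (k l : ℕ) (a e b : Fin p → ℤ) (ha : StrictMono a)
    (he : StrictMono e) (hb : StrictMono b) (hpar : ∀ i j, (2 : ℤ) ∣ a i - a j) :
    (∑ s : Fin p → Fin (k + l) → Bool, if IsNontouching a s ∧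
      (fun i => bernoulliPath (a i) (s i) k) = e ∧
      (fun i => bernoulliPath (a i) (s i) (k + l)) = b then (1 : ℝ) else 0)
      = pathDet k a e * pathDet l e b := by
  induction k generalizing a with
  | zero =>
    simp only [bernoulliPath_zero]
    by_cases hae : a = e
    · subst hae
      rw [pathDet_zero_self a ha, one_mul, ← card_nontouching l a b ha hb hpar]
      simp only [true_and]
      have h0 : 0 + l = l := zero_add l
      rw! [h0]
      rfl
    · rw [pathDet_zero_of_ne a e ha he hae]
      simp [hae]
  | succ k ih =>
    have h0 : k + 1 + l = k + l + 1 := by omega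
    rw! [h0]
    rw [sum_steps_succ, pathDet_succ, Finset.sum_mul]
    refine Finset.sum_congr rfl fun d _ => ?_
    simp only [isNontouching_cons, bernoulliPath_cons, ha, true_and]
    by_cases hd : StrictMono fun i => a i + stepSign (d i)
    · exact ih _ hd (two_dvd_step hpar d)
    · rw [pathDet_eq_zero_of_touching k a e ha hpar d hd, zero_mul]
      refine Finset.sum_eq_zero fun s _ => if_neg fun h => hd ?_
      simpa [bernoulliPath_zero] using h.1 0 (Nat.zero_le _)

theorem pathDet_comm {p : ℕ} (k : ℕ) (a b : Fin p → ℤ) : pathDet k a b = pathDet k b a := by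
  rw [pathDet, pathDet, ← Matrix.det_transpose]
  congr 1
  ext i j
  simp only [Matrix.transpose_apply, Matrix.of_apply]
  rw [← stepCount_neg, neg_sub]

/-- The levels `0, 2, …, 2p - 2`. -/
def startLevel (p : ℕ) (i : Fin p) : ℤ := 2 * (i : ℤ)

theorem startLevel_strictMono (p : ℕ) : StrictMono (startLevel p) := fun i j h => by
  have : (i : ℕ) < j := h
  simp only [startLevel]; omega

theorem isWatermelon_iff {p m : ℕ} (s : Fin p → Fin m → Bool) :
    IsWatermelon s ↔ IsNontouching (startLevel p) s ∧
      (fun i => bernoulliPath (startLevel p i) (s i) m) = startLevel p := by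
  rw [and_comm]
  unfold IsWatermelon IsNontouching
  refine and_congr ?_ Iff.rfl
  rw [funext_iff]
  rfl

open Classical in
theorem card_watermelon (p m : ℕ) :
    (Fintype.card (Watermelon p m) : ℝ) = pathDet m (startLevel p) (startLevel p) := by
  rw [← card_nontouching m _ _ (startLevel_strictMono p) (startLevel_strictMono p)
    (fun i j => by simp only [startLevel]; omega), Fintype.card_subtype]
  simp only [isWatermelon_iff]
  rw [Finset.sum_ite]
  simp

open Classical in
/-- Watermelons with prescribed positions at time `k`; the last `l` steps are read backwards. -/
theorem card_watermelon_at (p : ℕ) (k l : ℕ) (e : Fin p → ℤ) (he : StrictMono e) :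
    (Fintype.card {w : Watermelon p (k + l) // (fun i => branch w.1 i k) = e} : ℝ)
      = pathDet k (startLevel p) e * pathDet l (startLevel p) e := by
  rw [pathDet_comm l, ← card_nontouching_through k l _ _ _ (startLevel_strictMono p) he
    (startLevel_strictMono p) (fun i j => by simp only [startLevel]; omega)]
  rw [Fintype.card_congr (Equiv.subtypeSubtypeEquivSubtypeInter _
    (fun s : Fin p → Fin (k + l) → Bool => (fun i => branch s i k) = e)), Fintype.card_subtype]
  simp only [isWatermelon_iff]
  rw [Finset.sum_ite]
  simp only [Finset.sum_const, nsmul_eq_mul, mul_one, mul_zero, add_zero]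
  congr 2
  ext s
  simp only [Finset.mem_filter, Finset.mem_univ, true_and, and_assoc]
  refine and_congr_right fun _ => ?_
  rw [and_comm]
  rfl


/-! ### The determinant as a product -/

section
open Polynomial

/-- The matrix of values of polynomials of degree less than `p` at `p` points factors through the
Vandermonde matrix of the points. -/
theorem det_eval_polynomials {p : ℕ} (v : Fin p → ℝ) (P : Fin p → ℝ[X])
    (hP : ∀ i, (P i).natDegree < p) :
    (Matrix.of fun i j => (P i).eval (v j)).det
      = (Matrix.of fun i j : Fin p => (P i).coeff j).det * (Matrix.vandermonde v).det := by
  rw [← Matrix.det_transpose (Matrix.vandermonde v), ← Matrix.det_mul]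
  congr 1
  ext i j
  simp only [Matrix.of_apply, Matrix.mul_apply, Matrix.transpose_apply, Matrix.vandermonde_apply]
  rw [eval_eq_sum_range' (hP i), Finset.sum_range]

/-- The polynomials `x (x-1) ⋯ (x-i+1) · (K-x) (K-1-x) ⋯`, with `p - 1` linear factors. -/
noncomputable def binomialPoly (p K : ℕ) (i : Fin p) : ℝ[X] :=
  descPochhammer ℝ i * (descPochhammer ℝ (p - 1 - i)).comp (C (K : ℝ) - X)

theorem natDegree_binomialPoly_lt (p K : ℕ) (i : Fin p) :
    (binomialPoly p K i).natDegree < p := by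
  have h1 : ((descPochhammer ℝ (p - 1 - i)).comp (C (K : ℝ) - X)).natDegree ≤ p - 1 - i := by
    refine natDegree_comp_le.trans ?_
    rw [descPochhammer_natDegree]
    calc (p - 1 - i) * (C (K : ℝ) - X).natDegree ≤ (p - 1 - i) * 1 := by
          gcongr
          exact (natDegree_sub_le _ _).trans (by simp)
      _ = _ := mul_one _
  have h2 := natDegree_mul_le (p := descPochhammer ℝ i)
    (q := (descPochhammer ℝ (p - 1 - i)).comp (C (K : ℝ) - X))
  rw [descPochhammer_natDegree] at h2
  have := i.2
  unfold binomialPoly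
  omega

theorem eval_binomialPoly {p K m : ℕ} (i : Fin p) (hm : m ≤ K) :
    (binomialPoly p K i).eval (m : ℝ)
      = m.descFactorial i * (K - m).descFactorial (p - 1 - i) := by
  rw [binomialPoly, eval_mul, eval_comp, descPochhammer_eval_eq_descFactorial, eval_sub, eval_C,
    eval_X, ← Nat.cast_sub hm, descPochhammer_eval_eq_descFactorial]

/-- The points `0, …, p - 1` make the matrix of values triangular, which determines the
determinant of the coefficients. -/
theorem det_coeff_binomialPoly_mul (p k : ℕ) :
    (Matrix.of fun i j : Fin p => (binomialPoly p (k + p - 1) i).coeff j).det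
      * (Matrix.vandermonde fun j : Fin p => (j : ℝ)).det
      = (∏ j : Fin p, ((j : ℕ).factorial : ℝ)) *
        ∏ j : Fin p, (((k + j).factorial : ℝ) / k.factorial) := by
  rw [← det_eval_polynomials _ _ (natDegree_binomialPoly_lt p (k + p - 1)),
    Matrix.det_of_isUpperTriangular]
  · rw [← Equiv.prod_comp Fin.revPerm (fun j : Fin p => (((k + j).factorial : ℝ) / k.factorial)),
      ← Finset.prod_mul_distrib]
    refine Finset.prod_congr rfl fun j _ => ?_
    have hj := j.2
    rw [Matrix.of_apply, eval_binomialPoly _ (by omega), Nat.descFactorial_self]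
    congr 1
    rw [eq_div_iff (by positivity)]
    have h := Nat.factorial_mul_descFactorial (n := k + p - 1 - j) (k := p - 1 - j) (by omega)
    have e1 : k + p - 1 - j - (p - 1 - j) = k := by omega
    have e2 : k + ((Fin.revPerm j : Fin p) : ℕ) = k + p - 1 - j := by
      simp only [Fin.revPerm_apply, Fin.val_rev]; omega
    rw [e1] at h
    rw [e2, ← h]
    push_cast; ring
  · intro i j hij
    have hj : (j : ℕ) < i := hij
    rw [Matrix.of_apply, eval_binomialPoly _ (by omega), Nat.descFactorial_of_lt hj]
    simp

theorem det_vandermonde_range (p : ℕ) :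
    (Matrix.vandermonde fun j : Fin p => (j : ℝ)).det = ∏ j : Fin p, ((j : ℕ).factorial : ℝ) := by
  rcases p with _ | p
  · simp
  · rw [Matrix.det_vandermonde_id_eq_superFactorial]
    rw [← Nat.prod_range_succ_factorial, Finset.prod_range]
    push_cast
    rfl

theorem det_coeff_binomialPoly (p k : ℕ) :
    (Matrix.of fun i j : Fin p => (binomialPoly p (k + p - 1) i).coeff j).det
      = ∏ j : Fin p, (((k + j).factorial : ℝ) / k.factorial) := by
  have h := det_coeff_binomialPoly_mul p k
  rw [det_vandermonde_range, mul_comm] at h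
  refine mul_left_cancel₀ (Finset.prod_ne_zero_iff.2 fun j _ => ?_) h
  positivity

end

theorem choose_eq_descFactorial {p k m : ℕ} (i : Fin p) (h1 : p ≤ m + 1) (h2 : m ≤ k) :
    (k.choose (m - i) : ℝ) = k.factorial / (m.factorial * (k + p - 1 - m).factorial) *
      (m.descFactorial i * (k + p - 1 - m).descFactorial (p - 1 - i)) := by
  have hi := i.2
  have a1 := Nat.factorial_mul_descFactorial (n := m) (k := i) (by omega)
  have a2 := Nat.factorial_mul_descFactorial (n := k + p - 1 - m) (k := p - 1 - i) (by omega)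
  have e : k + p - 1 - m - (p - 1 - i) = k - (m - i) := by omega
  rw [e] at a2
  rw [Nat.cast_choose ℝ (by omega : m - i ≤ k), ← a1, ← a2]
  have b1 : (m.descFactorial i : ℝ) ≠ 0 := by
    have : m.descFactorial i ≠ 0 := by
      intro h; rw [h] at a1; exact Nat.factorial_ne_zero m (by simpa using a1.symm)
    exact_mod_cast this
  have b2 : ((k + p - 1 - m).descFactorial (p - 1 - i) : ℝ) ≠ 0 := by
    have : (k + p - 1 - m).descFactorial (p - 1 - i) ≠ 0 := by
      intro h; rw [h] at a2; exact Nat.factorial_ne_zero (k + p - 1 - m) (by simpa using a2.symm)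
    exact_mod_cast this
  push_cast
  field_simp

/-- Product formula for the number of non-touching families from `0, 2, …, 2p - 2` to the points
`2 m_j - k`. -/
theorem pathDet_startLevel {p k : ℕ} (m : Fin p → ℕ) (h1 : ∀ j, p ≤ m j + 1)
    (h2 : ∀ j, m j ≤ k) :
    pathDet k (startLevel p) (fun j => 2 * (m j : ℤ) - k)
      = (∏ i : Fin p, ∏ j ∈ Finset.Ioi i, ((m j : ℝ) - m i)) *
        ∏ j : Fin p, ((k + j).factorial / ((m j).factorial * (k + p - 1 - m j).factorial) : ℝ) := by
  have hmat : (Matrix.of fun i j : Fin p => stepCount k (2 * (m j : ℤ) - k - startLevel p i))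
      = Matrix.of fun i j : Fin p =>
        ((k.factorial : ℝ) / ((m j).factorial * (k + p - 1 - m j).factorial)) *
        (Matrix.of fun i j : Fin p => (binomialPoly p (k + p - 1) i).eval (m j : ℝ)) i j := by
    ext i j
    have hi := i.2
    have hm := h1 j
    have hk := h2 j
    have e : 2 * (m j : ℤ) - k - startLevel p i = 2 * ((m j - i : ℕ) : ℤ) - k := by
      simp only [startLevel]
      omega
    simp only [Matrix.of_apply]
    rw [e, stepCount_eq_choose, eval_binomialPoly _ (by omega), choose_eq_descFactorial i hm hk]
  rw [pathDet, hmat, Matrix.det_mul_row,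
    det_eval_polynomials _ _ (natDegree_binomialPoly_lt p (k + p - 1)), det_coeff_binomialPoly,
    Matrix.det_vandermonde, ← mul_assoc, ← Finset.prod_mul_distrib, mul_comm]
  congr 1
  refine Finset.prod_congr rfl fun j _ => ?_
  have : (k.factorial : ℝ) ≠ 0 := by positivity
  field_simp


/-! ### Local limit theorem for binomial coefficients -/

/-- Second order expansion at `0` of the exponential rate of the symmetric binomial law. -/
theorem abs_entropy_sub_sq_le {u : ℝ} (hu : |u| ≤ 1 / 2) :
    |(1 + u) * Real.log (1 + u) + (1 - u) * Real.log (1 - u) - u ^ 2| ≤ 4 * |u| ^ 3 := by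
  have key : ∀ x : ℝ, |x| ≤ 1 / 2 → |x + x ^ 2 / 2 + Real.log (1 - x)| ≤ 2 * |x| ^ 3 := by
    intro x hx
    have h := Real.abs_log_sub_add_sum_range_le (x := x) (by linarith) 2
    have e : ∑ i ∈ Finset.range 2, x ^ (i + 1) / ((i : ℝ) + 1) = x + x ^ 2 / 2 := by
      rw [Finset.sum_range_succ, Finset.sum_range_one]; norm_num
    rw [e] at h
    refine h.trans ?_
    rw [div_le_iff₀ (by linarith)]
    have : 0 ≤ |x| ^ 3 := by positivity
    norm_num
    nlinarith
  have h1 := key u hu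
  have h2 := key (-u) (by rwa [abs_neg])
  rw [abs_neg] at h2
  have e : (1 + u) * Real.log (1 + u) + (1 - u) * Real.log (1 - u) - u ^ 2
      = (1 + u) * (-u + (-u) ^ 2 / 2 + Real.log (1 - -u))
        + (1 - u) * (u + u ^ 2 / 2 + Real.log (1 - u)) := by
    rw [sub_neg_eq_add]; ring
  obtain ⟨hl, hr⟩ := abs_le.mp hu
  rw [e]
  calc _ ≤ |(1 + u) * (-u + (-u) ^ 2 / 2 + Real.log (1 - -u))|
        + |(1 - u) * (u + u ^ 2 / 2 + Real.log (1 - u))| := abs_add_le _ _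
    _ = (1 + u) * |(-u + (-u) ^ 2 / 2 + Real.log (1 - -u))|
        + (1 - u) * |(u + u ^ 2 / 2 + Real.log (1 - u))| := by
        rw [abs_mul, abs_mul, abs_of_nonneg (by linarith : 0 ≤ 1 + u),
          abs_of_nonneg (by linarith : 0 ≤ 1 - u)]
    _ ≤ (1 + u) * (2 * |u| ^ 3) + (1 - u) * (2 * |u| ^ 3) := by
        gcongr <;> linarith
    _ = _ := by ring

section Sequences

variable {k m : ℕ → ℕ} {y : ℝ}

theorem tendsto_relative_deviation (hk : Tendsto k atTop atTop)
    (hm : Tendsto (fun n => (2 * (m n : ℝ) - k n) / √(k n)) atTop (𝓝 y)) :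
    Tendsto (fun n => (2 * (m n : ℝ) - k n) / k n) atTop (𝓝 0) := by
  have hk' : Tendsto (fun n => √(k n : ℝ)) atTop atTop :=
    Real.tendsto_sqrt_atTop.comp (tendsto_natCast_atTop_atTop.comp hk)
  have h := hm.div_atTop hk'
  refine h.congr fun n => ?_
  rw [div_div, Real.mul_self_sqrt (Nat.cast_nonneg _)]

theorem tendsto_entropy (hk : Tendsto k atTop atTop)
    (hm : Tendsto (fun n => (2 * (m n : ℝ) - k n) / √(k n)) atTop (𝓝 y)) :
    Tendsto (fun n => (k n : ℝ) * ((1 + (2 * (m n : ℝ) - k n) / k n) *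
        Real.log (1 + (2 * (m n : ℝ) - k n) / k n) + (1 - (2 * (m n : ℝ) - k n) / k n) *
        Real.log (1 - (2 * (m n : ℝ) - k n) / k n))) atTop (𝓝 (y ^ 2)) := by
  have hu := tendsto_relative_deviation hk hm
  set u : ℕ → ℝ := fun n => (2 * (m n : ℝ) - k n) / k n with hu_def
  have hsq : Tendsto (fun n => (k n : ℝ) * u n ^ 2) atTop (𝓝 (y ^ 2)) := by
    refine (hm.pow 2).congr' ?_
    filter_upwards [hk.eventually_gt_atTop 0] with n hn
    have : (0 : ℝ) < k n := by exact_mod_cast hn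
    simp only [hu_def]
    rw [div_pow, div_pow, Real.sq_sqrt this.le]
    field_simp
  have herr : Tendsto (fun n => 4 * ((k n : ℝ) * u n ^ 2) * |u n|) atTop (𝓝 0) := by
    have := (hsq.const_mul 4).mul hu.abs
    simpa using this
  have hdiff : Tendsto (fun n => (k n : ℝ) * ((1 + u n) * Real.log (1 + u n)
      + (1 - u n) * Real.log (1 - u n)) - (k n : ℝ) * u n ^ 2) atTop (𝓝 0) := by
    refine squeeze_zero_norm' ?_ herr
    have hsmall : ∀ᶠ n in atTop, |u n| < 1 / 2 := by
      have := hu.abs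
      rw [abs_zero] at this
      exact this.eventually_lt_const (by norm_num)
    filter_upwards [hsmall] with n hn
    rw [← mul_sub, Real.norm_eq_abs, abs_mul, Nat.abs_cast]
    calc _ ≤ (k n : ℝ) * (4 * |u n| ^ 3) := by
          gcongr
          exact abs_entropy_sub_sq_le hn.le
      _ = 4 * ((k n : ℝ) * |u n| ^ 2) * |u n| := by ring
      _ = _ := by rw [sq_abs]
  simpa using hdiff.add hsq

theorem eventually_pos_of_deviation (hk : Tendsto k atTop atTop)
    (hm : Tendsto (fun n => (2 * (m n : ℝ) - k n) / √(k n)) atTop (𝓝 y)) :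
    ∀ᶠ n in atTop, 0 < k n ∧ 0 < m n ∧ m n < k n := by
  have hu := (tendsto_relative_deviation hk hm).abs
  rw [abs_zero] at hu
  filter_upwards [hu.eventually_lt_const (show (0 : ℝ) < 1 by norm_num),
    hk.eventually_gt_atTop 0] with n hn hkn
  have hk0 : (0 : ℝ) < k n := by exact_mod_cast hkn
  rw [abs_div, div_lt_one (by positivity), Nat.abs_cast, abs_lt] at hn
  refine ⟨hkn, ?_, ?_⟩
  · have : (0 : ℝ) < m n := by linarith
    exact_mod_cast this
  · have : (m n : ℝ) < k n := by linarith
    exact_mod_cast this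

theorem tendsto_half (hk : Tendsto k atTop atTop)
    (hm : Tendsto (fun n => (2 * (m n : ℝ) - k n) / √(k n)) atTop (𝓝 y)) :
    Tendsto (fun n => 2 * (m n : ℝ) / k n) atTop (𝓝 1) := by
  have h := (tendsto_relative_deviation hk hm).const_add 1
  rw [add_zero] at h
  refine h.congr' ?_
  filter_upwards [hk.eventually_gt_atTop 0] with n hn
  have : (0 : ℝ) < k n := by exact_mod_cast hn
  field_simp; ring

theorem tendsto_atTop_of_deviation (hk : Tendsto k atTop atTop)
    (hm : Tendsto (fun n => (2 * (m n : ℝ) - k n) / √(k n)) atTop (𝓝 y)) :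
    Tendsto m atTop atTop := by
  rw [← tendsto_natCast_atTop_iff (R := ℝ)]
  have h := (tendsto_half hk hm).pos_mul_atTop one_pos (tendsto_natCast_atTop_atTop.comp hk)
  have h2 := h.const_mul_atTop (show (0 : ℝ) < 1 / 2 by norm_num)
  refine h2.congr' ?_
  filter_upwards [hk.eventually_gt_atTop 0] with n hn
  have : (0 : ℝ) < k n := by exact_mod_cast hn
  simp only [Function.comp]
  field_simp

/-- The deviations of `m` and of `k - m` from `k / 2` are opposite. -/
theorem deviation_compl (hk : Tendsto k atTop atTop)
    (hm : Tendsto (fun n => (2 * (m n : ℝ) - k n) / √(k n)) atTop (𝓝 y)) :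
    Tendsto (fun n => (2 * ((k n - m n : ℕ) : ℝ) - k n) / √(k n)) atTop (𝓝 (-y)) := by
  refine hm.neg.congr' ?_
  filter_upwards [eventually_pos_of_deviation hk hm] with n hn
  rw [Nat.cast_sub hn.2.2.le]; ring

/-- The value of a binomial coefficient in terms of the normalised Stirling sequence. -/
theorem sqrt_mul_choose_eq {k m : ℕ} (hm : 0 < m) (hmk : m < k) :
    √(k : ℝ) * (k.choose m : ℝ) / 2 ^ k
      = Stirling.stirlingSeq k / (Stirling.stirlingSeq m * Stirling.stirlingSeq (k - m))
        * (√2 / (√(2 * (m : ℝ) / k) * √(2 * ((k - m : ℕ) : ℝ) / k)))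
        * Real.exp (-((k : ℝ) * ((1 + (2 * (m : ℝ) - k) / k) *
        Real.log (1 + (2 * (m : ℝ) - k) / k) + (1 - (2 * (m : ℝ) - k) / k) *
        Real.log (1 - (2 * (m : ℝ) - k) / k))) / 2) := by
  obtain ⟨l, rfl⟩ : ∃ l, k = m + l := ⟨k - m, by omega⟩
  have hl : 0 < l := by omega
  have hm0 : (0 : ℝ) < m := by exact_mod_cast hm
  have hl0 : (0 : ℝ) < l := by exact_mod_cast hl
  have e1 : m + l - m = l := by omega
  rw [e1]
  have hs : ((m + l : ℕ) : ℝ) = (m : ℝ) + l := by push_cast; ring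
  have hK : (0 : ℝ) < (m : ℝ) + l := by linarith
  have u1 : 1 + (2 * (m : ℝ) - (m + l)) / (m + l) = 2 * m / (m + l) := by field_simp; ring
  have u2 : 1 - (2 * (m : ℝ) - (m + l)) / (m + l) = 2 * l / (m + l) := by field_simp; ring
  rw [hs, u1, u2]
  have hexp : Real.exp (-(((m : ℝ) + l) * (2 * m / (m + l) * Real.log (2 * m / (m + l))
      + 2 * l / (m + l) * Real.log (2 * l / (m + l)))) / 2)
      = ((2 * m / (m + l)) ^ m * (2 * l / (m + l)) ^ l : ℝ)⁻¹ := by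
    have : -(((m : ℝ) + l) * (2 * m / (m + l) * Real.log (2 * m / (m + l))
      + 2 * l / (m + l) * Real.log (2 * l / (m + l)))) / 2
      = -(m * Real.log (2 * m / (m + l)) + l * Real.log (2 * l / (m + l))) := by
      field_simp
    rw [this, Real.exp_neg, Real.exp_add, Real.exp_nat_mul, Real.exp_nat_mul,
      Real.exp_log (by positivity), Real.exp_log (by positivity)]
  rw [hexp, Nat.cast_add_choose]
  simp only [Stirling.stirlingSeq]
  rw [hs]
  have s1 : √(2 * ((m : ℝ) + l)) = √2 * √((m : ℝ) + l) := Real.sqrt_mul (by norm_num) _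
  have s2 : √(2 * (m : ℝ) / (m + l)) = √(2 * (m : ℝ)) / √((m : ℝ) + l) :=
    Real.sqrt_div (by positivity) _
  have s3 : √(2 * (l : ℝ) / (m + l)) = √(2 * (l : ℝ)) / √((m : ℝ) + l) :=
    Real.sqrt_div (by positivity) _
  rw [s1, s2, s3]
  have p1 : 0 < √((m : ℝ) + l) := Real.sqrt_pos.2 hK
  have p2 : 0 < √(2 * (m : ℝ)) := Real.sqrt_pos.2 (by positivity)
  have p3 : 0 < √(2 * (l : ℝ)) := Real.sqrt_pos.2 (by positivity)
  have p4 : 0 < √(2 : ℝ) := Real.sqrt_pos.2 (by positivity)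
  have p5 : 0 < Real.exp 1 := Real.exp_pos 1
  simp only [div_pow, mul_pow, pow_add]
  field_simp

/-- Local central limit theorem of de Moivre and Laplace. -/
theorem tendsto_sqrt_mul_choose (hk : Tendsto k atTop atTop)
    (hm : Tendsto (fun n => (2 * (m n : ℝ) - k n) / √(k n)) atTop (𝓝 y)) :
    Tendsto (fun n => √(k n : ℝ) * ((k n).choose (m n) : ℝ) / 2 ^ k n) atTop
      (𝓝 (√(2 / Real.pi) * Real.exp (-y ^ 2 / 2))) := by
  have hm' := deviation_compl hk hm
  have h1 := (Stirling.tendsto_stirlingSeq_sqrt_pi.comp hk).div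
    ((Stirling.tendsto_stirlingSeq_sqrt_pi.comp (tendsto_atTop_of_deviation hk hm)).mul
      (Stirling.tendsto_stirlingSeq_sqrt_pi.comp (tendsto_atTop_of_deviation hk hm')))
    (by positivity)
  have h2 := (tendsto_const_nhds (x := √(2 : ℝ))).div
    ((tendsto_half hk hm).sqrt.mul (tendsto_half hk hm').sqrt) (by simp)
  have h3 := (Real.continuous_exp.tendsto _).comp ((tendsto_entropy hk hm).neg.div_const 2)
  have h := (h1.mul h2).mul h3
  have hlim : √Real.pi / (√Real.pi * √Real.pi) * (√2 / (√1 * √1)) * Real.exp (-y ^ 2 / 2)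
      = √(2 / Real.pi) * Real.exp (-y ^ 2 / 2) := by
    rw [Real.sqrt_div (by norm_num), Real.sqrt_one]
    have : 0 < √Real.pi := Real.sqrt_pos.2 Real.pi_pos
    field_simp
  rw [hlim] at h
  refine h.congr' ?_
  filter_upwards [eventually_pos_of_deviation hk hm] with n hn
  rw [sqrt_mul_choose_eq hn.2.1 hn.2.2]
  rfl

end Sequences

theorem tendsto_factorial_add_div (j : ℕ) :
    Tendsto (fun n : ℕ => ((n + j).factorial : ℝ) / (n.factorial * (n : ℝ) ^ j)) atTop (𝓝 1) := by
  induction j with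
  | zero =>
    refine tendsto_const_nhds.congr fun n => ?_
    have : (n.factorial : ℝ) ≠ 0 := by positivity
    simp [this]
  | succ j ih =>
    have h : Tendsto (fun n : ℕ => 1 + ((j : ℝ) + 1) / (n : ℝ)) atTop (𝓝 (1 + 0)) :=
      (tendsto_const_div_atTop_nhds_zero_nat _).const_add 1
    have h2 := ih.mul h
    rw [add_zero, mul_one] at h2
    refine h2.congr' ?_
    filter_upwards [eventually_gt_atTop 0] with n hn
    have : (0 : ℝ) < n := by exact_mod_cast hn
    rw [← add_assoc, Nat.factorial_succ]
    push_cast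
    field_simp
    ring

/-- The factor which belongs to one endpoint in the product formula, in the central limit
scaling. -/
theorem tendsto_endpoint_factor {k m : ℕ → ℕ} {y : ℝ} (hk : Tendsto k atTop atTop)
    (hm : Tendsto (fun n => (2 * (m n : ℝ) - k n) / √(k n)) atTop (𝓝 y)) {p j : ℕ} (hj : j < p) :
    Tendsto (fun n => √(k n : ℝ) * (k n : ℝ) ^ (p - 1 - j) *
      ((k n + j).factorial / ((m n).factorial * (k n + p - 1 - m n).factorial) : ℝ)
        / 2 ^ (k n + p - 1)) atTop (𝓝 (√(2 / Real.pi) * Real.exp (-y ^ 2 / 2))) := by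
  obtain ⟨q, rfl⟩ : ∃ q, p = j + q + 1 := ⟨p - 1 - j, by omega⟩
  have hm' := deviation_compl hk hm
  have h1 := tendsto_sqrt_mul_choose hk hm
  have h2 := (tendsto_factorial_add_div j).comp hk
  have h3 := (tendsto_factorial_add_div (j + q)).comp (tendsto_atTop_of_deviation hk hm')
  have h4 := (tendsto_half hk hm').pow (j + q)
  have h := (h1.mul h2).mul ((h3.inv₀ one_ne_zero).mul (h4.inv₀ (by simp)))
  simp only [mul_one, inv_one, one_pow] at h
  refine h.congr' ?_
  filter_upwards [eventually_pos_of_deviation hk hm] with n hn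
  obtain ⟨l, hl⟩ : ∃ l, k n = m n + l := ⟨k n - m n, by omega⟩
  have e1 : k n - m n = l := by omega
  have e2 : k n + (j + q + 1) - 1 - m n = l + (j + q) := by omega
  have e3 : k n + (j + q + 1) - 1 = k n + (j + q) := by omega
  have e4 : j + q + 1 - 1 - j = q := by omega
  have hk0 : (0 : ℝ) < k n := by exact_mod_cast hn.1
  have hl0 : (0 : ℝ) < l := by
    have : 0 < l := by omega
    exact_mod_cast this
  simp only [Function.comp]
  rw [e1, e2, e3, e4, Nat.cast_choose ℝ hn.2.2.le, e1, div_pow, mul_pow, pow_add _ _ (j + q),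
    pow_add _ j q]
  field_simp
  ring


/-! ### Local limit theorem for watermelons -/

/-- The part of the product formula for `pathDet` which does not contain differences of
endpoints. -/
noncomputable def endpointProd (p k : ℕ) (m : Fin p → ℕ) : ℝ :=
  ∏ j : Fin p, ((k + j).factorial / ((m j).factorial * (k + p - 1 - m j).factorial) : ℝ)

theorem prod_pairs_const (p : ℕ) (c : ℝ) :
    ∏ i : Fin p, ∏ _j ∈ Finset.Ioi i, c ^ 2 = c ^ (p * (p - 1)) := by
  simp only [Finset.prod_const, Fin.card_Ioi, ← pow_mul]
  rw [Finset.prod_pow_eq_pow_sum, ← Equiv.sum_comp Fin.revPerm, ← Finset.sum_range_id_mul_two,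
    Finset.sum_range, Finset.sum_mul]
  congr 1
  refine Finset.sum_congr rfl fun i _ => ?_
  have := i.2
  simp only [Fin.revPerm_apply, Fin.val_rev]
  rw [mul_comm]; congr 1; omega

/-- The powers of `√k` which normalise the endpoint factors combine to the power `p²`. -/
theorem prod_sqrt_mul_pow (p k : ℕ) :
    ∏ j : Fin p, (√(k : ℝ) * (k : ℝ) ^ (p - 1 - (j : ℕ))) = √(k : ℝ) ^ (p ^ 2) := by
  have h := prod_pairs_const p (√(k : ℝ))
  simp only [Finset.prod_const, Fin.card_Ioi, Real.sq_sqrt (Nat.cast_nonneg k)] at h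
  rw [Finset.prod_mul_distrib, h, Finset.prod_const, Finset.card_univ, Fintype.card_fin, ← pow_add]
  congr 1
  rcases p with _ | p
  · rfl
  · rw [Nat.add_sub_cancel]; ring

theorem tendsto_endpointProd {p : ℕ} {k : ℕ → ℕ} {m : ℕ → Fin p → ℕ} {y : Fin p → ℝ}
    (hk : Tendsto k atTop atTop)
    (hm : ∀ j, Tendsto (fun n => (2 * (m n j : ℝ) - k n) / √(k n)) atTop (𝓝 (y j))) :
    Tendsto (fun n => √(k n : ℝ) ^ (p ^ 2) * endpointProd p (k n) (m n)
        / (2 ^ (k n + p - 1)) ^ p) atTop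
      (𝓝 (∏ j, (√(2 / Real.pi) * Real.exp (-y j ^ 2 / 2)))) := by
  have h := tendsto_finsetProd Finset.univ fun j (_ : j ∈ Finset.univ) =>
    tendsto_endpoint_factor hk (hm j) j.2
  refine h.congr fun n => ?_
  rw [Finset.prod_div_distrib, Finset.prod_mul_distrib, prod_sqrt_mul_pow, endpointProd]
  simp

open Classical in
theorem card_watermelon_at_eq {p n k l : ℕ} (h : k + l = 2 * n) (e : Fin p → ℤ)
    (he : StrictMono e) :
    (Fintype.card {w : Watermelon p (2 * n) // (fun i => branch w.1 i k) = e} : ℝ)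
      = pathDet k (startLevel p) e * pathDet l (startLevel p) e := by
  rw [← card_watermelon_at p k l e he]
  rw! [h]
  rfl

open Classical in
/-- The probability that the branches of a uniform watermelon are at the levels `e` at
time `k`. -/
noncomputable def watermelonProb (p n k : ℕ) (e : Fin p → ℤ) : ℝ :=
  (Fintype.card {w : Watermelon p (2 * n) // (fun i => branch w.1 i k) = e} : ℝ) /
    Fintype.card (Watermelon p (2 * n))

/-- The probability as a product. The levels are given by the numbers `m j` of up-steps (for a path
from `0`) in the first `k` steps, and by the corresponding numbers `m' j` for the last `l` steps
read backwards. -/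
theorem watermelonProb_eq {p n k l : ℕ} (h : k + l = 2 * n) (hn : p ≤ n) (m m' : Fin p → ℕ)
    (hm : StrictMono m) (hmm' : ∀ j, 2 * (m j : ℤ) - k = 2 * (m' j : ℤ) - l)
    (h1 : ∀ j, p ≤ m j) (h2 : ∀ j, m j ≤ k) (h1' : ∀ j, p ≤ m' j) (h2' : ∀ j, m' j ≤ l) :
    watermelonProb p n k (fun j => 2 * (m j : ℤ) - k)
      = (∏ i : Fin p, ∏ j ∈ Finset.Ioi i, ((m j : ℝ) - m i)) ^ 2 * endpointProd p k m *
        endpointProd p l m' /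
        ((∏ j : Fin p, ((j : ℕ).factorial : ℝ)) * endpointProd p (2 * n) fun j => n + j) := by
  have he : StrictMono fun j => 2 * (m j : ℤ) - k := fun i j hij => by
    have := hm hij
    simp only
    omega
  rw [watermelonProb, card_watermelon_at_eq h _ he, card_watermelon]
  rw [pathDet_startLevel m (fun j => by have := h1 j; omega) h2]
  simp only [hmm']
  rw [pathDet_startLevel m' (fun j => by have := h1' j; omega) h2']
  have hst : startLevel p = fun j : Fin p => 2 * ((n + (j : ℕ) : ℕ) : ℤ) - (2 * n : ℕ) := by
    funext j; simp only [startLevel]; push_cast; ring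
  have hden := pathDet_startLevel (p := p) (k := 2 * n) (fun j => n + j)
    (fun j => by omega) (fun j => by have := j.2; omega)
  rw [← hst] at hden
  rw [hden]
  have hv : ∏ i : Fin p, ∏ j ∈ Finset.Ioi i, (((n + j : ℕ) : ℝ) - (n + i : ℕ))
      = ∏ j : Fin p, ((j : ℕ).factorial : ℝ) := by
    rw [← det_vandermonde_range, Matrix.det_vandermonde]
    push_cast
    simp
  have hv' : ∏ i : Fin p, ∏ j ∈ Finset.Ioi i, ((m' j : ℝ) - m' i)
      = ∏ i : Fin p, ∏ j ∈ Finset.Ioi i, ((m j : ℝ) - m i) := by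
    refine Finset.prod_congr rfl fun i _ => Finset.prod_congr rfl fun j _ => ?_
    have a : (m' j : ℤ) - m' i = m j - m i := by
      have := hmm' i
      have := hmm' j
      omega
    exact_mod_cast a
  rw [hv, hv']
  simp only [endpointProd]
  congr 1
  ring

section LocalLimit

variable {p : ℕ} {t : ℝ} {x : Fin p → ℝ}

/-- The midpoint coordinate of the lattice point of mesh `2 / √(2n)` just below `x`. -/
noncomputable def latticeFloor (p n k : ℕ) (x : Fin p → ℝ) (j : Fin p) : ℤ :=
  ⌊(x j * √(2 * (n : ℝ)) + k) / 2⌋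

/-- The piecewise constant density on `ℝ^p` given by the watermelon at time `k`. -/
noncomputable def smearedDensity (p n k : ℕ) (x : Fin p → ℝ) : ℝ :=
  (√(2 * (n : ℝ)) / 2) ^ p * watermelonProb p n k fun j => 2 * latticeFloor p n k x j - k

theorem tendsto_sqrt_two_mul : Tendsto (fun n : ℕ => √(2 * (n : ℝ))) atTop atTop :=
  Real.tendsto_sqrt_atTop.comp
    (tendsto_natCast_atTop_atTop.const_mul_atTop (by norm_num : (0 : ℝ) < 2))

theorem tendsto_latticeFloor (k : ℕ → ℕ) (j : Fin p) :
    Tendsto (fun n => (2 * (latticeFloor p n (k n) x j : ℝ) - k n) / √(2 * (n : ℝ))) atTop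
      (𝓝 (x j)) := by
  have h0 : Tendsto (fun n : ℕ => 2 / √(2 * (n : ℝ))) atTop (𝓝 0) :=
    tendsto_const_nhds.div_atTop tendsto_sqrt_two_mul
  have h1 : Tendsto (fun n : ℕ => x j - 2 / √(2 * (n : ℝ))) atTop (𝓝 (x j)) := by
    simpa using h0.const_sub (x j)
  refine tendsto_of_tendsto_of_tendsto_of_le_of_le' h1 tendsto_const_nhds ?_ ?_
  · filter_upwards [tendsto_sqrt_two_mul.eventually_gt_atTop 0] with n hn
    have := Int.lt_floor_add_one ((x j * √(2 * (n : ℝ)) + k n) / 2)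
    rw [sub_le_iff_le_add, ← add_div, le_div_iff₀ hn]
    unfold latticeFloor
    linarith
  · filter_upwards [tendsto_sqrt_two_mul.eventually_gt_atTop 0] with n hn
    have := Int.floor_le ((x j * √(2 * (n : ℝ)) + k n) / 2)
    rw [div_le_iff₀ hn]
    unfold latticeFloor
    linarith

theorem tendsto_floor_div (ht : 0 < t) :
    Tendsto (fun n : ℕ => ((⌊2 * (n : ℝ) * t⌋₊ : ℕ) : ℝ) / (2 * n)) atTop (𝓝 t) := by
  have h := (tendsto_nat_floor_mul_div_atTop (R := ℝ) ht.le).comp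
    (tendsto_natCast_atTop_atTop.const_mul_atTop (by norm_num : (0 : ℝ) < 2) :
      Tendsto (fun n : ℕ => 2 * (n : ℝ)) atTop atTop)
  refine h.congr fun n => ?_
  simp only [Function.comp]
  rw [mul_comm t]

/-- The local limit theorem for the position of a watermelon. -/
theorem tendsto_smearedDensity (ht : t ∈ Set.Ioo (0 : ℝ) 1) (hx : StrictMono x) :
    Tendsto (fun n : ℕ => smearedDensity p n ⌊2 * (n : ℝ) * t⌋₊ x) atTop
      (𝓝 (1 / (√(2 * Real.pi) ^ p * √(t * (1 - t)) ^ (p ^ 2) *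
        ∏ i ∈ Finset.range p, (Nat.factorial i : ℝ)) *
        (∏ i : Fin p, ∏ j ∈ Finset.Ioi i, (x j - x i) ^ 2) *
        Real.exp (-(∑ j, x j ^ 2) / (2 * t * (1 - t))))) := by
  obtain ⟨ht0, ht1⟩ := ht
  have ht1' : 0 < 1 - t := by linarith
  set k : ℕ → ℕ := fun n => ⌊2 * (n : ℝ) * t⌋₊ with hk_def
  have hkle : ∀ n, k n ≤ 2 * n := fun n => by
    refine Nat.floor_le_of_le ?_
    push_cast
    nlinarith [(Nat.cast_nonneg n : (0 : ℝ) ≤ n)]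
  set l : ℕ → ℕ := fun n => 2 * n - k n with hl_def
  have hkl : ∀ n, k n + l n = 2 * n := fun n => by have := hkle n; simp only [hl_def]; omega
  have hlR : ∀ n, (l n : ℝ) = 2 * n - k n := fun n => by
    have : ((k n + l n : ℕ) : ℝ) = (2 * n : ℕ) := by rw [hkl]
    push_cast at this; linarith
  have hN : Tendsto (fun n : ℕ => 2 * (n : ℝ)) atTop atTop :=
    tendsto_natCast_atTop_atTop.const_mul_atTop (by norm_num : (0 : ℝ) < 2)
  have hkt : Tendsto (fun n => (k n : ℝ) / (2 * n)) atTop (𝓝 t) := tendsto_floor_div ht0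
  have hlt : Tendsto (fun n => (l n : ℝ) / (2 * n)) atTop (𝓝 (1 - t)) := by
    refine (hkt.const_sub 1).congr' ?_
    filter_upwards [hN.eventually_gt_atTop 0] with n hn
    rw [hlR, sub_div, div_self hn.ne']
  have toTop : ∀ {k : ℕ → ℕ} {t : ℝ}, 0 < t → Tendsto (fun n => (k n : ℝ) / (2 * n)) atTop (𝓝 t) →
      Tendsto k atTop atTop := by
    intro k t ht h
    rw [← tendsto_natCast_atTop_iff (R := ℝ)]
    refine (h.pos_mul_atTop ht hN).congr' ?_
    filter_upwards [hN.eventually_gt_atTop 0] with n hn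
    exact div_mul_cancel₀ _ hn.ne'
  have hk := toTop ht0 hkt
  have hl := toTop ht1' hlt
  -- The levels at time `k n` are `2 z_j - k n`; read backwards from the end they are `2 z'_j - l n`.
  set z : ℕ → Fin p → ℤ := fun n => latticeFloor p n (k n) x with hz_def
  have hz : ∀ j, Tendsto (fun n => (2 * (z n j : ℝ) - k n) / √(2 * (n : ℝ))) atTop (𝓝 (x j)) :=
    fun j => tendsto_latticeFloor k j
  have hsq : Tendsto (fun n : ℕ => √(2 * (n : ℝ))) atTop atTop := tendsto_sqrt_two_mul
  have scale : ∀ {k : ℕ → ℕ} {t : ℝ}, 0 < t →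
      Tendsto (fun n => (k n : ℝ) / (2 * n)) atTop (𝓝 t) → ∀ {e : ℕ → ℝ} {a : ℝ},
      Tendsto (fun n => e n / √(2 * (n : ℝ))) atTop (𝓝 a) →
      Tendsto (fun n => e n / √(k n : ℝ)) atTop (𝓝 (a / √t)) := by
    intro k t ht h e a he
    refine (he.div h.sqrt (Real.sqrt_pos.2 ht).ne').congr' ?_
    filter_upwards [hN.eventually_gt_atTop 0] with n hn
    rw [Pi.div_apply, Real.sqrt_div (Nat.cast_nonneg _)]
    have := Real.sqrt_pos.2 hn
    rw [div_div_div_cancel_right₀ this.ne']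
  have toTopZ : ∀ {k : ℕ → ℕ} {t : ℝ}, 0 < t →
      Tendsto (fun n => (k n : ℝ) / (2 * n)) atTop (𝓝 t) → ∀ {u : ℕ → ℤ} {a : ℝ},
      Tendsto (fun n => (2 * (u n : ℝ) - k n) / √(2 * (n : ℝ))) atTop (𝓝 a) →
      ∀ᶠ n in atTop, (p : ℤ) ≤ u n ∧ u n ≤ k n := by
    intro k t ht h u a hu
    have h0 : Tendsto (fun n => (2 * (u n : ℝ) - k n) / (2 * n)) atTop (𝓝 0) := by
      refine (hu.div_atTop hsq).congr fun n => ?_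
      rw [div_div, Real.mul_self_sqrt (by positivity)]
    have h1 : Tendsto (fun n => (u n : ℝ) / (2 * n)) atTop (𝓝 (t / 2)) := by
      have h3 := (h0.add h).div_const 2
      rw [zero_add] at h3
      refine h3.congr fun n => ?_
      ring
    have h2 := h1.pos_mul_atTop (by linarith) hN
    have h3 := h1.eventually_lt h (by linarith)
    filter_upwards [h2.eventually_ge_atTop (p : ℝ), hN.eventually_gt_atTop 0, h3] with n hn1 hn2 hn3
    rw [div_mul_cancel₀ _ hn2.ne'] at hn1
    rw [div_lt_div_iff_of_pos_right hn2] at hn3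
    exact ⟨by exact_mod_cast hn1, by exact_mod_cast hn3.le⟩
  set z' : ℕ → Fin p → ℤ := fun n j => z n j + n - k n with hz'_def
  have hzz' : ∀ n j, 2 * z n j - k n = 2 * z' n j - l n := fun n j => by
    have := hkl n
    simp only [hz'_def]
    omega
  have hz' : ∀ j, Tendsto (fun n => (2 * (z' n j : ℝ) - l n) / √(2 * (n : ℝ))) atTop
      (𝓝 (x j)) := fun j => by
    refine (hz j).congr fun n => ?_
    have := hzz' n j
    have h : (2 * (z n j : ℝ) - k n) = 2 * (z' n j : ℝ) - l n := by exact_mod_cast this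
    rw [h]
  have bz : ∀ᶠ n in atTop, ∀ j, (p : ℤ) ≤ z n j ∧ z n j ≤ k n :=
    eventually_all.2 fun j => toTopZ ht0 hkt (hz j)
  have bz' : ∀ᶠ n in atTop, ∀ j, (p : ℤ) ≤ z' n j ∧ z' n j ≤ l n :=
    eventually_all.2 fun j => toTopZ ht1' hlt (hz' j)
  -- `f1` belongs to the first `k n` steps, `f2` to the last `l n` steps, `f3` to the total number
  -- of watermelons, `f4` to the two Vandermonde products, and `f5` collects the powers of `2n`,
  -- `k n` and `l n` with which the other factors are normalised.
  have f1 := tendsto_endpointProd (p := p) (m := fun n j => (z n j).toNat)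
    (y := fun j => x j / √t) hk fun j => by
      refine (scale ht0 hkt (hz j)).congr' ?_
      filter_upwards [bz] with n hn
      have : (((z n j).toNat : ℤ)) = z n j := Int.toNat_of_nonneg (by have := (hn j).1; omega)
      have h : ((z n j).toNat : ℝ) = z n j := by exact_mod_cast this
      rw [h]
  have f2 := tendsto_endpointProd (p := p) (m := fun n j => (z' n j).toNat)
    (y := fun j => x j / √(1 - t)) hl fun j => by
      refine (scale ht1' hlt (hz' j)).congr' ?_
      filter_upwards [bz'] with n hn
      have : (((z' n j).toNat : ℤ)) = z' n j := Int.toNat_of_nonneg (by have := (hn j).1; omega)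
      have h : ((z' n j).toNat : ℝ) = z' n j := by exact_mod_cast this
      rw [h]
  have f3 := tendsto_endpointProd (p := p) (k := fun n => 2 * n) (m := fun n j => n + j)
    (y := fun j => 0) (tendsto_id.const_mul_atTop' (by norm_num)) fun j => by
      have : Tendsto (fun n : ℕ => 2 * (j : ℝ) / √(2 * (n : ℝ))) atTop (𝓝 0) :=
        tendsto_const_nhds.div_atTop hsq
      refine this.congr fun n => ?_
      push_cast
      congr 1
      ring
  have f4 : Tendsto (fun n => ∏ i : Fin p, ∏ j ∈ Finset.Ioi i,
      (((z n j : ℝ) - z n i) * (2 / √(2 * (n : ℝ)))) ^ 2) atTop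
      (𝓝 (∏ i : Fin p, ∏ j ∈ Finset.Ioi i, (x j - x i) ^ 2)) := by
    refine tendsto_finsetProd _ fun i _ => tendsto_finsetProd _ fun j _ => ?_
    refine (((hz j).sub (hz i)).pow 2).congr fun n => ?_
    ring
  have f5 : Tendsto (fun n : ℕ => (2 * (n : ℝ) / (√(k n : ℝ) * √(l n : ℝ))) ^ (p ^ 2)) atTop
      (𝓝 ((1 / √(t * (1 - t))) ^ (p ^ 2))) := by
    refine Tendsto.pow ?_ _
    have h := (tendsto_const_nhds (x := (1 : ℝ))).div (hkt.mul hlt).sqrt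
      (Real.sqrt_pos.2 (by positivity)).ne'
    refine h.congr' ?_
    filter_upwards [hN.eventually_gt_atTop 0] with n hn
    rw [Pi.div_apply, div_mul_div_comm, Real.sqrt_div (by positivity), Real.sqrt_mul_self hn.le,
      Real.sqrt_mul (Nat.cast_nonneg _), one_div_div]
  have hf3 : ∏ j : Fin p, (√(2 / Real.pi) * Real.exp (-(0 : ℝ) ^ 2 / 2)) ≠ 0 := by
    refine Finset.prod_ne_zero_iff.2 fun j _ => ?_
    have : 0 < √(2 / Real.pi) := Real.sqrt_pos.2 (by positivity)
    positivity
  have f := ((((f4.mul f1).mul f2).div f3 hf3).mul f5).mul_const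
    ((1 / 2) ^ p / ∏ j : Fin p, ((j : ℕ).factorial : ℝ))
  have hlim : (∏ i : Fin p, ∏ j ∈ Finset.Ioi i, (x j - x i) ^ 2) *
      (∏ j, (√(2 / Real.pi) * Real.exp (-(x j / √t) ^ 2 / 2))) *
      (∏ j, (√(2 / Real.pi) * Real.exp (-(x j / √(1 - t)) ^ 2 / 2))) /
      (∏ j : Fin p, (√(2 / Real.pi) * Real.exp (-(0 : ℝ) ^ 2 / 2))) *
      (1 / √(t * (1 - t))) ^ (p ^ 2) * ((1 / 2) ^ p / ∏ j : Fin p, ((j : ℕ).factorial : ℝ))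
      = 1 / (√(2 * Real.pi) ^ p * √(t * (1 - t)) ^ (p ^ 2) *
        ∏ i ∈ Finset.range p, (Nat.factorial i : ℝ)) *
        (∏ i : Fin p, ∏ j ∈ Finset.Ioi i, (x j - x i) ^ 2) *
        Real.exp (-(∑ j, x j ^ 2) / (2 * t * (1 - t))) := by
    simp only [Finset.prod_mul_distrib, ← Real.exp_sum]
    have hexp : Real.exp (∑ j, -(x j / √t) ^ 2 / 2) * Real.exp (∑ j, -(x j / √(1 - t)) ^ 2 / 2)
        = Real.exp (-(∑ j, x j ^ 2) / (2 * t * (1 - t))) := by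
      rw [← Real.exp_add, ← Finset.sum_add_distrib, ← Finset.sum_neg_distrib, Finset.sum_div]
      congr 1
      refine Finset.sum_congr rfl fun j _ => ?_
      rw [div_pow, div_pow, Real.sq_sqrt ht0.le, Real.sq_sqrt ht1'.le]
      field_simp
      ring
    have h0 : Real.exp (∑ _j : Fin p, -(0 : ℝ) ^ 2 / 2) = 1 := by simp
    have hs : √(2 / Real.pi) * (1 / 2) = 1 / √(2 * Real.pi) := by
      rw [Real.sqrt_div (by norm_num), Real.sqrt_mul (by norm_num)]
      have h2 : √2 * √2 = (2 : ℝ) := Real.mul_self_sqrt (by norm_num)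
      have : 0 < √Real.pi := Real.sqrt_pos.2 Real.pi_pos
      have : 0 < √(2 : ℝ) := Real.sqrt_pos.2 (by norm_num)
      field_simp
      nlinarith
    rw [← hexp, h0, Finset.prod_range, Finset.prod_const, Finset.card_univ, Fintype.card_fin]
    have hs' : √(2 / Real.pi) ^ p * (1 / 2) ^ p = 1 / √(2 * Real.pi) ^ p := by
      rw [← mul_pow, hs, div_pow, one_pow]
    have : 0 < √(2 / Real.pi) := Real.sqrt_pos.2 (by positivity)
    rw [mul_one, div_pow 1 (√(t * (1 - t))), one_pow]
    generalize Real.exp (∑ j, -(x j / √t) ^ 2 / 2) = E1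
    generalize Real.exp (∑ j, -(x j / √(1 - t)) ^ 2 / 2) = E2
    generalize (∏ i : Fin p, ∏ j ∈ Finset.Ioi i, (x j - x i) ^ 2) = V
    generalize √(t * (1 - t)) ^ (p ^ 2) = S
    generalize ∏ j : Fin p, ((j : ℕ).factorial : ℝ) = Fa
    have hne : √(2 / Real.pi) ^ p ≠ 0 := by positivity
    calc _ = (√(2 / Real.pi) ^ p * (1 / 2) ^ p) * (V * E1 * E2 * (1 / S) / Fa) := by
          field_simp
      _ = _ := by rw [hs', one_div_mul_eq_div, one_div_mul_eq_div]; field_simp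
  rw [hlim] at f
  refine f.congr' ?_
  have hzmono : ∀ᶠ n in atTop, ∀ i j, i < j → z n i < z n j := by
    refine eventually_all.2 fun i => eventually_all.2 fun j => ?_
    by_cases hij : i < j
    · filter_upwards [(hz i).eventually_lt (hz j) (hx hij), hsq.eventually_gt_atTop 0] with n hn hn2
      rw [div_lt_div_iff_of_pos_right hn2] at hn
      intro _
      have : (z n i : ℝ) < z n j := by linarith
      exact_mod_cast this
    · exact Eventually.of_forall fun n h => absurd h hij
  filter_upwards [bz, bz', hzmono, eventually_ge_atTop p, hN.eventually_gt_atTop 0,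
    hk.eventually_gt_atTop 0, hl.eventually_gt_atTop 0] with n b b' hmono hpn hn0 hk0 hl0
  -- For large `n` the sequence with limit `f` is `smearedDensity`: the product formula applies, and
  -- after abstracting the powers what remains is an identity of rational functions.
  have c : ∀ j, (((z n j).toNat : ℤ)) = z n j := fun j =>
    Int.toNat_of_nonneg (by have := (b j).1; omega)
  have c' : ∀ j, (((z' n j).toNat : ℤ)) = z' n j := fun j =>
    Int.toNat_of_nonneg (by have := (b' j).1; omega)
  have cR : ∀ j, ((z n j).toNat : ℝ) = z n j := fun j => by exact_mod_cast c j
  have key := watermelonProb_eq (hkl n) hpn (fun j => (z n j).toNat) (fun j => (z' n j).toNat)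
    (fun i j hij => by have := hmono i j hij; have := c i; have := c j; simp only; omega)
    (fun j => by rw [c, c']; exact hzz' n j)
    (fun j => by have := b j; have := c j; omega) (fun j => by have := b j; have := c j; omega)
    (fun j => by have := b' j; have := c' j; omega) (fun j => by have := b' j; have := c' j; omega)
  simp only [c, cR] at key
  rw [smearedDensity, key]
  simp only [Pi.div_apply, mul_pow, Finset.prod_mul_distrib, prod_pairs_const]
  have hV : ∏ i : Fin p, ∏ j ∈ Finset.Ioi i, ((z n j : ℝ) - z n i) ^ 2
      = (∏ i : Fin p, ∏ j ∈ Finset.Ioi i, ((z n j : ℝ) - z n i)) ^ 2 := by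
    simp only [Finset.prod_pow]
  rw [hV]
  generalize (∏ i : Fin p, ∏ j ∈ Finset.Ioi i, ((z n j : ℝ) - z n i)) ^ 2 = V
  generalize endpointProd p (k n) _ = A1
  generalize endpointProd p (l n) _ = A2
  have hA3 : endpointProd p (2 * n) (fun j => n + j) ≠ 0 :=
    Finset.prod_ne_zero_iff.2 fun j _ => by positivity
  generalize endpointProd p (2 * n) _ = A3 at hA3 ⊢
  have hFa : ∏ j : Fin p, ((j : ℕ).factorial : ℝ) ≠ 0 :=
    Finset.prod_ne_zero_iff.2 fun j _ => by positivity
  generalize ∏ j : Fin p, ((j : ℕ).factorial : ℝ) = Fa at hFa ⊢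
  have hk0' : 0 < √(k n : ℝ) := Real.sqrt_pos.2 (by exact_mod_cast hk0)
  have hl0' : 0 < √(l n : ℝ) := Real.sqrt_pos.2 (by exact_mod_cast hl0)
  have hs0 : 0 < √(2 * (n : ℝ)) := Real.sqrt_pos.2 hn0
  have hss : (2 * (n : ℝ)) = √(2 * (n : ℝ)) ^ 2 := (Real.sq_sqrt hn0.le).symm
  have hcast : ((2 * n : ℕ) : ℝ) = 2 * (n : ℝ) := by push_cast; ring
  rw [hcast]
  have hpow : ((2 : ℝ) ^ (k n + p - 1)) ^ p * (2 ^ (l n + p - 1)) ^ p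
      = (2 ^ (2 * n + p - 1)) ^ p * 2 ^ (p * (p - 1)) := by
    rcases p with _ | p
    · simp
    · rw [← mul_pow, ← pow_add, ← pow_mul, ← pow_mul, ← pow_add, ← hkl n]
      congr 1
      simp only [Nat.add_succ_sub_one]
      ring
  generalize √(k n : ℝ) = a at hk0' ⊢
  generalize √(l n : ℝ) = b0 at hl0' ⊢
  have hN2 : (2 * (n : ℝ) / (a * b0)) ^ (p ^ 2)
      = (√(2 * (n : ℝ)) ^ (p ^ 2)) ^ 2 / (a ^ (p ^ 2) * b0 ^ (p ^ 2)) := by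
    rw [div_pow, mul_pow a b0, ← pow_mul, mul_comm (p ^ 2) 2, pow_mul, ← hss]
  rw [hN2]
  generalize √(2 * (n : ℝ)) = s at hs0 ⊢
  have e1 : p ^ 2 = p * (p - 1) + p := by
    rcases p with _ | p
    · rfl
    · simp only [Nat.add_sub_cancel]; ring
  have hP1 : ((2 : ℝ) ^ (k n + p - 1)) ^ p ≠ 0 := by positivity
  have hP2 : ((2 : ℝ) ^ (l n + p - 1)) ^ p ≠ 0 := by positivity
  have hP3 : ((2 : ℝ) ^ (2 * n + p - 1)) ^ p ≠ 0 := by positivity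
  generalize ((2 : ℝ) ^ (k n + p - 1)) ^ p = P1 at *
  generalize ((2 : ℝ) ^ (l n + p - 1)) ^ p = P2 at *
  generalize ((2 : ℝ) ^ (2 * n + p - 1)) ^ p = P3 at *
  have ha : a ^ (p ^ 2) ≠ 0 := by positivity
  have hb : b0 ^ (p ^ 2) ≠ 0 := by positivity
  generalize a ^ (p ^ 2) = a' at *
  generalize b0 ^ (p ^ 2) = b' at *
  have hs2 : s ^ (p ^ 2) = s ^ (p * (p - 1)) * s ^ p := by rw [← pow_add, ← e1]
  rw [hs2, div_pow, div_pow, div_pow, one_pow]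
  have hsp : s ^ p ≠ 0 := by positivity
  have hsq' : s ^ (p * (p - 1)) ≠ 0 := by positivity
  generalize s ^ (p * (p - 1)) = s1 at *
  generalize s ^ p = s2 at *
  have h2a : (2 : ℝ) ^ (p * (p - 1)) ≠ 0 := by positivity
  generalize (2 : ℝ) ^ (p * (p - 1)) = q at *
  have h2b : (2 : ℝ) ^ p ≠ 0 := by positivity
  generalize (2 : ℝ) ^ p = r at *
  have : P3 = P1 * P2 / q := by rw [hpow]; field_simp
  rw [this]
  field_simp

end LocalLimit


/-! ### From the local limit to open sets -/

section OpenSets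

variable {p : ℕ}

/-- All branches alternately go up and down. -/
theorem isWatermelon_alternating (p n : ℕ) :
    IsWatermelon (p := p) (m := 2 * n) fun _ j => decide (Even (j : ℕ)) := by
  constructor
  · intro i
    have h : ∀ n : ℕ,
        (∑ j : Fin (2 * n), if decide (Even (j : ℕ)) = true then (1 : ℤ) else -1) = 0 := by
      intro n
      rw [Finset.sum_fin_eq_sum_range]
      induction n with
      | zero => rfl
      | succ n ih =>
        rw [show 2 * (n + 1) = 2 * n + 1 + 1 by ring, Finset.sum_range_succ, Finset.sum_range_succ]
        rw [← Finset.sum_congr rfl fun j hj => ?_, ih]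
        · simp
        · have := Finset.mem_range.1 hj
          rw [dif_pos this, dif_pos (by omega)]
    have h2 := h n
    simp only [branch, bernoulliPath, Fin.is_lt, if_true, add_eq_left]
    exact h2
  · intro k _ i j hij
    have : (i : ℕ) < j := hij
    simp only [branch, bernoulliPath]
    have : (i : ℤ) < j := by exact_mod_cast this
    linarith

instance nonempty_watermelon (p n : ℕ) : Nonempty (Watermelon p (2 * n)) :=
  ⟨⟨_, isWatermelon_alternating p n⟩⟩

theorem uniformOn_branch_eq (p n k : ℕ) (e : Fin p → ℤ) :
    uniformOn Set.univ {w : Watermelon p (2 * n) | (fun i => branch w.1 i k) = e}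
      = ENNReal.ofReal (watermelonProb p n k e) := by
  classical
  rw [uniformOn_univ, watermelonProb, ENNReal.ofReal_div_of_pos (by
    exact_mod_cast Fintype.card_pos), ENNReal.ofReal_natCast, ENNReal.ofReal_natCast,
    Measure.count_apply_finite _ (Set.toFinite _)]
  congr 2
  · rw [← Set.ncard_eq_toFinset_card, ← Nat.card_coe_set_eq, Nat.card_eq_fintype_card]
    exact Fintype.card_congr (Equiv.refl _)

/-- The lattice point with midpoint coordinates `z`. -/
noncomputable def latticePoint (p n k : ℕ) (z : Fin p → ℤ) : EuclideanSpace ℝ (Fin p) :=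
  WithLp.toLp 2 fun j => (2 * (z j : ℝ) - k) / √(2 * (n : ℝ))

theorem measurable_latticeFloor (p n k : ℕ) : Measurable (latticeFloor p n k) := by
  refine measurable_pi_lambda _ fun j => ?_
  exact Int.measurable_floor.comp ((((measurable_pi_apply j).mul_const _).add_const _).div_const _)

theorem volume_latticeFloor_preimage {n : ℕ} (hn : 0 < n) (k : ℕ) (z : Fin p → ℤ) :
    volume (latticeFloor p n k ⁻¹' {z}) = ENNReal.ofReal ((2 / √(2 * (n : ℝ))) ^ p) := by
  have hs : 0 < √(2 * (n : ℝ)) := Real.sqrt_pos.2 (by positivity)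
  have h : latticeFloor p n k ⁻¹' {z} = Set.univ.pi fun j =>
      Set.Ico ((2 * (z j : ℝ) - k) / √(2 * (n : ℝ)))
        ((2 * (z j : ℝ) - k) / √(2 * (n : ℝ)) + 2 / √(2 * (n : ℝ))) := by
    ext x
    simp only [Set.mem_preimage, Set.mem_singleton_iff, funext_iff, Set.mem_univ_pi, Set.mem_Ico,
      latticeFloor, Int.floor_eq_iff]
    refine forall_congr' fun j => ?_
    rw [← add_div, div_le_iff₀ hs, lt_div_iff₀ hs]
    constructor <;> rintro ⟨h1, h2⟩ <;> constructor <;> linarith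
  rw [h, volume_pi_pi]
  rw [ENNReal.ofReal_pow (by positivity)]
  simp only [Real.volume_Ico, add_sub_cancel_left, Finset.prod_const, Finset.card_univ,
    Fintype.card_fin]

open Classical in
/-- The smeared density, restricted to the cells whose lattice point is in `G`. -/
noncomputable def cellDensity (p n k : ℕ) (G : Set (EuclideanSpace ℝ (Fin p)))
    (x : Fin p → ℝ) : ENNReal :=
  if latticePoint p n k (latticeFloor p n k x) ∈ G then
    ENNReal.ofReal (smearedDensity p n k x) else 0

/-- The cells of the lattice points have volume `(2 / √(2n)) ^ p`, so integrating over them sums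
probabilities. -/
theorem lintegral_cellDensity_le {n : ℕ} (hn : 0 < n) (t : ℝ)
    (G : Set (EuclideanSpace ℝ (Fin p))) :
    ∫⁻ x, cellDensity p n ⌊2 * (n : ℝ) * t⌋₊ G x ≤
      uniformOn Set.univ {w : Watermelon p (2 * n) | rescaledWatermelon w t ∈ G} := by
  classical
  set k := ⌊2 * (n : ℝ) * t⌋₊ with hk
  have hs : 0 < √(2 * (n : ℝ)) := Real.sqrt_pos.2 (by positivity)
  set F : (Fin p → ℤ) → ENNReal := fun z => if latticePoint p n k z ∈ G then
    ENNReal.ofReal ((√(2 * (n : ℝ)) / 2) ^ p * watermelonProb p n k fun j => 2 * z j - k) else 0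
    with hF
  have e1 : ∫⁻ x, cellDensity p n k G x
      = ∑' z, F z * ENNReal.ofReal ((2 / √(2 * (n : ℝ))) ^ p) := by
    have : ∀ x, cellDensity p n k G x = F (latticeFloor p n k x) := fun x => rfl
    simp only [this]
    rw [← lintegral_map (Measurable.of_discrete) (measurable_latticeFloor p n k),
      lintegral_countable']
    refine tsum_congr fun z => ?_
    rw [Measure.map_apply (measurable_latticeFloor p n k) (measurableSet_singleton z),
      volume_latticeFloor_preimage hn]
  have e2 : ∀ z, F z * ENNReal.ofReal ((2 / √(2 * (n : ℝ))) ^ p) =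
      uniformOn Set.univ ({w : Watermelon p (2 * n) | (fun i => branch w.1 i k) =
        fun j => 2 * z j - k} ∩ {w | rescaledWatermelon w t ∈ G}) := by
    intro z
    have hpt : ∀ w : Watermelon p (2 * n),
        (fun i => branch w.1 i k) = (fun j => 2 * z j - (k : ℤ)) →
        rescaledWatermelon w t = latticePoint p n k z := by
      intro w hw
      simp only [rescaledWatermelon, latticePoint, ← hk]
      congr 1
      funext i
      rw [congrFun hw i]
      push_cast
      ring
    simp only [hF]
    split_ifs with h
    · rw [Set.inter_eq_left.2 fun w hw => by simpa [hpt w hw] using h, uniformOn_branch_eq,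
        ← ENNReal.ofReal_mul' (by positivity)]
      congr 1
      rw [mul_right_comm, ← mul_pow]
      have : √(2 * (n : ℝ)) / 2 * (2 / √(2 * (n : ℝ))) = 1 := by field_simp
      rw [this, one_pow, one_mul]
    · rw [zero_mul, eq_comm]
      convert measure_empty (μ := uniformOn (Set.univ : Set (Watermelon p (2 * n))))
      ext w
      simp only [Set.mem_inter_iff, Set.mem_ofPred_eq, Set.mem_empty_iff_false, iff_false, not_and]
      intro hw
      rwa [hpt w hw]
  rw [e1]
  simp only [e2]
  refine tsum_meas_le_meas_iUnion_of_disjoint _ (fun z => MeasurableSet.of_discrete) ?_ |>.trans ?_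
  · intro z z' hzz'
    refine Set.disjoint_left.2 fun w hw hw' => hzz' ?_
    have h := hw.1.symm.trans hw'.1
    funext j
    have := congrFun h j
    omega
  · exact measure_mono (Set.iUnion_subset fun z => Set.inter_subset_right)

theorem tendsto_latticePoint (k : ℕ → ℕ) (x : Fin p → ℝ) :
    Tendsto (fun n => latticePoint p n (k n) (latticeFloor p n (k n) x)) atTop
      (𝓝 (WithLp.toLp 2 x)) := by
  refine ((PiLp.continuous_toLp 2 (fun _ : Fin p => ℝ)).tendsto x).comp ?_
  exact tendsto_pi_nhds.2 fun j => tendsto_latticeFloor k j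

theorem limitDensity_eq_zero {t : ℝ} {x : Fin p → ℝ} (hx : ¬ StrictMono x) :
    limitDensity p t (WithLp.toLp 2 x) = 0 := by
  unfold limitDensity
  split_ifs with h
  · have hinj : ¬ Function.Injective x := fun h' => hx (Monotone.strictMono_of_injective h h')
    simp only [Function.Injective, not_forall] at hinj
    obtain ⟨i, j, hij, hne⟩ := hinj
    have : ∏ i : Fin p, ∏ j ∈ Finset.Ioi i, (x j - x i) ^ 2 = 0 := by
      rcases lt_or_gt_of_ne hne with hlt | hlt
      · exact Finset.prod_eq_zero (Finset.mem_univ i)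
          (Finset.prod_eq_zero (Finset.mem_Ioi.2 hlt) (by rw [hij]; ring))
      · exact Finset.prod_eq_zero (Finset.mem_univ j)
          (Finset.prod_eq_zero (Finset.mem_Ioi.2 hlt) (by rw [hij]; ring))
    simp only [this, mul_zero, zero_mul]
  · rfl

theorem limitDensity_of_strictMono {t : ℝ} {x : Fin p → ℝ} (hx : StrictMono x) :
    limitDensity p t (WithLp.toLp 2 x) = 1 / (√(2 * Real.pi) ^ p * √(t * (1 - t)) ^ (p ^ 2) *
        ∏ i ∈ Finset.range p, (Nat.factorial i : ℝ)) *
        (∏ i : Fin p, ∏ j ∈ Finset.Ioi i, (x j - x i) ^ 2) *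
        Real.exp (-(∑ j, x j ^ 2) / (2 * t * (1 - t))) := by
  unfold limitDensity
  rw [if_pos hx.monotone, EuclideanSpace.norm_sq_eq]
  simp

/-- Fatou's lemma turns the local limit theorem into a lower bound for the probabilities of
open sets. -/
theorem withDensity_le_liminf {t : ℝ} (ht : t ∈ Set.Ioo (0 : ℝ) 1)
    {G : Set (EuclideanSpace ℝ (Fin p))} (hG : IsOpen G) :
    (volume.withDensity fun x => ENNReal.ofReal (limitDensity p t x)) G ≤
      liminf (fun n : ℕ => uniformOn Set.univ
        {w : Watermelon p (2 * n) | rescaledWatermelon w t ∈ G}) atTop := by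
  classical
  rw [withDensity_apply _ hG.measurableSet, ← lintegral_indicator hG.measurableSet,
    ← (PiLp.volume_preserving_toLp (Fin p)).lintegral_comp_emb
      (MeasurableEquiv.toLp 2 (Fin p → ℝ)).measurableEmbedding]
  calc _ ≤ ∫⁻ x : Fin p → ℝ,
          liminf (fun n : ℕ => cellDensity p n ⌊2 * (n : ℝ) * t⌋₊ G x) atTop := by
        refine lintegral_mono fun x => ?_
        simp only
        by_cases hx : WithLp.toLp 2 x ∈ G
        · rw [Set.indicator_of_mem hx]
          by_cases hmono : StrictMono x
          · have h := ENNReal.tendsto_ofReal (tendsto_smearedDensity ht hmono)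
            rw [← limitDensity_of_strictMono hmono] at h
            refine (Tendsto.liminf_eq (h.congr' ?_)).ge
            filter_upwards [(tendsto_latticePoint (fun n : ℕ =>
              ⌊2 * (n : ℝ) * t⌋₊) x).eventually_mem (hG.mem_nhds hx)] with n hn
            rw [cellDensity, if_pos hn]
          · rw [limitDensity_eq_zero hmono]
            simp
        · rw [Set.indicator_of_notMem hx]
          exact zero_le
    _ ≤ liminf (fun n : ℕ => ∫⁻ x : Fin p → ℝ, cellDensity p n ⌊2 * (n : ℝ) * t⌋₊ G x) atTop := by
        refine lintegral_liminf_le fun n => ?_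
        exact (Measurable.of_discrete (f := fun z : Fin p → ℤ =>
          if latticePoint p n ⌊2 * (n : ℝ) * t⌋₊ z ∈ G then
          ENNReal.ofReal ((√(2 * (n : ℝ)) / 2) ^ p *
            watermelonProb p n ⌊2 * (n : ℝ) * t⌋₊ fun j => 2 * z j - ⌊2 * (n : ℝ) * t⌋₊)
            else 0)).comp (measurable_latticeFloor p n _)
    _ ≤ _ := by
        refine liminf_le_liminf ?_
        filter_upwards [eventually_gt_atTop 0] with n hn
        exact lintegral_cellDensity_le hn t G

end OpenSets


/-! ### Ordered eigenvalues -/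

section Eigenvalues
open Polynomial

theorem orderedEigenvalues_monotone {p : ℕ} (H : HermitianMatrix p) :
    Monotone fun i => orderedEigenvalues H i :=
  Tuple.monotone_sort (Matrix.IsHermitian.eigenvalues (selfAdjoint.mem_iff.mp H.2))

theorem charpoly_orderedEigenvalues {p : ℕ} (H : HermitianMatrix p) :
    H.1.charpoly = ∏ i, (X - C ((orderedEigenvalues H i : ℝ) : ℂ)) := by
  have hH : H.1.IsHermitian := selfAdjoint.mem_iff.mp H.2
  rw [hH.charpoly_eq]
  exact (Equiv.prod_comp (Tuple.sort hH.eigenvalues)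
    fun i => (X - C ((hH.eigenvalues i : ℝ) : ℂ))).symm

/-- A monotone tuple is determined by the monic polynomial with these roots. -/
theorem eq_of_monotone_of_prod_eq {p : ℕ} {x y : Fin p → ℝ} (hx : Monotone x) (hy : Monotone y)
    (h : ∏ i, (X - C (x i : ℂ)) = ∏ i, (X - C (y i : ℂ))) : x = y := by
  have h1 := congrArg Polynomial.roots h
  have aux : ∀ z : Fin p → ℝ, (∏ i, (X - C (z i : ℂ))).roots
      = Multiset.map Complex.ofReal (Finset.univ.val.map z) := by
    intro z
    have := roots_multiset_prod_X_sub_C (Finset.univ.val.map fun i => (z i : ℂ))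
    rw [Multiset.map_map] at this
    rw [Multiset.map_map]
    exact this
  rw [aux, aux] at h1
  have h2 := Multiset.map_injective Complex.ofReal_injective h1
  rw [Fin.univ_val_map, Fin.univ_val_map, Multiset.coe_eq_coe] at h2
  exact List.ofFn_injective
    (h2.eq_of_pairwise' hx.sortedLE_ofFn.pairwise hy.sortedLE_ofFn.pairwise)

/-- The Hermitian matrix with given free real coordinates, inverse to `hermitianCoord`. -/
noncomputable def hermitianOfCoord {p : ℕ} (c : Fin p × Fin p → ℝ) : HermitianMatrix p :=
  ⟨Matrix.of fun i j => if i = j then (c (i, i) : ℂ) else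
    if i < j then c (i, j) - Complex.I * c (j, i) else c (j, i) + Complex.I * c (i, j), by
    rw [selfAdjoint.mem_iff]
    ext i j
    simp only [Matrix.star_apply, Matrix.of_apply]
    rcases lt_trichotomy i j with h | rfl | h
    · simp [h.ne, h.ne', h, h.not_gt, sub_eq_add_neg]
    · simp
    · simp [h.ne, h.ne', h, h.not_gt, sub_eq_add_neg]⟩

theorem hermitianOfCoord_apply {p : ℕ} (c : Fin p × Fin p → ℝ) (i j : Fin p) :
    (hermitianOfCoord c).1 i j = if i = j then (c (i, i) : ℂ) else
    if i < j then c (i, j) - Complex.I * c (j, i) else c (j, i) + Complex.I * c (i, j) := rfl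

theorem hermitianOfCoord_hermitianCoord {p : ℕ} (H : HermitianMatrix p) :
    hermitianOfCoord (hermitianCoord H) = H := by
  have hH : ∀ i j, star (H.1 j i) = H.1 i j := fun i j => by
    have h : star H.1 = H.1 := selfAdjoint.mem_iff.mp H.2
    rw [← Matrix.star_apply, h]
  refine Subtype.ext ?_
  ext i j
  rw [hermitianOfCoord_apply]
  simp only [hermitianCoord]
  have h1 := hH i j
  rw [Complex.ext_iff] at h1
  simp only [RCLike.star_def, Complex.conj_re, Complex.conj_im] at h1
  rcases lt_trichotomy i j with h | rfl | h
  · apply Complex.ext <;> simp [h.ne, h, h.le, h.not_ge, h1.2]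
  · apply Complex.ext <;> simp
    linarith [h1.2]
  · apply Complex.ext <;> simp [h.ne', h.le, h.not_ge, h.not_gt, h1.1]

/-- The ordered eigenvalues as a function of the free real coordinates. -/
noncomputable def coordEigenvalues {p : ℕ} (c : Fin p × Fin p → ℝ) : Fin p → ℝ :=
  fun i => orderedEigenvalues (hermitianOfCoord c) i

theorem coordEigenvalues_monotone {p : ℕ} (c : Fin p × Fin p → ℝ) :
    Monotone (coordEigenvalues c) :=
  orderedEigenvalues_monotone _

theorem charpoly_hermitianOfCoord {p : ℕ} (c : Fin p × Fin p → ℝ) :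
    (hermitianOfCoord c).1.charpoly = ∏ i, (X - C (coordEigenvalues c i : ℂ)) :=
  charpoly_orderedEigenvalues _

theorem coordEigenvalues_eq {p : ℕ} {c : Fin p × Fin p → ℝ} {x : Fin p → ℝ} (hx : Monotone x)
    (h : (hermitianOfCoord c).1.charpoly = ∏ i, (X - C (x i : ℂ))) : coordEigenvalues c = x :=
  eq_of_monotone_of_prod_eq (coordEigenvalues_monotone c) hx
    ((charpoly_hermitianOfCoord c).symm.trans h)

/-- The values at the natural numbers of the monic polynomial with roots `x`. -/
noncomputable def rootValues {p : ℕ} (x : Fin p → ℝ) (n : ℕ) : ℝ := ∏ i, ((n : ℝ) - x i)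

theorem continuous_rootValues {p : ℕ} : Continuous (rootValues (p := p)) :=
  continuous_pi fun _ => continuous_finsetProd _ fun i _ =>
    continuous_const.sub (continuous_apply i)

theorem injOn_rootValues {p : ℕ} : Set.InjOn (rootValues (p := p)) {x | Monotone x} := by
  intro x hx y hy h
  refine eq_of_monotone_of_prod_eq hx hy ?_
  refine Polynomial.eq_of_infinite_eval_eq _ _ ?_
  refine (Set.infinite_range_of_injective (Nat.cast_injective (R := ℂ))).mono ?_
  rintro _ ⟨n, rfl⟩
  have hn := congrFun h n
  simp only [rootValues] at hn
  change eval _ _ = eval _ _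
  simp only [eval_prod, eval_sub, eval_X, eval_C]
  exact_mod_cast congrArg Complex.ofReal hn

theorem rootValues_coordEigenvalues {p : ℕ} (c : Fin p × Fin p → ℝ) (n : ℕ) :
    rootValues (coordEigenvalues c) n
      = (Matrix.scalar (Fin p) (n : ℂ) - (hermitianOfCoord c).1).det.re := by
  rw [← Matrix.eval_charpoly, charpoly_hermitianOfCoord]
  simp only [eval_prod, eval_sub, eval_X, eval_C, rootValues]
  have : (∏ i, ((n : ℂ) - (coordEigenvalues c i : ℂ)))
      = ((∏ i, ((n : ℝ) - coordEigenvalues c i) : ℝ) : ℂ) := by push_cast; rfl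
  rw [this, Complex.ofReal_re]

theorem continuous_hermitianOfCoord {p : ℕ} :
    Continuous fun c : Fin p × Fin p → ℝ => (hermitianOfCoord c).1 := by
  refine continuous_matrix fun i j => ?_
  simp only [hermitianOfCoord_apply]
  split_ifs <;> fun_prop

/-- The ordered eigenvalues are a measurable function of the matrix: the map from ordered tuples
to monic polynomials is continuous and injective, hence a measurable embedding by the theorem of
Lusin and Souslin, and the characteristic polynomial is continuous. -/
theorem measurable_coordEigenvalues {p : ℕ} : Measurable (coordEigenvalues (p := p)) := by
  have hmeas : Measurable fun c : Fin p × Fin p → ℝ => rootValues (coordEigenvalues c) := by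
    refine measurable_pi_lambda _ fun n => ?_
    simp only [rootValues_coordEigenvalues]
    refine Continuous.measurable ?_
    exact Complex.continuous_re.comp (Continuous.matrix_det
      (continuous_const.sub continuous_hermitianOfCoord))
  have hclosed : IsClosed {x : Fin p → ℝ | Monotone x} := by
    simp only [Monotone, Set.ofPred_forall]
    exact isClosed_iInter fun i => isClosed_iInter fun j => isClosed_iInter fun _ =>
      isClosed_le (continuous_apply i) (continuous_apply j)
  intro B hB
  have himg := (hB.inter hclosed.measurableSet).image_of_continuousOn_injOn
    continuous_rootValues.continuousOn (injOn_rootValues.mono Set.inter_subset_right)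
  have h := hmeas himg
  convert h using 1
  ext c
  simp only [Set.mem_preimage, Set.mem_image]
  constructor
  · intro hc
    exact ⟨_, ⟨hc, coordEigenvalues_monotone c⟩, rfl⟩
  · rintro ⟨x, ⟨hxB, hx⟩, hxe⟩
    rwa [← injOn_rootValues hx (coordEigenvalues_monotone c) hxe]

/-! ### Bordered Hermitian matrices -/

/-- The coordinates of the Hermitian matrix obtained from a matrix with coordinates `c` by adding
a first row and column: diagonal entry `a`, first column `u + i w`. -/
def borderCoord {p : ℕ} (a : ℝ) (u w : Fin p → ℝ) (c : Fin p × Fin p → ℝ) :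
    Fin (p + 1) × Fin (p + 1) → ℝ :=
  fun ij => Fin.cases (Fin.cases a u ij.2) (fun i => Fin.cases (w i) (fun j => c (i, j)) ij.2) ij.1

/-- The index equivalence which singles out the first row and column. -/
def borderEquiv (p : ℕ) : Unit ⊕ Fin p ≃ Fin (p + 1) :=
  ((Equiv.sumComm _ _).trans (Equiv.optionEquivSumPUnit (Fin p)).symm).trans
    (finSuccEquiv p).symm

theorem borderEquiv_inl (p : ℕ) (i : Unit) : borderEquiv p (Sum.inl i) = 0 := rfl

theorem borderEquiv_inr (p : ℕ) (i : Fin p) : borderEquiv p (Sum.inr i) = i.succ := by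
  simp [borderEquiv]

theorem reindex_border {p : ℕ} (a : ℝ) (u w : Fin p → ℝ) (c : Fin p × Fin p → ℝ) :
    (hermitianOfCoord (borderCoord a u w c)).1.submatrix (borderEquiv p) (borderEquiv p)
      = Matrix.fromBlocks (Matrix.of fun _ _ => (a : ℂ))
        (Matrix.of fun _ j => star (u j + Complex.I * w j))
        (Matrix.of fun i _ => (u i + Complex.I * w i)) (hermitianOfCoord c).1 := by
  ext i j
  rcases i with i | i <;> rcases j with j | j
  · simp [hermitianOfCoord_apply, borderEquiv_inl, borderCoord]
  · simp [hermitianOfCoord_apply, borderEquiv_inl, borderEquiv_inr, borderCoord,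
      (Fin.succ_ne_zero j).symm, sub_eq_add_neg]
  · simp [hermitianOfCoord_apply, borderEquiv_inl, borderEquiv_inr, borderCoord]
  · simp [hermitianOfCoord_apply, borderEquiv_inr, borderCoord]

/-- The characteristic polynomial of a Hermitian matrix with eigenvalues `lam`, bordered by the
diagonal entry `a` and a vector whose squared moduli in an eigenbasis are `r`. -/
noncomputable def borderPoly {p : ℕ} (lam r : Fin p → ℝ) (a : ℝ) : ℂ[X] :=
  (X - C (a : ℂ)) * ∏ i, (X - C (lam i : ℂ)) -
    ∑ i, C (r i : ℂ) * ∏ j ∈ Finset.univ.erase i, (X - C (lam j : ℂ))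

/-- The characteristic polynomial of a bordered matrix, by the Schur complement at the points where
the corner is invertible. -/
theorem charpoly_border {p : ℕ} (a : ℝ) (u w : Fin p → ℝ) (c : Fin p × Fin p → ℝ)
    (U : Matrix (Fin p) (Fin p) ℂ) (lam : Fin p → ℝ) (hU : U * star U = 1)
    (hc : (hermitianOfCoord c).1 = U * Matrix.diagonal (fun i => (lam i : ℂ)) * star U) :
    (hermitianOfCoord (borderCoord a u w c)).1.charpoly = borderPoly lam
      (fun i => Complex.normSq ((star U).mulVec (fun i => (u i : ℂ) + Complex.I * w i) i)) a := by
  have hU' : star U * U = 1 := mul_eq_one_comm.1 hU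
  set v : Fin p → ℂ := fun i => (u i : ℂ) + Complex.I * w i with hv
  set M := (hermitianOfCoord c).1 with hM
  have hfact : ∀ x : ℂ, Matrix.scalar (Fin p) x - M
      = U * Matrix.diagonal (fun i => x - (lam i : ℂ)) * star U := by
    intro x
    have : Matrix.diagonal (fun i => x - (lam i : ℂ))
        = Matrix.scalar (Fin p) x - Matrix.diagonal (fun i => (lam i : ℂ)) := by
      rw [Matrix.scalar_apply, Matrix.diagonal_sub]
    rw [this, mul_sub, sub_mul, hc]
    congr 1
    rw [← (Matrix.scalar_commute x (fun r => Commute.all _ _) U).eq, mul_assoc, hU, mul_one]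
  have hdet : ∀ x : ℂ, (Matrix.scalar (Fin p) x - M).det = ∏ i, (x - lam i) := by
    intro x
    rw [hfact, Matrix.det_mul, Matrix.det_mul, mul_right_comm, ← Matrix.det_mul, hU, Matrix.det_one,
      one_mul, Matrix.det_diagonal]
  refine Polynomial.eq_of_infinite_eval_eq _ _ ?_
  have hfin : (Set.range fun i => (lam i : ℂ)).Finite := Set.finite_range _
  refine hfin.infinite_compl.mono fun x hx => ?_
  have hx' : ∀ i, x - lam i ≠ 0 := fun i h => hx ⟨i, (sub_eq_zero.1 h).symm⟩
  change eval x _ = eval x _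
  have hN1 : (Matrix.scalar (Fin p) x - M) *
      (U * Matrix.diagonal (fun i => (x - (lam i : ℂ))⁻¹) * star U) = 1 := by
    calc _ = U * Matrix.diagonal (fun i => x - (lam i : ℂ)) * (star U * U) *
          Matrix.diagonal (fun i => (x - (lam i : ℂ))⁻¹) * star U := by
          rw [hfact]; simp only [mul_assoc]
      _ = U * (Matrix.diagonal (fun i => x - (lam i : ℂ)) *
          Matrix.diagonal (fun i => (x - (lam i : ℂ))⁻¹)) * star U := by
          rw [hU', mul_one]; simp only [mul_assoc]
      _ = 1 := by
          rw [Matrix.diagonal_mul_diagonal]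
          simp only [mul_inv_cancel₀ (hx' _), Matrix.diagonal_one, mul_one, hU]
  let _ : Invertible (Matrix.scalar (Fin p) x - M) :=
    ⟨_, mul_eq_one_comm.1 hN1, hN1⟩
  have hinv : ⅟(Matrix.scalar (Fin p) x - M)
      = U * Matrix.diagonal (fun i => (x - (lam i : ℂ))⁻¹) * star U :=
    invOf_eq_right_inv hN1
  rw [Matrix.eval_charpoly, ← Matrix.det_submatrix_equiv_self (borderEquiv p)]
  have hblock : (Matrix.scalar (Fin (p + 1)) x
      - (hermitianOfCoord (borderCoord a u w c)).1).submatrix (borderEquiv p) (borderEquiv p)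
      = Matrix.fromBlocks (Matrix.of fun _ _ => x - (a : ℂ)) (-Matrix.of fun _ j => star (v j))
        (-Matrix.of fun i _ => v i) (Matrix.scalar (Fin p) x - M) := by
    rw [Matrix.submatrix_sub, Pi.sub_apply, Pi.sub_apply, reindex_border]
    have : (Matrix.scalar (Fin (p + 1)) x).submatrix (borderEquiv p) (borderEquiv p)
        = Matrix.fromBlocks (Matrix.of fun _ _ => x) 0 0 (Matrix.scalar (Fin p) x) := by
      ext i j
      rcases i with i | i <;> rcases j with j | j <;>
        simp [borderEquiv_inl, borderEquiv_inr, Matrix.diagonal_apply, (Fin.succ_ne_zero _).symm]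
    rw [this, sub_eq_add_neg, Matrix.fromBlocks_neg, Matrix.fromBlocks_add]
    congr 1
    · rw [zero_add]
    · rw [zero_add]
  rw [hblock, Matrix.det_fromBlocks₂₂, hdet, hinv, Matrix.det_unique]
  have hquad : (-(Matrix.of fun (_ : Unit) j => star (v j)) *
      (U * Matrix.diagonal (fun i => (x - (lam i : ℂ))⁻¹) * star U) *
      -(Matrix.of fun i (_ : Unit) => v i)) default default
      = ∑ i, (Complex.normSq ((star U).mulVec v i) : ℂ) * (x - lam i)⁻¹ := by
    have e1 : (Matrix.of fun (_ : Unit) j => star (v j)) * U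
        = Matrix.of fun (_ : Unit) j => star ((star U).mulVec v j) := by
      ext i j
      simp [Matrix.mul_apply, Matrix.mulVec, dotProduct, Matrix.star_apply, mul_comm]
    have e2 : star U * (Matrix.of fun i (_ : Unit) => v i)
        = Matrix.of fun i (_ : Unit) => (star U).mulVec v i := by
      ext i j
      simp [Matrix.mul_apply, Matrix.mulVec, dotProduct]
    rw [Matrix.mul_neg, Matrix.neg_mul, Matrix.neg_mul, neg_neg]
    have e3 : (Matrix.of fun (_ : Unit) j => star (v j)) *
      (U * Matrix.diagonal (fun i => (x - (lam i : ℂ))⁻¹) * star U) *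
      (Matrix.of fun i (_ : Unit) => v i) = ((Matrix.of fun (_ : Unit) j => star (v j)) * U) *
        Matrix.diagonal (fun i => (x - (lam i : ℂ))⁻¹) *
        (star U * (Matrix.of fun i (_ : Unit) => v i)) := by
      simp only [Matrix.mul_assoc]
    rw [e3, e1, e2, Matrix.mul_apply]
    refine Finset.sum_congr rfl fun i _ => ?_
    rw [Matrix.mul_diagonal, Matrix.of_apply, Matrix.of_apply, mul_right_comm,
      Complex.normSq_eq_conj_mul_self]
    rfl
  rw [Matrix.sub_apply, hquad, borderPoly]
  simp only [eval_sub, eval_mul, eval_X, eval_C, eval_prod, eval_finsetSum, Matrix.of_apply]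
  rw [mul_sub, mul_comm, Finset.mul_sum]
  congr 1
  refine Finset.sum_congr rfl fun i _ => ?_
  rw [← Finset.mul_prod_erase _ _ (Finset.mem_univ i)]
  field_simp [hx' i]

/-- Spectral theorem, with the eigenvalues in increasing order. -/
theorem exists_unitary_coordEigenvalues {p : ℕ} (c : Fin p × Fin p → ℝ) :
    ∃ U : Matrix (Fin p) (Fin p) ℂ, U * star U = 1 ∧
      (hermitianOfCoord c).1
        = U * Matrix.diagonal (fun i => (coordEigenvalues c i : ℂ)) * star U := by
  have hH : (hermitianOfCoord c).1.IsHermitian := selfAdjoint.mem_iff.mp (hermitianOfCoord c).2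
  set σ := Tuple.sort hH.eigenvalues with hσ
  set V : Matrix (Fin p) (Fin p) ℂ := hH.eigenvectorUnitary.1 with hV
  have hVV : V * star V = 1 := Unitary.coe_mul_star_self hH.eigenvectorUnitary
  refine ⟨V.submatrix id σ, ?_, ?_⟩
  · rw [← hVV]
    ext i j
    simp only [Matrix.mul_apply, Matrix.submatrix_apply, Matrix.star_apply, id]
    exact Equiv.sum_comp σ fun k => V i k * star (V j k)
  · have h := hH.spectral_theorem
    rw [Unitary.conjStarAlgAut_apply] at h
    conv_lhs => rw [h]
    ext i j
    rw [Matrix.mul_apply, Matrix.mul_apply]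
    simp only [Matrix.mul_diagonal, Matrix.submatrix_apply, Matrix.star_apply, id]
    exact (Equiv.sum_comp σ fun k => V i k * (hH.eigenvalues k : ℂ) * star (V j k)).symm

end Eigenvalues


/-! ### Interlacing and the border of a matrix -/

section Interlacing
open Polynomial

variable {p : ℕ}

/-- `mu` strictly interlaces `lam`. -/
def Interlaced (lam : Fin p → ℝ) (mu : Fin (p + 1) → ℝ) : Prop :=
  ∀ i, mu i.castSucc < lam i ∧ lam i < mu i.succ

/-- The squared modulus of the `i`-th coordinate of the border which produces the eigenvalues `mu`
from the eigenvalues `lam`. -/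
noncomputable def borderWeight (lam : Fin p → ℝ) (mu : Fin (p + 1) → ℝ) (i : Fin p) : ℝ :=
  -(∏ j, (lam i - mu j)) / ∏ k ∈ Finset.univ.erase i, (lam i - lam k)

/-- The border, that is the diagonal entry followed by the squared moduli, which produces the
eigenvalues `mu` from the eigenvalues `lam`. -/
noncomputable def borderMap (lam : Fin p → ℝ) (mu : Fin (p + 1) → ℝ) : Fin (p + 1) → ℝ :=
  Fin.cons (∑ j, mu j - ∑ i, lam i) (borderWeight lam mu)

theorem Interlaced.strictMono_right {lam : Fin p → ℝ} {mu : Fin (p + 1) → ℝ}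
    (h : Interlaced lam mu) : StrictMono mu :=
  Fin.strictMono_iff_lt_succ.2 fun i => (h i).1.trans (h i).2

theorem Interlaced.strictMono_left {lam : Fin p → ℝ} {mu : Fin (p + 1) → ℝ}
    (h : Interlaced lam mu) : StrictMono lam := by
  intro i j hij
  refine (h i).2.trans_le (le_trans (h.strictMono_right.monotone ?_) (h j).1.le)
  rw [Fin.le_iff_val_le_val]
  have : (i : ℕ) < j := hij
  simp only [Fin.val_succ, Fin.val_castSucc]
  omega

theorem prod_erase_sub_ne_zero {lam : Fin p → ℝ} (hlam : StrictMono lam) (i : Fin p) :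
    ∏ k ∈ Finset.univ.erase i, (lam i - lam k) ≠ 0 :=
  Finset.prod_ne_zero_iff.2 fun _ hk =>
    sub_ne_zero.2 fun h => (Finset.ne_of_mem_erase hk) (hlam.injective h).symm

theorem eval_borderPoly_node (lam r : Fin p → ℝ) (a : ℝ) (i : Fin p) :
    (borderPoly lam r a).eval (lam i : ℂ)
      = ((-(r i * ∏ k ∈ Finset.univ.erase i, (lam i - lam k)) : ℝ) : ℂ) := by
  simp only [borderPoly, eval_sub, eval_mul, eval_X, eval_C, eval_prod, eval_finsetSum]
  rw [Finset.prod_eq_zero (Finset.mem_univ i) (sub_self _), mul_zero, zero_sub,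
    Finset.sum_eq_single i]
  · push_cast; rfl
  · intro j _ hji
    rw [Finset.prod_eq_zero (Finset.mem_erase.2 ⟨hji.symm, Finset.mem_univ i⟩) (sub_self _),
      mul_zero]
  · intro h; exact absurd (Finset.mem_univ i) h

/-- The diagonal entry is the one which makes the two leading coefficients cancel, by the trace. -/
theorem degree_prod_sub_lt (lam : Fin p → ℝ) (mu : Fin (p + 1) → ℝ) :
    (∏ j, (X - C (mu j : ℂ)) - (X - C ((∑ j, mu j - ∑ i, lam i : ℝ) : ℂ)) *
      ∏ i, (X - C (lam i : ℂ))).degree < (p : WithBot ℕ) := by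
  set a := (∑ j, mu j - ∑ i, lam i : ℝ) with ha
  have hA : (∏ j, (X - C (mu j : ℂ))).Monic := monic_prod_of_monic _ _ fun j _ => monic_X_sub_C _
  have hB' : (∏ i, (X - C (lam i : ℂ))).Monic := monic_prod_of_monic _ _ fun j _ => monic_X_sub_C _
  have hB := (monic_X_sub_C (a : ℂ)).mul hB'
  have dA : (∏ j, (X - C (mu j : ℂ))).natDegree = p + 1 := by
    rw [natDegree_finsetProd_X_sub_C_eq_card]; simp
  have dB' : (∏ i, (X - C (lam i : ℂ))).natDegree = p := by
    rw [natDegree_finsetProd_X_sub_C_eq_card]; simp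
  have dB : ((X - C (a : ℂ)) * ∏ i, (X - C (lam i : ℂ))).natDegree = p + 1 := by
    rw [(monic_X_sub_C _).natDegree_mul hB', natDegree_X_sub_C, dB', add_comm]
  have nA : (∏ j, (X - C (mu j : ℂ))).nextCoeff = -∑ j, (mu j : ℂ) := prod_X_sub_C_nextCoeff _
  have nB : ((X - C (a : ℂ)) * ∏ i, (X - C (lam i : ℂ))).nextCoeff
      = -(a : ℂ) + -∑ j, (lam j : ℂ) := by
    rw [(monic_X_sub_C _).nextCoeff_mul hB', nextCoeff_X_sub_C, prod_X_sub_C_nextCoeff]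
  rw [nextCoeff_of_natDegree_pos (by omega), dA] at nA
  rw [nextCoeff_of_natDegree_pos (by omega), dB] at nB
  rw [degree_lt_iff_coeff_zero]
  intro m hm
  rw [coeff_sub]
  rcases hm.eq_or_lt with rfl | hm
  · rw [Nat.add_sub_cancel] at nA nB
    rw [nA, nB, ha]; push_cast; ring
  · rcases (Nat.succ_le_of_lt hm).eq_or_lt with rfl | hm
    · have h1 := hA.coeff_natDegree
      have h2 := hB.coeff_natDegree
      rw [dA] at h1
      rw [dB] at h2
      rw [Nat.succ_eq_add_one, h1, h2, sub_self]
    · rw [coeff_eq_zero_of_natDegree_lt (by omega), coeff_eq_zero_of_natDegree_lt (by omega),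
        sub_self]

theorem degree_sum_erase_lt (lam r : Fin p → ℝ) :
    (∑ i, C (r i : ℂ) * ∏ j ∈ Finset.univ.erase i, (X - C (lam j : ℂ))).degree
      < (p : WithBot ℕ) := by
  rcases p with _ | p
  · simp
  · refine (degree_sum_le _ _).trans_lt ?_
    rw [Finset.sup_lt_iff (by exact_mod_cast WithBot.bot_lt_coe _)]
    intro i _
    rw [← smul_eq_C_mul]
    refine (degree_smul_le _ _).trans_lt ?_
    rw [degree_prod]
    simp only [degree_X_sub_C, Finset.sum_const, Finset.card_erase_of_mem (Finset.mem_univ i),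
      Finset.card_univ, Fintype.card_fin, Nat.add_sub_cancel]
    simp only [nsmul_eq_mul, mul_one]
    exact_mod_cast Nat.lt_succ_self p

/-- Lagrange interpolation at the points `lam`. -/
theorem borderPoly_borderMap {lam : Fin p → ℝ} (hlam : StrictMono lam) (mu : Fin (p + 1) → ℝ) :
    borderPoly lam (borderWeight lam mu) (∑ j, mu j - ∑ i, lam i) = ∏ j, (X - C (mu j : ℂ)) := by
  have key : ∏ j, (X - C (mu j : ℂ)) - (X - C ((∑ j, mu j - ∑ i, lam i : ℝ) : ℂ)) *
      ∏ i, (X - C (lam i : ℂ)) =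
      -∑ i, C (borderWeight lam mu i : ℂ) * ∏ j ∈ Finset.univ.erase i, (X - C (lam j : ℂ)) := by
    refine eq_of_degrees_lt_of_eval_index_eq (s := Finset.univ) (v := fun i => (lam i : ℂ))
      ?_ ?_ ?_ ?_
    · intro i _ j _ h
      exact hlam.injective (Complex.ofReal_injective h)
    · simpa using degree_prod_sub_lt lam mu
    · rw [degree_neg]
      simpa using degree_sum_erase_lt lam (borderWeight lam mu)
    · intro i _
      have h := eval_borderPoly_node lam (borderWeight lam mu) (∑ j, mu j - ∑ i, lam i) i
      have e : borderWeight lam mu i * ∏ k ∈ Finset.univ.erase i, (lam i - lam k)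
          = -∏ j, (lam i - mu j) := by
        rw [borderWeight, div_mul_cancel₀ _ (prod_erase_sub_ne_zero hlam i)]
      rw [e, neg_neg, borderPoly, eval_sub] at h
      rw [eval_sub, eval_neg]
      have h2 : (∏ j, (X - C (mu j : ℂ))).eval (lam i : ℂ) = ((∏ j, (lam i - mu j) : ℝ) : ℂ) := by
        simp [eval_prod]
      rw [h2, ← h]
      ring
  rw [borderPoly, sub_eq_iff_eq_add.1 key]
  ring

/-- A border which produces the eigenvalues `mu` is the one given by `borderMap`. -/
theorem borderMap_eq_of_borderPoly_eq {lam r : Fin p → ℝ} {a : ℝ} {mu : Fin (p + 1) → ℝ}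
    (hlam : StrictMono lam) (h : borderPoly lam r a = ∏ j, (X - C (mu j : ℂ))) :
    borderMap lam mu = Fin.cons a r := by
  have hr : borderWeight lam mu = r := by
    funext i
    have h1 := eval_borderPoly_node lam r a i
    have h2 : (∏ j, (X - C (mu j : ℂ))).eval (lam i : ℂ) = ((∏ j, (lam i - mu j) : ℝ) : ℂ) := by
      simp [eval_prod]
    rw [h, h2] at h1
    rw [borderWeight, div_eq_iff (prod_erase_sub_ne_zero hlam i), Complex.ofReal_injective h1,
      neg_neg]
  have ha : ∑ j, mu j - ∑ i, lam i = a := by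
    have h1 := (borderPoly_borderMap hlam mu).trans h.symm
    rw [hr, borderPoly, borderPoly, sub_left_inj] at h1
    have hne : ∏ i, (X - C (lam i : ℂ)) ≠ 0 :=
      (monic_prod_of_monic _ _ fun j _ => monic_X_sub_C _).ne_zero
    have h2 := mul_right_cancel₀ hne h1
    rw [sub_right_inj] at h2
    exact Complex.ofReal_injective (C_injective h2)
  rw [borderMap, hr, ha]

theorem borderMap_injOn {lam : Fin p → ℝ} (hlam : StrictMono lam) :
    Set.InjOn (borderMap lam) {mu | Interlaced lam mu} := by
  intro mu hmu mu' hmu' h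
  refine eq_of_monotone_of_prod_eq (Interlaced.strictMono_right hmu).monotone
    (Interlaced.strictMono_right hmu').monotone ?_
  rw [borderMap, borderMap, Fin.cons_inj] at h
  rw [← borderPoly_borderMap hlam, ← borderPoly_borderMap hlam, h.1, h.2]

theorem Interlaced.borderWeight_pos {lam : Fin p → ℝ} {mu : Fin (p + 1) → ℝ}
    (h : Interlaced lam mu) (i : Fin p) : 0 < borderWeight lam mu i := by
  have hlam := h.strictMono_left
  have hmu := h.strictMono_right
  rw [borderWeight, Fin.prod_univ_castSucc, ← Finset.mul_prod_erase _ _ (Finset.mem_univ i)]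
  have e : -((lam i - mu i.castSucc) * (∏ k ∈ Finset.univ.erase i, (lam i - mu k.castSucc)) *
      (lam i - mu (Fin.last p))) / ∏ k ∈ Finset.univ.erase i, (lam i - lam k)
      = (lam i - mu i.castSucc) * (mu (Fin.last p) - lam i) *
        ∏ k ∈ Finset.univ.erase i, ((lam i - mu k.castSucc) / (lam i - lam k)) := by
    rw [Finset.prod_div_distrib]; ring
  rw [e]
  refine mul_pos (mul_pos (sub_pos.2 (h i).1) (sub_pos.2 ?_)) (Finset.prod_pos fun k hk => ?_)
  · exact (h i).2.trans_le (hmu.monotone (Fin.le_last _))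
  · rcases lt_or_gt_of_ne (Finset.ne_of_mem_erase hk) with hki | hki
    · exact div_pos (sub_pos.2 ((h k).1.trans (hlam hki))) (sub_pos.2 (hlam hki))
    · refine div_pos_of_neg_of_neg (sub_neg.2 ((h i).2.trans_le (hmu.monotone ?_)))
        (sub_neg.2 (hlam hki))
      rw [Fin.le_iff_val_le_val]
      have : (i : ℕ) < k := hki
      simp only [Fin.val_succ, Fin.val_castSucc]
      omega

theorem prod_abs_eq_neg_one_pow {ι : Type*} (s : Finset ι) (f : ι → ℝ) :
    ∏ i ∈ s, |f i| = (-1) ^ (s.filter fun i => f i < 0).card * ∏ i ∈ s, f i := by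
  have : ∀ i ∈ s, |f i| = (if f i < 0 then -1 else 1) * f i := by
    intro i _
    split_ifs with h
    · rw [abs_of_neg h, neg_one_mul]
    · rw [abs_of_nonneg (not_lt.1 h), one_mul]
  rw [Finset.prod_congr rfl this, Finset.prod_mul_distrib, Finset.prod_ite]
  simp

/-- The number of `mu j` above `lam i` has the parity of `p - i`; as it decreases in `i`, is positive
at the last `i` and at most `p + 1` at the first one, it equals `p - i`. -/
theorem interlaced_of_borderWeight_pos {lam : Fin p → ℝ} {mu : Fin (p + 1) → ℝ}
    (hlam : StrictMono lam) (hmu : Monotone mu) (h : ∀ i, 0 < borderWeight lam mu i) :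
    Interlaced lam mu := by
  have hprod : ∀ i, (∏ j, (lam i - mu j)) * ∏ k ∈ Finset.univ.erase i, (lam i - lam k) < 0 := by
    intro i
    have h1 := h i
    have h2 := prod_erase_sub_ne_zero hlam i
    rw [borderWeight, neg_div, neg_pos] at h1
    have h3 : (∏ j, (lam i - mu j)) * ∏ k ∈ Finset.univ.erase i, (lam i - lam k)
        = (∏ j, (lam i - mu j)) / (∏ k ∈ Finset.univ.erase i, (lam i - lam k)) *
          (∏ k ∈ Finset.univ.erase i, (lam i - lam k)) ^ 2 := by
      field_simp
    rw [h3]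
    exact mul_neg_of_neg_of_pos h1 (by positivity)
  have hne : ∀ i j, mu j ≠ lam i := by
    intro i j hij
    have := hprod i
    rw [Finset.prod_eq_zero (Finset.mem_univ j) (by rw [hij, sub_self]), zero_mul] at this
    exact lt_irrefl _ this
  -- the number of `mu j` above `lam i`, whose parity is found by counting signs
  set N : Fin p → ℕ := fun i => (Finset.univ.filter fun j => lam i - mu j < 0).card with hN
  have hodd : ∀ i, (-1 : ℝ) ^ (N i + (p - 1 - i)) < 0 := by
    intro i
    have h1 := prod_abs_eq_neg_one_pow Finset.univ fun j => lam i - mu j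
    have h2 := prod_abs_eq_neg_one_pow (Finset.univ.erase i) fun k => lam i - lam k
    have hc : ((Finset.univ.erase i).filter fun k => lam i - lam k < 0).card = p - 1 - i := by
      have : (Finset.univ.erase i).filter (fun k => lam i - lam k < 0) = Finset.Ioi i := by
        ext k
        simp only [Finset.mem_filter, Finset.mem_erase, Finset.mem_univ, and_true, sub_neg,
          Finset.mem_Ioi, hlam.lt_iff_lt]
        exact ⟨fun h => h.2, fun h => ⟨h.ne', h⟩⟩
      rw [this, Fin.card_Ioi]
    rw [hc] at h2
    have p1 : 0 ≤ ∏ j, |lam i - mu j| := Finset.prod_nonneg fun j _ => abs_nonneg _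
    have p2 : 0 ≤ ∏ k ∈ Finset.univ.erase i, |lam i - lam k| :=
      Finset.prod_nonneg fun j _ => abs_nonneg _
    have p3 := mul_nonneg p1 p2
    rw [h1, h2] at p3
    have e : (-1 : ℝ) ^ (N i) * (∏ j, (lam i - mu j)) *
        ((-1) ^ (p - 1 - (i : ℕ)) * ∏ k ∈ Finset.univ.erase i, (lam i - lam k))
        = (-1 : ℝ) ^ (N i + (p - 1 - i)) *
          ((∏ j, (lam i - mu j)) * ∏ k ∈ Finset.univ.erase i, (lam i - lam k)) := by
      rw [pow_add]; ring
    rw [e] at p3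
    have hx := hprod i
    rcases neg_one_pow_eq_or ℝ (N i + (p - 1 - i)) with h' | h'
    · rw [h', one_mul] at p3
      linarith
    · rw [h']; norm_num
  have hpar : ∀ i, Odd (N i + (p - 1 - i)) := by
    intro i
    by_contra hev
    have := hodd i
    rw [(Nat.not_odd_iff_even.1 hev).neg_one_pow] at this
    linarith
  have hanti : ∀ i i', i ≤ i' → N i' ≤ N i := by
    intro i i' hii'
    refine Finset.card_le_card fun j => ?_
    simp only [Finset.mem_filter, Finset.mem_univ, true_and]
    intro hj
    have := hlam.monotone hii'
    linarith
  have hupper : ∀ (k : ℕ) (hk : k < p), N ⟨k, hk⟩ ≤ p - k := by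
    intro k
    induction k with
    | zero =>
      intro hk
      have h1 : N ⟨0, hk⟩ ≤ p + 1 := (Finset.card_le_univ _).trans (by simp)
      have h2 := hpar ⟨0, hk⟩
      rw [Nat.odd_iff] at h2
      simp only at h2
      omega
    | succ k ih =>
      intro hk
      have h1 := ih (by omega)
      have h2 := hpar ⟨k, by omega⟩
      have h3 := hpar ⟨k + 1, hk⟩
      have h4 := hanti ⟨k, by omega⟩ ⟨k + 1, hk⟩ (by simp)
      rw [Nat.odd_iff] at h2 h3
      simp only at h2 h3
      omega
  have hlower : ∀ (d k : ℕ) (hk : k < p), k + d + 1 = p → p - k ≤ N ⟨k, hk⟩ := by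
    intro d
    induction d with
    | zero =>
      intro k hk hkd
      have h2 := hpar ⟨k, hk⟩
      rw [Nat.odd_iff] at h2
      simp only at h2
      omega
    | succ d ih =>
      intro k hk hkd
      have h1 := ih (k + 1) (by omega) (by omega)
      have h2 := hpar ⟨k, by omega⟩
      have h3 := hpar ⟨k + 1, by omega⟩
      have h4 := hanti ⟨k, by omega⟩ ⟨k + 1, by omega⟩ (by simp)
      rw [Nat.odd_iff] at h2 h3
      simp only at h2 h3
      omega
  intro i
  have hNi : N i = p - i := le_antisymm (hupper i i.2)
    (hlower (p - 1 - i) i i.2 (by have := i.2; omega))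
  have hi := i.2
  constructor
  · by_contra hcon
    have hlt : lam i < mu i.castSucc := lt_of_le_of_ne (not_lt.1 hcon) (hne _ _).symm
    have hsub : Finset.Ici i.castSucc ⊆ Finset.univ.filter fun j => lam i - mu j < 0 := by
      intro j hj
      simp only [Finset.mem_filter, Finset.mem_univ, true_and, sub_neg]
      exact hlt.trans_le (hmu (Finset.mem_Ici.1 hj))
    have := Finset.card_le_card hsub
    rw [Fin.card_Ici] at this
    simp only [Fin.val_castSucc] at this
    change _ ≤ N i at this
    omega
  · by_contra hcon
    have hlt : mu i.succ < lam i := lt_of_le_of_ne (not_lt.1 hcon) (hne _ _)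
    have hsub : (Finset.univ.filter fun j => lam i - mu j < 0) ⊆ Finset.Ioi i.succ := by
      intro j hj
      simp only [Finset.mem_filter, Finset.mem_univ, true_and, sub_neg] at hj
      rw [Finset.mem_Ioi]
      by_contra hji
      have := hmu (not_lt.1 hji)
      linarith
    have := Finset.card_le_card hsub
    rw [Fin.card_Ioi] at this
    simp only [Fin.val_succ] at this
    change N i ≤ _ at this
    omega

end Interlacing


/-! ### The sum of squares of the eigenvalues of a bordered matrix -/

section BorderAnalysis

variable {p : ℕ}

/-- The coordinates of a real diagonal matrix. -/
def diagCoord (lam : Fin p → ℝ) (ij : Fin p × Fin p) : ℝ := if ij.1 = ij.2 then lam ij.1 else 0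

theorem hermitianOfCoord_diagCoord (lam : Fin p → ℝ) :
    (hermitianOfCoord (diagCoord lam)).1 = Matrix.diagonal fun i => (lam i : ℂ) := by
  ext i j
  rw [hermitianOfCoord_apply, Matrix.diagonal_apply]
  by_cases h : i = j
  · simp [h, diagCoord]
  · have h' : j ≠ i := fun e => h e.symm
    simp [h, h', diagCoord]

theorem coordEigenvalues_border_interlaced {lam : Fin p → ℝ} {mu : Fin (p + 1) → ℝ}
    (h : Interlaced lam mu) :
    coordEigenvalues (borderCoord (∑ j, mu j - ∑ i, lam i) (fun i => √(borderWeight lam mu i)) 0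
      (diagCoord lam)) = mu := by
  refine coordEigenvalues_eq h.strictMono_right.monotone ?_
  rw [charpoly_border _ _ _ _ 1 lam (by simp) (by simp [hermitianOfCoord_diagCoord]),
    ← borderPoly_borderMap h.strictMono_left]
  congr 1
  funext i
  simp [Complex.normSq_ofReal, Real.mul_self_sqrt (h.borderWeight_pos i).le]

theorem trace_sq_eq_sum_sq (c : Fin p × Fin p → ℝ) :
    ((hermitianOfCoord c).1 * (hermitianOfCoord c).1).trace
      = ((∑ i, coordEigenvalues c i ^ 2 : ℝ) : ℂ) := by
  obtain ⟨U, hU, h⟩ := exists_unitary_coordEigenvalues c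
  have hU' : star U * U = 1 := mul_eq_one_comm.1 hU
  set D := Matrix.diagonal fun i => (coordEigenvalues c i : ℂ)
  rw [h]
  have : U * D * star U * (U * D * star U) = U * (D * D) * star U := by
    calc _ = U * D * (star U * U) * D * star U := by simp only [mul_assoc]
      _ = _ := by rw [hU', mul_one]; simp only [mul_assoc]
  rw [this, Matrix.trace_mul_comm, ← mul_assoc, hU', one_mul, Matrix.diagonal_mul_diagonal,
    Matrix.trace_diagonal]
  push_cast
  simp only [pow_two]

theorem trace_sq_border (a : ℝ) (u w : Fin p → ℝ) (c : Fin p × Fin p → ℝ) :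
    ((hermitianOfCoord (borderCoord a u w c)).1 * (hermitianOfCoord (borderCoord a u w c)).1).trace
      = ((a ^ 2 + 2 * ∑ i, (u i ^ 2 + w i ^ 2) : ℝ) : ℂ) +
        ((hermitianOfCoord c).1 * (hermitianOfCoord c).1).trace := by
  set M := (hermitianOfCoord (borderCoord a u w c)).1 with hM
  have htr : (M * M).trace = ((M * M).submatrix (borderEquiv p) (borderEquiv p)).trace :=
    (Equiv.sum_comp (borderEquiv p) fun i => (M * M) i i).symm
  have h := Matrix.submatrix_mul_equiv M M (borderEquiv p) (borderEquiv p) (borderEquiv p)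
  rw [htr, hM]
  rw [hM] at h
  rw [← h, reindex_border, Matrix.fromBlocks_multiply, Matrix.trace, Fintype.sum_sum_type]
  simp only [Matrix.diag_apply, Matrix.fromBlocks_apply₁₁, Matrix.fromBlocks_apply₂₂,
    Matrix.add_apply, Finset.sum_add_distrib]
  rw [← add_assoc]
  refine congrArg₂ _ ?_ rfl
  simp only [Matrix.mul_apply, Matrix.of_apply, Finset.univ_unique, Finset.sum_singleton]
  push_cast
  rw [pow_two, add_assoc, ← Finset.sum_add_distrib, ← Finset.sum_add_distrib, Finset.mul_sum]
  congr 1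
  refine Finset.sum_congr rfl fun i _ => ?_
  have hI := Complex.I_sq
  simp only [star_add, star_mul, RCLike.star_def, Complex.conj_ofReal, Complex.conj_I]
  linear_combination (-2 * (w i : ℂ) ^ 2) * hI

/-- The trace of the square of the bordered matrix, computed in two ways. -/
theorem Interlaced.sum_sq {lam : Fin p → ℝ} {mu : Fin (p + 1) → ℝ} (h : Interlaced lam mu) :
    ∑ j, mu j ^ 2 = (∑ j, mu j - ∑ i, lam i) ^ 2 + 2 * ∑ i, borderWeight lam mu i
      + ∑ i, lam i ^ 2 := by
  have h1 := trace_sq_eq_sum_sq (borderCoord (∑ j, mu j - ∑ i, lam i)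
    (fun i => √(borderWeight lam mu i)) 0 (diagCoord lam))
  rw [trace_sq_border, coordEigenvalues_border_interlaced h, hermitianOfCoord_diagCoord,
    Matrix.diagonal_mul_diagonal, Matrix.trace_diagonal] at h1
  have h2 : ∀ i, √(borderWeight lam mu i) ^ 2 + (0 : Fin p → ℝ) i ^ 2 = borderWeight lam mu i :=
    fun i => by rw [Real.sq_sqrt (h.borderWeight_pos i).le]; simp
  simp only [h2] at h1
  have h3 : (∑ i, (lam i : ℂ) * lam i) = ((∑ i, lam i ^ 2 : ℝ) : ℂ) := by
    push_cast; simp only [pow_two]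
  rw [h3] at h1
  exact_mod_cast h1.symm

/-! ### The Jacobian of the border map -/

/-- The Vandermonde product `∏_{i<j} (x_j - x_i)`. -/
def vdm {n : ℕ} (x : Fin n → ℝ) : ℝ := ∏ i : Fin n, ∏ j ∈ Finset.Ioi i, (x j - x i)

theorem vdm_eq_det {n : ℕ} (x : Fin n → ℝ) : vdm x = (Matrix.vandermonde x).det :=
  (Matrix.det_vandermonde x).symm

theorem vdm_pos {n : ℕ} {x : Fin n → ℝ} (hx : StrictMono x) : 0 < vdm x :=
  Finset.prod_pos fun _ _ => Finset.prod_pos fun _ hj => sub_pos.2 (hx (Finset.mem_Ioi.1 hj))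

theorem prod_abs_erase {n : ℕ} (x : Fin n → ℝ) :
    ∏ i, |∏ k ∈ Finset.univ.erase i, (x i - x k)| = vdm x ^ 2 := by
  have h := Finset.prod_prod_Ioi_mul_eq_prod_prod_off_diag fun i j : Fin n => |x i - x j|
  simp only [Finset.abs_prod]
  have e : ∀ i : Fin n, ∏ k ∈ Finset.univ.erase i, |x i - x k| = ∏ j ∈ {i}ᶜ, |x j - x i| := by
    intro i
    rw [Finset.compl_singleton]
    exact Finset.prod_congr rfl fun k _ => abs_sub_comm _ _
  simp only [e]
  rw [← h, vdm, ← Finset.prod_pow]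
  refine Finset.prod_congr rfl fun i _ => ?_
  rw [← Finset.prod_pow]
  refine Finset.prod_congr rfl fun j _ => ?_
  rw [abs_sub_comm (x i), ← pow_two, sq_abs]

/-- The Jacobian matrix of `borderMap lam` at `mu`. -/
noncomputable def borderJacobian (lam : Fin p → ℝ) (mu : Fin (p + 1) → ℝ) :
    Matrix (Fin (p + 1)) (Fin (p + 1)) ℝ :=
  Matrix.of (Fin.cons (fun _ => 1) fun i j =>
    (∏ k ∈ Finset.univ.erase j, (lam i - mu k)) / ∏ k ∈ Finset.univ.erase i, (lam i - lam k))

theorem hasFDerivAt_borderMap (lam : Fin p → ℝ) (mu : Fin (p + 1) → ℝ) :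
    HasFDerivAt (borderMap lam) (LinearMap.toContinuousLinearMap
      (Matrix.toLin' (borderJacobian lam mu))) mu := by
  rw [hasFDerivAt_pi']
  intro i
  refine Fin.cases ?_ (fun i => ?_) i
  · have h : HasFDerivAt (fun x : Fin (p + 1) → ℝ => ∑ j, x j - ∑ i, lam i)
        (∑ j, ContinuousLinearMap.proj (R := ℝ) (φ := fun _ => ℝ) j) mu :=
      (HasFDerivAt.fun_sum fun j _ => hasFDerivAt_apply j mu).sub_const _
    refine h.congr_fderiv ?_
    ext v
    simp [borderJacobian, Matrix.mulVec, dotProduct]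
  · have h := HasFDerivAt.finsetProd (u := Finset.univ)
      (g := fun (j : Fin (p + 1)) (x : Fin (p + 1) → ℝ) => lam i - x j) (x := mu)
      (g' := fun j => -ContinuousLinearMap.proj (R := ℝ) (φ := fun _ => ℝ) j)
      fun j _ => (hasFDerivAt_apply j mu).const_sub (lam i)
    have h2 := h.neg.mul_const (∏ k ∈ Finset.univ.erase i, (lam i - lam k))⁻¹
    refine h2.congr_fderiv ?_
    ext v
    simp [borderJacobian, Matrix.mulVec, dotProduct, div_eq_mul_inv, Finset.mul_sum, mul_comm,
      mul_left_comm]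

/-- Multiplying the Jacobian matrix by a rescaled Vandermonde matrix evaluates monomials at `lam`
and extracts their leading coefficients, by Lagrange interpolation at `mu`. -/
theorem borderJacobian_mul (lam : Fin p → ℝ) {mu : Fin (p + 1) → ℝ} (hmu : StrictMono mu) :
    borderJacobian lam mu *
      (Matrix.of fun j m => (∏ k ∈ Finset.univ.erase j, (mu j - mu k))⁻¹ *
        Matrix.vandermonde mu j m)
      = Matrix.of (Fin.cons (fun m => if m = Fin.last p then 1 else 0) fun i (m : Fin (p + 1)) =>
        (∏ k ∈ Finset.univ.erase i, (lam i - lam k))⁻¹ * lam i ^ (m : ℕ)) := by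
  have hinj : Set.InjOn mu (Finset.univ : Finset (Fin (p + 1))) := hmu.injective.injOn
  have hdeg : ∀ m : Fin (p + 1), ((Polynomial.X : Polynomial ℝ) ^ (m : ℕ)).degree
      < (Finset.univ : Finset (Fin (p + 1))).card := by
    intro m
    rw [Polynomial.degree_X_pow, Finset.card_univ, Fintype.card_fin]
    exact_mod_cast m.2
  ext i m
  rw [Matrix.mul_apply]
  refine Fin.cases ?_ (fun i => ?_) i
  · have h := Lagrange.coeff_eq_sum hinj (hdeg m)
    simp only [Finset.card_univ, Fintype.card_fin, Nat.add_sub_cancel, Polynomial.coeff_X_pow,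
      Polynomial.eval_pow, Polynomial.eval_X] at h
    simp only [borderJacobian, Matrix.of_apply, Fin.cons_zero, one_mul, Matrix.vandermonde_apply]
    have e : (p = (m : ℕ)) ↔ m = Fin.last p := by
      rw [Fin.ext_iff, Fin.val_last, eq_comm]
    simp only [e] at h
    rw [h]
    exact Finset.sum_congr rfl fun j _ => by rw [div_eq_inv_mul]
  · have h := congrArg (Polynomial.eval (lam i)) (Lagrange.eq_interpolate hinj (hdeg m))
    simp only [Lagrange.interpolate_apply, Polynomial.eval_pow, Polynomial.eval_X,
      Polynomial.eval_finsetSum, Polynomial.eval_mul, Polynomial.eval_C, Lagrange.basis,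
      Polynomial.eval_prod, Lagrange.basisDivisor, Polynomial.eval_sub] at h
    simp only [borderJacobian, Matrix.of_apply, Fin.cons_succ, Matrix.vandermonde_apply]
    rw [h, Finset.mul_sum]
    refine Finset.sum_congr rfl fun j _ => ?_
    rw [Finset.prod_mul_distrib, Finset.prod_inv_distrib]
    ring

theorem abs_det_borderJacobian {lam : Fin p → ℝ} {mu : Fin (p + 1) → ℝ} (hlam : StrictMono lam)
    (hmu : StrictMono mu) : |(borderJacobian lam mu).det| = vdm mu / vdm lam := by
  have h := congrArg (fun M => |Matrix.det M|) (borderJacobian_mul lam hmu)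
  simp only [Matrix.det_mul, Matrix.det_mul_column, abs_mul, ← vdm_eq_det] at h
  have hK : |(Matrix.of (Fin.cons (fun m => if m = Fin.last p then (1 : ℝ) else 0)
      fun i (m : Fin (p + 1)) =>
        (∏ k ∈ Finset.univ.erase i, (lam i - lam k))⁻¹ * lam i ^ (m : ℕ))).det|
      = (vdm lam ^ 2)⁻¹ * vdm lam := by
    rw [Matrix.det_succ_row_zero, Finset.sum_eq_single (Fin.last p)]
    · have e : (Matrix.of (Fin.cons (fun m => if m = Fin.last p then (1 : ℝ) else 0)
        fun i (m : Fin (p + 1)) =>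
        (∏ k ∈ Finset.univ.erase i, (lam i - lam k))⁻¹ * lam i ^ (m : ℕ))).submatrix Fin.succ
          (Fin.last p).succAbove = Matrix.of fun i j =>
          (∏ k ∈ Finset.univ.erase i, (lam i - lam k))⁻¹ * Matrix.vandermonde lam i j := by
        ext i j
        simp
      rw [e, Matrix.det_mul_column, ← vdm_eq_det, abs_mul, abs_mul, abs_mul, Finset.abs_prod]
      simp only [abs_inv, Finset.prod_inv_distrib, prod_abs_erase, abs_pow, abs_neg, abs_one,
        one_pow, one_mul, Matrix.of_apply, Fin.cons_zero, if_true, abs_of_pos (vdm_pos hlam)]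
    · intro m _ hm
      simp [hm]
    · intro h; exact absurd (Finset.mem_univ _) h
  rw [hK, Finset.abs_prod] at h
  simp only [abs_inv, Finset.prod_inv_distrib, prod_abs_erase, abs_of_pos (vdm_pos hmu)] at h
  have h1 := vdm_pos hlam
  have h2 := vdm_pos hmu
  field_simp at h
  rw [eq_div_iff h1.ne', mul_comm]
  linarith

/-! ### Integration over interlacing sequences -/

theorem setOf_interlaced (mu : Fin (p + 1) → ℝ) :
    {lam : Fin p → ℝ | Interlaced lam mu}
      = Set.univ.pi fun i => Set.Ioo (mu i.castSucc) (mu i.succ) := by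
  ext lam
  simp [Interlaced]

theorem integral_pow_Ioo {a b : ℝ} (h : a ≤ b) (k : ℕ) :
    ∫ x in Set.Ioo a b, x ^ k = (b ^ (k + 1) - a ^ (k + 1)) / (k + 1) := by
  rw [← integral_Ioc_eq_integral_Ioo, ← intervalIntegral.integral_of_le h, integral_pow]

/-- Subtracting from every row of a Vandermonde matrix the preceding one. -/
theorem det_pow_sub_pow (mu : Fin (p + 1) → ℝ) :
    (Matrix.of fun i j : Fin p => mu i.succ ^ ((j : ℕ) + 1) - mu i.castSucc ^ ((j : ℕ) + 1)).det
      = vdm mu := by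
  rw [vdm_eq_det, Matrix.det_eq_of_forall_row_eq_smul_add_pred
    (A := Matrix.vandermonde mu) (B := Matrix.of (Fin.cons (Matrix.vandermonde mu 0)
      fun i j => mu i.succ ^ (j : ℕ) - mu i.castSucc ^ (j : ℕ))) (fun _ => 1)
    (fun j => rfl) (fun i j => by simp [Matrix.vandermonde_apply])]
  rw [Matrix.det_succ_column_zero, Fin.sum_univ_succ]
  simp only [Matrix.of_apply, Fin.cons_succ, Fin.val_zero, pow_zero, sub_self, mul_zero, zero_mul,
    Finset.sum_const_zero, add_zero, Fin.cons_zero, Matrix.vandermonde_apply, one_mul]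
  congr 1

/-- The integral of the Vandermonde determinant over a box of intervals is again a determinant, with
columns `(mu_{i+1}^{j+1} - mu_i^{j+1}) / (j + 1)`. -/
theorem integral_vdm_interlaced {mu : Fin (p + 1) → ℝ} (hmu : StrictMono mu) :
    IntegrableOn vdm {lam : Fin p → ℝ | Interlaced lam mu} ∧
    ∫ lam in {lam : Fin p → ℝ | Interlaced lam mu}, vdm lam = vdm mu / (p.factorial : ℝ) := by
  have hexp : ∀ lam : Fin p → ℝ, vdm lam
      = ∑ σ : Equiv.Perm (Fin p), ((Equiv.Perm.sign σ : ℤ) : ℝ) * ∏ i, lam i ^ (σ i : ℕ) := by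
    intro lam
    rw [vdm_eq_det, ← Matrix.det_transpose, Matrix.det_apply']
    rfl
  have hle : ∀ i : Fin p, mu i.castSucc ≤ mu i.succ := fun i => (hmu i.castSucc_lt_succ).le
  have hint : ∀ (i : Fin p) (k : ℕ), Integrable (fun x : ℝ => x ^ k)
      ((volume : Measure ℝ).restrict (Set.Ioo (mu i.castSucc) (mu i.succ))) := by
    intro i k
    exact ((continuous_pow k).continuousOn.integrableOn_Icc (a := mu i.castSucc)
      (b := mu i.succ)).mono_set Set.Ioo_subset_Icc_self
  have hmeas : (volume : Measure (Fin p → ℝ)).restrict {lam : Fin p → ℝ | Interlaced lam mu}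
      = Measure.pi fun i => (volume : Measure ℝ).restrict
        (Set.Ioo (mu i.castSucc) (mu i.succ)) := by
    rw [setOf_interlaced, volume_pi, Measure.restrict_pi_pi]
  have hterm : ∀ σ : Equiv.Perm (Fin p), Integrable
      (fun lam : Fin p → ℝ => ((Equiv.Perm.sign σ : ℤ) : ℝ) * ∏ i, lam i ^ (σ i : ℕ))
      (Measure.pi fun i => (volume : Measure ℝ).restrict
        (Set.Ioo (mu i.castSucc) (mu i.succ))) := fun σ =>
    (Integrable.fintype_prod (f := fun i (x : ℝ) => x ^ (σ i : ℕ)) fun i =>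
      hint i (σ i)).const_mul _
  constructor
  · rw [IntegrableOn, hmeas]
    simp only [funext hexp]
    exact integrable_finsetSum _ fun σ _ => hterm σ
  · rw [hmeas]
    simp only [hexp]
    rw [integral_finsetSum _ fun σ _ => hterm σ]
    have : ∀ σ : Equiv.Perm (Fin p), ∫ lam : Fin p → ℝ,
        ((Equiv.Perm.sign σ : ℤ) : ℝ) * ∏ i, lam i ^ (σ i : ℕ)
        ∂(Measure.pi fun i => (volume : Measure ℝ).restrict
        (Set.Ioo (mu i.castSucc) (mu i.succ)))
        = ((Equiv.Perm.sign σ : ℤ) : ℝ) * ∏ i : Fin p,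
          (Matrix.of fun i j : Fin p => ((j : ℝ) + 1)⁻¹ *
            (mu i.succ ^ ((j : ℕ) + 1) - mu i.castSucc ^ ((j : ℕ) + 1))).transpose (σ i) i := by
      intro σ
      rw [integral_const_mul, integral_fintype_prod_eq_prod (f := fun i (x : ℝ) => x ^ (σ i : ℕ))]
      congr 1
      refine Finset.prod_congr rfl fun i _ => ?_
      rw [integral_pow_Ioo (hle i), Matrix.transpose_apply, Matrix.of_apply, div_eq_inv_mul]
    simp only [this]
    rw [← Matrix.det_apply', Matrix.det_transpose]
    have hrow := Matrix.det_mul_row (fun j : Fin p => ((j : ℝ) + 1)⁻¹)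
      (Matrix.of fun i j : Fin p => mu i.succ ^ ((j : ℕ) + 1) - mu i.castSucc ^ ((j : ℕ) + 1))
    simp only [Matrix.of_apply] at hrow
    rw [hrow, det_pow_sub_pow, Finset.prod_inv_distrib, div_eq_inv_mul]
    congr 2
    rw [← Finset.prod_range_add_one_eq_factorial, Finset.prod_range]
    push_cast
    rfl

end BorderAnalysis


/-! ### Products of densities and rotations of Gaussian vectors -/

theorem pi_withDensity {ι : Type*} [Fintype ι] (f : ι → ℝ → ℝ) (hf : ∀ i x, 0 ≤ f i x)
    (hi : ∀ i, Integrable (f i)) :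
    Measure.pi (fun i => (volume : Measure ℝ).withDensity fun x => ENNReal.ofReal (f i x))
      = (volume : Measure (ι → ℝ)).withDensity fun x => ENNReal.ofReal (∏ i, f i (x i)) := by
  have _ : ∀ i, IsFiniteMeasure
      ((volume : Measure ℝ).withDensity fun x => ENNReal.ofReal (f i x)) := fun i =>
    isFiniteMeasure_withDensity_ofReal (hi i).2
  refine Measure.pi_eq fun s hs => ?_
  rw [withDensity_apply _ (MeasurableSet.univ_pi hs), volume_pi, Measure.restrict_pi_pi,
    ← ofReal_integral_eq_lintegral_ofReal, integral_fintype_prod_eq_prod,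
    ENNReal.ofReal_prod_of_nonneg]
  · refine Finset.prod_congr rfl fun i _ => ?_
    rw [withDensity_apply _ (hs i), ← ofReal_integral_eq_lintegral_ofReal (hi i).restrict
      (ae_of_all _ (hf i))]
  · exact fun i _ => integral_nonneg (hf i)
  · exact Integrable.fintype_prod fun i => (hi i).restrict
  · exact ae_of_all _ fun x => Finset.prod_nonneg fun i _ => hf i _

theorem pi_gaussianReal_eq_withDensity {ι : Type*} [Fintype ι] {v : NNReal} (hv : v ≠ 0) :
    Measure.pi (fun _ : ι => gaussianReal 0 v) = (volume : Measure (ι → ℝ)).withDensity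
      fun x => ENNReal.ofReal ((√(2 * Real.pi * v))⁻¹ ^ Fintype.card ι *
        Real.exp (-(∑ i, x i ^ 2) / (2 * v))) := by
  have h : gaussianReal 0 v
      = volume.withDensity fun x => ENNReal.ofReal (gaussianPDFReal 0 v x) := by
    rw [gaussianReal_of_var_ne_zero 0 hv]; rfl
  rw [h, pi_withDensity (fun _ => gaussianPDFReal 0 v) (fun _ => gaussianPDFReal_nonneg _ _)
    (fun _ => integrable_gaussianPDFReal _ _)]
  congr 1
  funext x
  simp only [gaussianPDFReal, Finset.prod_mul_distrib, Finset.prod_const, ← Real.exp_sum,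
    Finset.card_univ, sub_zero, ← Finset.sum_div, Finset.sum_neg_distrib]

/-- A centred Gaussian vector with independent coordinates of equal variance is invariant under
orthogonal matrices. -/
theorem measurePreserving_mulVec_gaussian {ι : Type*} [Fintype ι] [DecidableEq ι] {v : NNReal}
    (hv : v ≠ 0) {O : Matrix ι ι ℝ} (hO : O.transpose * O = 1) :
    MeasurePreserving (fun x => O.mulVec x) (Measure.pi fun _ : ι => gaussianReal 0 v)
      (Measure.pi fun _ : ι => gaussianReal 0 v) := by
  have hdet : |O.det| = 1 := by
    have h := congrArg Matrix.det hO
    rw [Matrix.det_mul, Matrix.det_transpose, Matrix.det_one] at h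
    rcases mul_self_eq_one_iff.1 h with h | h <;> rw [h] <;> norm_num
  have hsq : ∀ x, ∑ i, O.mulVec x i ^ 2 = ∑ i, x i ^ 2 := by
    intro x
    have h1 : ∀ y : ι → ℝ, ∑ i, y i ^ 2 = dotProduct y y := fun y =>
      Finset.sum_congr rfl fun i _ => sq _
    rw [h1, h1, Matrix.dotProduct_mulVec, Matrix.vecMul_mulVec, hO, Matrix.vecMul_one]
  have hmeas : Measurable fun x : ι → ℝ => O.mulVec x :=
    (Continuous.matrix_mulVec continuous_const continuous_id).measurable
  have hvol : Measure.map (fun x => O.mulVec x) volume = (volume : Measure (ι → ℝ)) := by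
    have h := Real.map_matrix_volume_pi_eq_smul_volume_pi (M := O)
      (fun h0 => by rw [h0, abs_zero] at hdet; exact zero_ne_one hdet)
    rw [abs_inv, hdet, inv_one, ENNReal.ofReal_one, one_smul] at h
    exact h
  refine ⟨hmeas, ?_⟩
  rw [pi_gaussianReal_eq_withDensity hv]
  ext s hs
  rw [Measure.map_apply hmeas hs, withDensity_apply _ (hmeas hs), withDensity_apply _ hs]
  conv_rhs => rw [← hvol, setLIntegral_map hs (by fun_prop) hmeas]
  simp only [hsq]

/-- Unitary invariance of the complex Gaussian vector `u + i w`. -/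
theorem measurePreserving_unitary_gaussian {p : ℕ} {v : NNReal} (hv : v ≠ 0)
    {V : Matrix (Fin p) (Fin p) ℂ} (hV : star V * V = 1) :
    MeasurePreserving (fun x : (Fin p → ℝ) × (Fin p → ℝ) =>
        ((fun i => (V.mulVec (fun i => (x.1 i : ℂ) + Complex.I * x.2 i) i).re),
          (fun i => (V.mulVec (fun i => (x.1 i : ℂ) + Complex.I * x.2 i) i).im)))
      ((Measure.pi fun _ : Fin p => gaussianReal 0 v).prod
        (Measure.pi fun _ : Fin p => gaussianReal 0 v))
      ((Measure.pi fun _ : Fin p => gaussianReal 0 v).prod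
        (Measure.pi fun _ : Fin p => gaussianReal 0 v)) := by
  set A : Matrix (Fin p) (Fin p) ℝ := V.map Complex.re with hA
  set B : Matrix (Fin p) (Fin p) ℝ := V.map Complex.im with hB
  have h1 : A.transpose * A + B.transpose * B = 1 := by
    ext i j
    have h := congrArg Complex.re (congrFun (congrFun hV i) j)
    simp only [Matrix.mul_apply, Matrix.star_apply, Complex.re_sum, Complex.mul_re,
      RCLike.star_def, Complex.conj_re, Complex.conj_im] at h
    rw [Matrix.add_apply, Matrix.mul_apply, Matrix.mul_apply, ← Finset.sum_add_distrib]
    simp only [Matrix.transpose_apply, hA, hB, Matrix.map_apply]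
    convert h using 1
    · exact Finset.sum_congr rfl fun k _ => by ring
    · rw [Matrix.one_apply, Matrix.one_apply]; split_ifs <;> simp
  have h2 : A.transpose * B = B.transpose * A := by
    ext i j
    have h := congrArg Complex.im (congrFun (congrFun hV i) j)
    simp only [Matrix.mul_apply, Matrix.star_apply, Complex.im_sum, Complex.mul_im,
      RCLike.star_def, Complex.conj_re, Complex.conj_im] at h
    have h0 : ((1 : Matrix (Fin p) (Fin p) ℂ) i j).im = 0 := by
      rw [Matrix.one_apply]; split_ifs <;> simp
    rw [h0, Finset.sum_add_distrib] at h
    simp only [neg_mul, Finset.sum_neg_distrib] at h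
    simp only [Matrix.mul_apply, Matrix.transpose_apply, hA, hB, Matrix.map_apply]
    linarith
  set O : Matrix (Fin p ⊕ Fin p) (Fin p ⊕ Fin p) ℝ := Matrix.fromBlocks A (-B) B A with hOdef
  have hO : O.transpose * O = 1 := by
    rw [hOdef, Matrix.fromBlocks_transpose, Matrix.fromBlocks_multiply, ← Matrix.fromBlocks_one]
    congr 1
    · rw [Matrix.mul_neg, h2, neg_add_cancel]
    · rw [Matrix.transpose_neg, Matrix.neg_mul, h2, neg_add_cancel]
    · rw [Matrix.transpose_neg, Matrix.neg_mul, Matrix.mul_neg, neg_neg, add_comm, h1]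
  have hsum := measurePreserving_sumPiEquivProdPi_symm
    (fun _ : Fin p ⊕ Fin p => gaussianReal 0 v)
  have hsum' := measurePreserving_sumPiEquivProdPi
    (fun _ : Fin p ⊕ Fin p => gaussianReal 0 v)
  convert (hsum'.comp (measurePreserving_mulVec_gaussian hv hO)).comp hsum using 1
  funext x
  refine Prod.ext ?_ ?_
  · funext i
    change _ = O.mulVec (Sum.elim x.1 x.2) (Sum.inl i)
    rw [hOdef, Matrix.fromBlocks_mulVec]
    simp [Matrix.mulVec, dotProduct, hA, hB, Finset.sum_add_distrib, Complex.mul_re, sub_eq_add_neg]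
  · funext i
    change _ = O.mulVec (Sum.elim x.1 x.2) (Sum.inr i)
    rw [hOdef, Matrix.fromBlocks_mulVec]
    simp [Matrix.mulVec, dotProduct, hA, hB, Finset.sum_add_distrib, Complex.mul_im]
    ring


/-! ### The law of a bordered Gaussian matrix -/

section BorderLaw
variable {p : ℕ}

/-- The law of the free real coordinates of a matrix from the Gaussian Unitary Ensemble. -/
noncomputable abbrev gueMeasure (p : ℕ) : Measure (Fin p × Fin p → ℝ) :=
  Measure.pi fun ij : Fin p × Fin p => gaussianReal 0 (if ij.1 = ij.2 then 1 / 2 else 1 / 4)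

theorem measurable_borderCoord : Measurable
    fun x : (Fin p × Fin p → ℝ) × ((Fin p → ℝ) × (Fin p → ℝ)) × ℝ =>
      borderCoord x.2.2 x.2.1.1 x.2.1.2 x.1 := by
  refine measurable_pi_lambda _ fun ij => ?_
  obtain ⟨i, j⟩ := ij
  refine Fin.cases ?_ (fun i => ?_) i <;> refine Fin.cases ?_ (fun j => ?_) j <;>
    simp only [borderCoord, Fin.cases_zero, Fin.cases_succ] <;> fun_prop

/-- A matrix of the ensemble of size `p + 1` is a matrix of the ensemble of size `p` with an
independent Gaussian border. -/
theorem measurePreserving_borderCoord : MeasurePreserving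
    (fun x : (Fin p × Fin p → ℝ) × ((Fin p → ℝ) × (Fin p → ℝ)) × ℝ =>
      borderCoord x.2.2 x.2.1.1 x.2.1.2 x.1)
    ((gueMeasure p).prod (((Measure.pi fun _ : Fin p => gaussianReal 0 (1 / 4)).prod
      (Measure.pi fun _ : Fin p => gaussianReal 0 (1 / 4))).prod (gaussianReal 0 (1 / 2))))
    (gueMeasure (p + 1)) := by
  refine ⟨measurable_borderCoord, (Measure.pi_eq fun s hs => ?_).symm⟩
  rw [Measure.map_apply measurable_borderCoord (MeasurableSet.univ_pi hs)]
  have hpre : (fun x : (Fin p × Fin p → ℝ) × ((Fin p → ℝ) × (Fin p → ℝ)) × ℝ =>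
      borderCoord x.2.2 x.2.1.1 x.2.1.2 x.1) ⁻¹' Set.univ.pi s =
      (Set.univ.pi fun ij : Fin p × Fin p => s (ij.1.succ, ij.2.succ)) ×ˢ
        (((Set.univ.pi fun j : Fin p => s (0, j.succ)) ×ˢ
          (Set.univ.pi fun i : Fin p => s (i.succ, 0))) ×ˢ s (0, 0)) := by
    ext x
    simp only [Set.mem_preimage, Set.mem_prod, Set.mem_univ_pi, Prod.forall, Fin.forall_fin_succ,
      borderCoord, Fin.cases_zero, Fin.cases_succ, forall_and]
    tauto
  rw [hpre, Measure.prod_prod, Measure.prod_prod, Measure.prod_prod, Measure.pi_pi, Measure.pi_pi,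
    Measure.pi_pi, Fintype.prod_prod_type, Fintype.prod_prod_type, Fin.prod_univ_succ,
    Fin.prod_univ_succ]
  simp only [Fin.prod_univ_succ, Fin.succ_ne_zero, (Fin.succ_ne_zero _).symm, if_true, if_false,
    Fin.succ_inj, Finset.prod_mul_distrib]
  ring

/-- The density of the exponential law with mean `1/2`. -/
noncomputable def expDensity : ℝ → ℝ := Set.indicator (Set.Ioi 0) fun r => 2 * Real.exp (-(2 * r))

theorem expDensity_nonneg (r : ℝ) : 0 ≤ expDensity r :=
  Set.indicator_nonneg (fun _ _ => by positivity) r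

theorem measurable_expDensity : Measurable expDensity :=
  Measurable.indicator (by fun_prop) measurableSet_Ioi

theorem integrable_expDensity : Integrable expDensity := by
  rw [expDensity, integrable_indicator_iff measurableSet_Ioi]
  have h := (exp_neg_integrableOn_Ioi 0 (zero_lt_two (α := ℝ))).const_mul 2
  simpa only [neg_mul, IntegrableOn] using h

/-- The exponential law with mean `1/2`. -/
noncomputable abbrev expLaw : Measure ℝ :=
  volume.withDensity fun r => ENNReal.ofReal (expDensity r)

/-- The squared modulus of a complex Gaussian variable is exponentially distributed. -/
theorem measurePreserving_sq_add_sq : MeasurePreserving (fun x : ℝ × ℝ => x.1 ^ 2 + x.2 ^ 2)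
    ((gaussianReal 0 (1 / 4)).prod (gaussianReal 0 (1 / 4))) expLaw := by
  have hm : Measurable fun x : ℝ × ℝ => x.1 ^ 2 + x.2 ^ 2 := by fun_prop
  refine ⟨hm, Measure.ext_of_lintegral _ fun φ hφ => ?_⟩
  rw [lintegral_map hφ hm, lintegral_withDensity_eq_lintegral_mul _
    (measurable_expDensity.ennreal_ofReal) hφ, gaussianReal_of_var_ne_zero 0 (by norm_num),
    prod_withDensity (measurable_gaussianPDF _ _) (measurable_gaussianPDF _ _),
    lintegral_withDensity_eq_lintegral_mul _ (by fun_prop) (by fun_prop), ← Measure.volume_eq_prod,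
    ← lintegral_comp_polarCoord_symm]
  have hpdf : ∀ q : ℝ × ℝ, ENNReal.ofReal q.1 •
      ((fun z : ℝ × ℝ => gaussianPDF 0 (1 / 4) z.1 * gaussianPDF 0 (1 / 4) z.2) *
        fun x : ℝ × ℝ => φ (x.1 ^ 2 + x.2 ^ 2)) (polarCoord.symm q)
      = ENNReal.ofReal q.1 * (ENNReal.ofReal (2 / Real.pi * Real.exp (-(2 * q.1 ^ 2))) *
        φ (q.1 ^ 2)) := by
    intro q
    have e : (q.1 * Real.cos q.2) ^ 2 + (q.1 * Real.sin q.2) ^ 2 = q.1 ^ 2 := by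
      linear_combination q.1 ^ 2 * Real.sin_sq_add_cos_sq q.2
    simp only [polarCoord_symm_apply, Pi.mul_apply, smul_eq_mul, e, gaussianPDF]
    rw [← ENNReal.ofReal_mul (gaussianPDFReal_nonneg _ _ _)]
    congr 3
    simp only [gaussianPDFReal, sub_zero]
    rw [mul_mul_mul_comm, ← Real.exp_add, ← mul_inv, Real.mul_self_sqrt (by positivity)]
    congr 1
    · push_cast; field_simp; norm_num
    · congr 1
      push_cast
      rw [← e]
      ring
  simp only [hpdf]
  have himg : (fun ρ : ℝ => ρ ^ 2) '' Set.Ioi 0 = Set.Ioi 0 := by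
    ext r
    constructor
    · rintro ⟨ρ, hρ, rfl⟩
      exact pow_pos (Set.mem_Ioi.1 hρ) 2
    · intro hr
      exact ⟨√r, Real.sqrt_pos.2 hr, Real.sq_sqrt (le_of_lt hr)⟩
  have hrhs : ∫⁻ r, ((fun r => ENNReal.ofReal (expDensity r)) * φ) r
      = ∫⁻ r in Set.Ioi (0 : ℝ), ENNReal.ofReal (2 * Real.exp (-(2 * r))) * φ r := by
    rw [← lintegral_indicator measurableSet_Ioi]
    refine lintegral_congr fun r => ?_
    by_cases hr : r ∈ Set.Ioi (0 : ℝ) <;> simp [expDensity, hr]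
  rw [hrhs, ← himg, lintegral_image_eq_lintegral_abs_deriv_mul measurableSet_Ioi
    (f' := fun ρ => 2 * ρ) (fun ρ _ => by simpa using (hasDerivAt_pow 2 ρ).hasDerivWithinAt)
    (fun x hx y hy h => (pow_left_inj₀ (le_of_lt hx) (le_of_lt hy) two_ne_zero).1 h),
    polarCoord_target, Measure.volume_eq_prod, ← Measure.prod_restrict, lintegral_prod _
    (by fun_prop)]
  refine setLIntegral_congr_fun measurableSet_Ioi fun ρ hρ => ?_
  have hρ' : 0 < ρ := hρ
  simp only [lintegral_const, Measure.restrict_apply_univ, Real.volume_Ioo, abs_of_pos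
    (mul_pos two_pos hρ')]
  rw [← mul_assoc, ← mul_assoc, mul_right_comm, ← ENNReal.ofReal_mul hρ'.le,
    ← ENNReal.ofReal_mul (by positivity), ← ENNReal.ofReal_mul (by positivity)]
  congr 2
  field_simp
  ring

/-- The law of the diagonal entry and of the squared moduli of a Gaussian border. -/
theorem lintegral_gaussian_border (G : (Fin p → ℝ) × ℝ → ENNReal) (hG : Measurable G) :
    ∫⁻ x, G (fun i => x.1.1 i ^ 2 + x.1.2 i ^ 2, x.2)
      ∂((((Measure.pi fun _ : Fin p => gaussianReal 0 (1 / 4)).prod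
      (Measure.pi fun _ : Fin p => gaussianReal 0 (1 / 4))).prod (gaussianReal 0 (1 / 2))))
    = ∫⁻ y : Fin (p + 1) → ℝ, ENNReal.ofReal (gaussianPDFReal 0 (1 / 2) (y 0) *
        ∏ i : Fin p, expDensity (y i.succ)) * G (fun i => y i.succ, y 0) := by
  have _ : IsFiniteMeasure expLaw := isFiniteMeasure_withDensity_ofReal integrable_expDensity.2
  have h1 : MeasurePreserving (fun x : (Fin p → ℝ) × (Fin p → ℝ) => fun i => x.1 i ^ 2 + x.2 i ^ 2)
      ((Measure.pi fun _ : Fin p => gaussianReal 0 (1 / 4)).prod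
      (Measure.pi fun _ : Fin p => gaussianReal 0 (1 / 4))) (Measure.pi fun _ : Fin p => expLaw) :=
    (measurePreserving_pi _ _ fun _ : Fin p => measurePreserving_sq_add_sq).comp
      (measurePreserving_arrowProdEquivProdArrow ℝ ℝ (Fin p) (fun _ => gaussianReal 0 (1 / 4))
        (fun _ => gaussianReal 0 (1 / 4))).symm
  have h2 := h1.prod (MeasurePreserving.id (gaussianReal 0 (1 / 2)))
  refine (h2.lintegral_comp hG).trans ?_
  set f : Fin (p + 1) → ℝ → ℝ := Fin.cons (gaussianPDFReal 0 (1 / 2)) fun _ => expDensity with hf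
  have hfi : ∀ i, Integrable (f i) := Fin.cases (integrable_gaussianPDFReal _ _)
    fun _ => integrable_expDensity
  have hfn : ∀ i x, 0 ≤ f i x := Fin.cases (gaussianPDFReal_nonneg _ _)
    fun _ => expDensity_nonneg
  have hfm : ∀ i, Measurable (f i) := Fin.cases (measurable_gaussianPDFReal _ _)
    fun _ => measurable_expDensity
  have _ : ∀ i, IsFiniteMeasure
      ((volume : Measure ℝ).withDensity fun x => ENNReal.ofReal (f i x)) := fun i =>
    isFiniteMeasure_withDensity_ofReal (hfi i).2
  have h3 := measurePreserving_piFinSuccAbove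
    (fun i => (volume : Measure ℝ).withDensity fun x => ENNReal.ofReal (f i x)) 0
  have h4 := h3.lintegral_comp (hG.comp measurable_swap)
  have h5 : gaussianReal 0 (1 / 2) = volume.withDensity fun x => ENNReal.ofReal (f 0 x) := by
    rw [gaussianReal_of_var_ne_zero 0 (by norm_num)]; rfl
  rw [← lintegral_prod_swap, h5]
  refine h4.symm.trans ?_
  have hprod : ∀ y : Fin (p + 1) → ℝ, ∏ i, f i (y i)
      = gaussianPDFReal 0 (1 / 2) (y 0) * ∏ i : Fin p, expDensity (y i.succ) := fun y => by
    rw [Fin.prod_univ_succ]; rfl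
  rw [pi_withDensity f hfn hfi, lintegral_withDensity_eq_lintegral_mul _]
  · refine lintegral_congr fun y => ?_
    rw [Pi.mul_apply, hprod]
    rfl
  · exact (Finset.measurable_fun_prod _ fun i _ =>
      (hfm i).comp (measurable_pi_apply i)).ennreal_ofReal
  · exact (hG.comp measurable_swap).comp h3.measurable

end BorderLaw


/-! ### From the border to the eigenvalues -/

section BorderChange
variable {p : ℕ}

theorem measurableSet_interlaced :
    MeasurableSet {x : (Fin p → ℝ) × (Fin (p + 1) → ℝ) | Interlaced x.1 x.2} := by
  simp only [Interlaced, Set.ofPred_forall]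
  refine MeasurableSet.iInter fun i => MeasurableSet.inter
    (measurableSet_lt (f := fun x : (Fin p → ℝ) × (Fin (p + 1) → ℝ) => x.2 i.castSucc)
      (g := fun x => x.1 i) (by fun_prop) (by fun_prop))
    (measurableSet_lt (f := fun x : (Fin p → ℝ) × (Fin (p + 1) → ℝ) => x.1 i)
      (g := fun x => x.2 i.succ) (by fun_prop) (by fun_prop))

/-- With `lam` fixed, the eigenvalues of the bordered matrices whose border has no vanishing
coordinate are the tuples which interlace with `lam`. -/
theorem image_borderMap {lam : Fin p → ℝ} (hlam : StrictMono lam) :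
    borderMap lam '' {mu | Interlaced lam mu} = {y | ∀ i : Fin p, 0 < y i.succ} := by
  ext y
  constructor
  · rintro ⟨mu, hmu, rfl⟩ i
    exact Interlaced.borderWeight_pos hmu i
  · intro hy
    have hy' : ∀ i : Fin p, 0 < y i.succ := hy
    set c := borderCoord (y 0) (fun i => √(y i.succ)) 0 (diagCoord lam) with hc
    have hpoly := charpoly_border (y 0) (fun i => √(y i.succ)) 0 (diagCoord lam) 1 lam (by simp)
      (by simp [hermitianOfCoord_diagCoord])
    rw [← hc, charpoly_hermitianOfCoord] at hpoly
    have hr : (fun i => Complex.normSq ((star (1 : Matrix (Fin p) (Fin p) ℂ)).mulVec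
        (fun i => ((√(y i.succ) : ℝ) : ℂ) + Complex.I * ((0 : Fin p → ℝ) i : ℝ)) i))
        = fun i => y i.succ := by
      funext i
      simp [Real.mul_self_sqrt (hy' i).le]
    rw [hr] at hpoly
    have hb := borderMap_eq_of_borderPoly_eq hlam hpoly.symm
    refine ⟨coordEigenvalues c, interlaced_of_borderWeight_pos hlam
      (coordEigenvalues_monotone c) fun i => ?_, ?_⟩
    · have := congrFun hb i.succ
      simp only [borderMap, Fin.cons_succ] at this
      rw [this]
      exact hy' i
    · rw [hb]
      exact Fin.cons_self_tail y

/-- Change of variables from the border to the eigenvalues of the bordered matrix. -/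
theorem lintegral_border_eq {lam : Fin p → ℝ} (hlam : StrictMono lam)
    (F : (Fin (p + 1) → ℝ) → ENNReal) :
    ∫⁻ y : Fin (p + 1) → ℝ, ENNReal.ofReal (gaussianPDFReal 0 (1 / 2) (y 0) *
        ∏ i : Fin p, expDensity (y i.succ)) *
        F (coordEigenvalues (borderCoord (y 0) (fun i => √(y i.succ)) 0 (diagCoord lam)))
    = ∫⁻ mu in {mu | Interlaced lam mu}, ENNReal.ofReal (2 ^ p / √Real.pi *
        Real.exp (∑ i, lam i ^ 2 - ∑ j, mu j ^ 2) * (vdm mu / vdm lam)) * F mu := by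
  have hS : MeasurableSet {y : Fin (p + 1) → ℝ | ∀ i : Fin p, 0 < y i.succ} := by
    simp only [Set.ofPred_forall]
    exact MeasurableSet.iInter fun i => measurableSet_lt measurable_const (by fun_prop)
  have hI : MeasurableSet {mu : Fin (p + 1) → ℝ | Interlaced lam mu} :=
    measurable_prodMk_left measurableSet_interlaced
  have hstep : ∀ y : Fin (p + 1) → ℝ, ENNReal.ofReal (gaussianPDFReal 0 (1 / 2) (y 0) *
        ∏ i : Fin p, expDensity (y i.succ)) *
        F (coordEigenvalues (borderCoord (y 0) (fun i => √(y i.succ)) 0 (diagCoord lam)))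
      = Set.indicator {y : Fin (p + 1) → ℝ | ∀ i : Fin p, 0 < y i.succ}
        (fun y => ENNReal.ofReal (2 ^ p / √Real.pi *
          Real.exp (-(y 0 ^ 2 + 2 * ∑ i : Fin p, y i.succ))) *
        F (coordEigenvalues (borderCoord (y 0) (fun i => √(y i.succ)) 0 (diagCoord lam)))) y := by
    intro y
    by_cases hy : ∀ i : Fin p, 0 < y i.succ
    · rw [Set.indicator_of_mem (show y ∈ {y : Fin (p + 1) → ℝ | ∀ i : Fin p, 0 < y i.succ} from hy)]
      congr 2
      have h1 : ∀ i : Fin p, expDensity (y i.succ) = 2 * Real.exp (-(2 * y i.succ)) := fun i =>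
        Set.indicator_of_mem (Set.mem_Ioi.2 (hy i)) _
      simp only [h1, Finset.prod_mul_distrib, ← Real.exp_sum, gaussianPDFReal, Finset.prod_const,
        Finset.card_univ, Fintype.card_fin]
      rw [mul_mul_mul_comm, ← Real.exp_add, Finset.sum_neg_distrib, ← Finset.mul_sum]
      congr 1
      · push_cast
        rw [show 2 * Real.pi * (1 / 2) = Real.pi by ring, div_eq_inv_mul]
      · congr 1
        push_cast
        ring
    · rw [Set.indicator_of_notMem
        (show y ∉ {y : Fin (p + 1) → ℝ | ∀ i : Fin p, 0 < y i.succ} from hy)]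
      push Not at hy
      obtain ⟨i, hi⟩ := hy
      have h0 : expDensity (y i.succ) = 0 :=
        Set.indicator_of_notMem (by simpa using hi) _
      rw [Finset.prod_eq_zero (Finset.mem_univ i) h0, mul_zero, ENNReal.ofReal_zero, zero_mul]
  simp only [hstep]
  rw [lintegral_indicator hS, ← image_borderMap hlam,
    lintegral_image_eq_lintegral_abs_det_fderiv_mul volume hI
      (fun mu _ => (hasFDerivAt_borderMap lam mu).hasFDerivWithinAt) (borderMap_injOn hlam)]
  refine setLIntegral_congr_fun hI fun mu hmu => ?_
  have hmu' : Interlaced lam mu := hmu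
  have hev := coordEigenvalues_border_interlaced hmu'
  have hdet : |(LinearMap.toContinuousLinearMap (Matrix.toLin' (borderJacobian lam mu))).det|
      = vdm mu / vdm lam := by
    rw [← abs_det_borderJacobian hlam hmu'.strictMono_right, ContinuousLinearMap.det,
      LinearMap.coe_toContinuousLinearMap, LinearMap.det_toLin']
  have h0 : borderMap lam mu 0 = ∑ j, mu j - ∑ i, lam i := rfl
  have h1 : ∀ i : Fin p, borderMap lam mu i.succ = borderWeight lam mu i := fun i => rfl
  simp only [h0, h1, hev, hdet]
  rw [← mul_assoc, ← ENNReal.ofReal_mul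
    (div_pos (vdm_pos hmu'.strictMono_right) (vdm_pos hlam)).le, mul_comm (vdm mu / vdm lam)]
  congr 5
  rw [hmu'.sum_sq]
  ring

end BorderChange


/-! ### The joint law of the eigenvalues of the Gaussian Unitary Ensemble -/

section JointLaw
variable {p : ℕ}

/-- The normalizing constant of the joint density of the ordered eigenvalues. -/
noncomputable def gueConst (p : ℕ) : ℝ :=
  2 ^ p.choose 2 / (√Real.pi ^ p * ∏ i ∈ Finset.range p, (i.factorial : ℝ))

theorem gueConst_pos (p : ℕ) : 0 < gueConst p := by
  have : 0 < √Real.pi := Real.sqrt_pos.2 Real.pi_pos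
  exact div_pos (by positivity) (mul_pos (by positivity)
    (Finset.prod_pos fun i _ => by exact_mod_cast i.factorial_pos))

theorem gueConst_succ (p : ℕ) :
    gueConst (p + 1) = gueConst p * (2 ^ p / √Real.pi) / (p.factorial : ℝ) := by
  rw [gueConst, gueConst, Finset.prod_range_succ, Nat.choose_succ_succ' p 1, Nat.choose_one_right,
    pow_add, pow_succ √Real.pi]
  ring

/-- The joint density of the ordered eigenvalues, on the strictly increasing tuples. -/
noncomputable def gueDensity {p : ℕ} (x : Fin p → ℝ) : ℝ :=
  gueConst p * vdm x ^ 2 * Real.exp (-∑ i, x i ^ 2)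

theorem continuous_vdm : Continuous (vdm (n := p)) := by
  unfold vdm
  fun_prop

theorem measurable_gueDensity : Measurable (gueDensity (p := p)) := by
  have := (continuous_vdm (p := p)).measurable
  unfold gueDensity
  fun_prop

theorem measurableSet_strictMono : MeasurableSet {x : Fin p → ℝ | StrictMono x} := by
  simp only [StrictMono, Set.ofPred_forall]
  exact MeasurableSet.iInter fun i => MeasurableSet.iInter fun j => MeasurableSet.iInter fun _ =>
    measurableSet_lt (measurable_pi_apply i) (measurable_pi_apply j)

/-- The eigenvalues of a bordered matrix depend only on the eigenvalues of the matrix and on the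
squared moduli of the border in an eigenbasis. -/
theorem coordEigenvalues_border_eq (a : ℝ) (u w : Fin p → ℝ) (c : Fin p × Fin p → ℝ)
    {U : Matrix (Fin p) (Fin p) ℂ} (hU : U * star U = 1)
    (hc : (hermitianOfCoord c).1
      = U * Matrix.diagonal (fun i => (coordEigenvalues c i : ℂ)) * star U) :
    coordEigenvalues (borderCoord a u w c) = coordEigenvalues (borderCoord a
      (fun i => √(((star U).mulVec (fun i => (u i : ℂ) + Complex.I * w i) i).re ^ 2 +
        ((star U).mulVec (fun i => (u i : ℂ) + Complex.I * w i) i).im ^ 2)) 0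
      (diagCoord (coordEigenvalues c))) := by
  refine coordEigenvalues_eq (coordEigenvalues_monotone _) ?_
  rw [← charpoly_hermitianOfCoord, charpoly_border _ _ _ _ U _ hU hc,
    charpoly_border _ _ _ _ 1 (coordEigenvalues c) (by simp) (by simp [hermitianOfCoord_diagCoord])]
  congr 1
  funext i
  rw [star_one, Matrix.one_mulVec, Complex.normSq_apply, Complex.normSq_apply]
  simp only [Pi.zero_apply, Complex.ofReal_zero, mul_zero, add_zero, Complex.ofReal_re,
    Complex.ofReal_im]
  rw [Real.mul_self_sqrt (by positivity), sq, sq]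

/-- The mean of a function of the eigenvalues of a bordered matrix, given the eigenvalues `lam`
of the matrix. -/
noncomputable def borderMean (F : (Fin (p + 1) → ℝ) → ENNReal) (lam : Fin p → ℝ) : ENNReal :=
  ∫⁻ y : Fin (p + 1) → ℝ, ENNReal.ofReal (gaussianPDFReal 0 (1 / 2) (y 0) *
    ∏ i : Fin p, expDensity (y i.succ)) *
    F (coordEigenvalues (borderCoord (y 0) (fun i => √(y i.succ)) 0 (diagCoord lam)))

theorem measurable_coordEigenvalues_border :
    Measurable fun x : (Fin p → ℝ) × (Fin p → ℝ) × ℝ =>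
      coordEigenvalues (borderCoord x.2.2 (fun i => √(x.2.1 i)) 0 (diagCoord x.1)) := by
  refine measurable_coordEigenvalues.comp (measurable_borderCoord.comp
    (f := fun x : (Fin p → ℝ) × (Fin p → ℝ) × ℝ => (diagCoord x.1,
      ((fun i => √(x.2.1 i), 0), x.2.2))) ?_)
  refine Measurable.prodMk (measurable_pi_lambda _ fun ij => ?_) (by fun_prop)
  simp only [diagCoord]
  split_ifs <;> fun_prop

theorem measurable_coordEigenvalues_border_right (lam : Fin p → ℝ) :
    Measurable fun x : (Fin p → ℝ) × ℝ =>
      coordEigenvalues (borderCoord x.2 (fun i => √(x.1 i)) 0 (diagCoord lam)) := by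
  have hk : Measurable fun x : (Fin p → ℝ) × ℝ =>
      (diagCoord lam, (((fun i => √(x.1 i)), (0 : Fin p → ℝ)), x.2)) := by fun_prop
  exact measurable_coordEigenvalues.comp (measurable_borderCoord.comp hk)

theorem measurable_borderMean {F : (Fin (p + 1) → ℝ) → ENNReal} (hF : Measurable F) :
    Measurable (borderMean F) := by
  have hg : Measurable fun x : (Fin p → ℝ) × (Fin (p + 1) → ℝ) =>
      ((x.1, (fun i => x.2 i.succ, x.2 0)) : (Fin p → ℝ) × (Fin p → ℝ) × ℝ) := by fun_prop
  have h2 := hF.comp (measurable_coordEigenvalues_border.comp hg)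
  have h3 : Measurable fun y : Fin (p + 1) → ℝ => gaussianPDFReal 0 (1 / 2) (y 0) *
      ∏ i : Fin p, expDensity (y i.succ) :=
    ((measurable_gaussianPDFReal _ _).comp (measurable_pi_apply 0)).mul
      (Finset.measurable_fun_prod _ fun i _ =>
        measurable_expDensity.comp (measurable_pi_apply _))
  have h4 := (h3.comp (measurable_snd (α := Fin p → ℝ))).ennreal_ofReal.mul h2
  exact h4.lintegral_prod_right' (ν := volume)

/-- Unitary invariance of the border reduces the mean over the matrices of size `p + 1` to a mean
over the eigenvalues of the matrices of size `p`. -/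
theorem lintegral_coordEigenvalues_succ {F : (Fin (p + 1) → ℝ) → ENNReal} (hF : Measurable F) :
    ∫⁻ c, F (coordEigenvalues c) ∂gueMeasure (p + 1)
      = ∫⁻ c, borderMean F (coordEigenvalues c) ∂gueMeasure p := by
  have hFe : Measurable fun c : Fin (p + 1) × Fin (p + 1) → ℝ => F (coordEigenvalues c) :=
    hF.comp measurable_coordEigenvalues
  have hFb : Measurable fun x : (Fin p × Fin p → ℝ) × ((Fin p → ℝ) × (Fin p → ℝ)) × ℝ =>
      F (coordEigenvalues (borderCoord x.2.2 x.2.1.1 x.2.1.2 x.1)) :=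
    hFe.comp measurable_borderCoord
  rw [← (measurePreserving_borderCoord (p := p)).lintegral_comp hFe, lintegral_prod _
    hFb.aemeasurable]
  refine lintegral_congr fun c => ?_
  obtain ⟨U, hU, hc⟩ := exists_unitary_coordEigenvalues c
  have hG := hF.comp (measurable_coordEigenvalues_border_right (coordEigenvalues c))
  refine Eq.trans ?_ (lintegral_gaussian_border _ hG)
  have hrot := (measurePreserving_unitary_gaussian (p := p) (v := 1 / 4) (by norm_num)
    (V := star U) (by rw [star_star, hU])).prod (MeasurePreserving.id (gaussianReal 0 (1 / 2)))
  have hm : Measurable fun x : ((Fin p → ℝ) × (Fin p → ℝ)) × ℝ =>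
      ((fun i => x.1.1 i ^ 2 + x.1.2 i ^ 2, x.2) : (Fin p → ℝ) × ℝ) := by fun_prop
  refine Eq.trans ?_ (hrot.lintegral_comp (hG.comp hm))
  refine lintegral_congr fun x => ?_
  simp only [Function.comp_apply, Prod.map, id]
  rw [coordEigenvalues_border_eq _ _ _ _ hU hc]

/-- The joint density of the ordered eigenvalues, by induction on the size of the matrix. -/
theorem lintegral_coordEigenvalues (p : ℕ) {F : (Fin p → ℝ) → ENNReal} (hF : Measurable F) :
    ∫⁻ c, F (coordEigenvalues c) ∂gueMeasure p
      = ∫⁻ x in {x | StrictMono x}, ENNReal.ofReal (gueDensity x) * F x := by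
  induction p with
  | zero =>
    have h1 : {x : Fin 0 → ℝ | StrictMono x} = Set.univ :=
      Set.eq_univ_of_forall fun x i => i.elim0
    rw [h1, Measure.restrict_univ, gueMeasure, Measure.pi_of_empty _ 0, volume_pi,
      Measure.pi_of_empty _ 0, lintegral_dirac, lintegral_dirac]
    simp [gueDensity, gueConst, vdm, Subsingleton.elim (coordEigenvalues (p := 0) 0) 0]
  | succ p ih =>
    rw [lintegral_coordEigenvalues_succ hF, ih (measurable_borderMean hF)]
    have hI := measurableSet_interlaced (p := p)
    have hIl : ∀ lam : Fin p → ℝ, MeasurableSet {mu | Interlaced lam mu} := fun lam =>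
      measurable_prodMk_left hI
    have hIr : ∀ mu : Fin (p + 1) → ℝ, MeasurableSet {lam | Interlaced lam mu} := fun mu =>
      measurable_prodMk_right hI
    -- one factor `vdm lam` cancels against the Jacobian, the exponential against that of `lam`
    have h1 : ∀ lam : Fin p → ℝ, StrictMono lam →
        ENNReal.ofReal (gueDensity lam) * borderMean F lam
        = ∫⁻ mu, {x : (Fin p → ℝ) × (Fin (p + 1) → ℝ) | Interlaced x.1 x.2}.indicator
          (fun x => ENNReal.ofReal (gueConst p * (2 ^ p / √Real.pi) * vdm x.2 *
            Real.exp (-∑ j, x.2 j ^ 2)) * ENNReal.ofReal (vdm x.1) * F x.2) (lam, mu) := by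
      intro lam hlam
      rw [borderMean, lintegral_border_eq hlam, ← lintegral_const_mul' _ _ ENNReal.ofReal_ne_top,
        ← lintegral_indicator (hIl lam)]
      refine lintegral_congr fun mu => ?_
      by_cases h : Interlaced lam mu
      · rw [Set.indicator_of_mem (show mu ∈ {mu | Interlaced lam mu} from h),
          Set.indicator_of_mem (show (lam, mu) ∈ {x : (Fin p → ℝ) × (Fin (p + 1) → ℝ) |
            Interlaced x.1 x.2} from h)]
        have hv := vdm_pos hlam
        have hv' := vdm_pos h.strictMono_right
        have hC := gueConst_pos p
        have hπ : 0 < √Real.pi := Real.sqrt_pos.2 Real.pi_pos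
        rw [← mul_assoc, ← ENNReal.ofReal_mul (by unfold gueDensity; positivity),
          ← ENNReal.ofReal_mul (by positivity)]
        congr 2
        rw [gueDensity, sub_eq_add_neg, Real.exp_add, Real.exp_neg (∑ i, lam i ^ 2)]
        field_simp
      · rw [Set.indicator_of_notMem (show mu ∉ {mu | Interlaced lam mu} from h),
          Set.indicator_of_notMem (show (lam, mu) ∉ {x : (Fin p → ℝ) × (Fin (p + 1) → ℝ) |
            Interlaced x.1 x.2} from h)]
    have hv1 := (continuous_vdm (p := p)).measurable
    have hv2 := (continuous_vdm (p := p + 1)).measurable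
    have hm : Measurable ({x : (Fin p → ℝ) × (Fin (p + 1) → ℝ) | Interlaced x.1 x.2}.indicator
          (fun x => ENNReal.ofReal (gueConst p * (2 ^ p / √Real.pi) * vdm x.2 *
            Real.exp (-∑ j, x.2 j ^ 2)) * ENNReal.ofReal (vdm x.1) * F x.2)) :=
      Measurable.indicator (by fun_prop) hI
    set g := {x : (Fin p → ℝ) × (Fin (p + 1) → ℝ) | Interlaced x.1 x.2}.indicator
          (fun x => ENNReal.ofReal (gueConst p * (2 ^ p / √Real.pi) * vdm x.2 *
            Real.exp (-∑ j, x.2 j ^ 2)) * ENNReal.ofReal (vdm x.1) * F x.2) with hg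
    -- interlacing tuples are strictly monotone, so the restrictions can be moved from one variable
    -- to the other when the order of integration is exchanged
    rw [setLIntegral_congr_fun measurableSet_strictMono h1,
      setLIntegral_eq_of_support_subset,
      lintegral_lintegral_swap (f := fun lam mu => g (lam, mu)) hm.aemeasurable,
      ← setLIntegral_eq_of_support_subset (s := {mu : Fin (p + 1) → ℝ | StrictMono mu})]
    · refine setLIntegral_congr_fun measurableSet_strictMono fun mu hmu => ?_
      obtain ⟨hint, hval⟩ := integral_vdm_interlaced hmu
      have hv := vdm_pos hmu
      have hpos : ∀ lam ∈ {lam : Fin p → ℝ | Interlaced lam mu}, 0 ≤ vdm lam := fun lam hlam =>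
        (vdm_pos (Interlaced.strictMono_left hlam)).le
      have hC := gueConst_pos p
      have hπ : 0 < √Real.pi := Real.sqrt_pos.2 Real.pi_pos
      have h2 : ∫⁻ lam in {lam : Fin p → ℝ | Interlaced lam mu}, ENNReal.ofReal (vdm lam)
          = ENNReal.ofReal (vdm mu / (p.factorial : ℝ)) := by
        rw [← hval, ofReal_integral_eq_lintegral_ofReal hint
          ((ae_restrict_iff' (hIr mu)).2 (ae_of_all _ hpos))]
      have h3 : ∀ lam : Fin p → ℝ,
          g (lam, mu) = {lam | Interlaced lam mu}.indicator (fun lam =>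
            ENNReal.ofReal (gueConst p * (2 ^ p / √Real.pi) * vdm mu *
            Real.exp (-∑ j, mu j ^ 2)) * ENNReal.ofReal (vdm lam) * F mu) lam := fun lam => rfl
      simp only [h3]
      rw [lintegral_indicator (hIr mu), lintegral_mul_const _ (by fun_prop),
        lintegral_const_mul _ (by fun_prop), h2, ← ENNReal.ofReal_mul (by positivity)]
      congr 2
      rw [gueDensity, gueConst_succ]
      ring
    · intro mu hmu
      by_contra h
      refine hmu ?_
      refine (lintegral_congr fun lam => ?_).trans lintegral_zero
      exact Set.indicator_of_notMem (fun hI => h (Interlaced.strictMono_right hI)) _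
    · intro lam hlam
      by_contra h
      refine hlam ?_
      refine (lintegral_congr fun mu => ?_).trans lintegral_zero
      exact Set.indicator_of_notMem (fun hI => h (Interlaced.strictMono_left hI)) _

end JointLaw


/-! ### The law of the rescaled eigenvalues -/

section Scaling
variable {p : ℕ}

theorem sum_card_Ioi (p : ℕ) : ∑ i : Fin p, (Finset.Ioi i).card = p.choose 2 := by
  simp only [Fin.card_Ioi]
  rw [Finset.sum_fin_eq_sum_range, Nat.choose_two_right, ← Finset.sum_range_id,
    ← Finset.sum_range_reflect]
  exact Finset.sum_congr rfl fun i hi => by 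
    have := Finset.mem_range.1 hi
    rw [dif_pos (by omega)]
    exact Nat.sub_sub_self (by omega)

theorem vdm_smul (r : ℝ) (x : Fin p → ℝ) : vdm (r • x) = r ^ p.choose 2 * vdm x := by
  simp only [vdm, Pi.smul_apply, smul_eq_mul, ← mul_sub, Finset.prod_mul_distrib,
    Finset.prod_const]
  rw [Finset.prod_pow_eq_pow_sum, sum_card_Ioi]

theorem sq_eq_add_two_mul_choose (p : ℕ) : p ^ 2 = p + 2 * p.choose 2 := by
  have h : 2 * p.choose 2 = p * (p - 1) := by
    rw [Nat.choose_two_right, Nat.mul_div_cancel' (Nat.even_mul_pred_self p).two_dvd]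
  rw [h]
  rcases p with _ | p
  · rfl
  · rw [Nat.add_sub_cancel]; ring

/-- The limit density arises from the eigenvalue density by the scaling `√(2t(1-t))`; this is where
the two normalising constants are compared. -/
theorem limitDensity_eq_gueDensity {t : ℝ} (ht : t ∈ Set.Ioo (0 : ℝ) 1) {x : Fin p → ℝ}
    (hx : StrictMono x) :
    limitDensity p t (WithLp.toLp 2 x)
      = (√(2 * t * (1 - t)) ^ p)⁻¹ * gueDensity ((√(2 * t * (1 - t)))⁻¹ • x) := by
  have h0 : 0 < t * (1 - t) := mul_pos ht.1 (sub_pos.2 ht.2)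
  rw [limitDensity_of_strictMono hx, gueDensity, vdm_smul, gueConst]
  have hs : √(2 * t * (1 - t)) = √2 * √(t * (1 - t)) := by
    rw [mul_assoc, Real.sqrt_mul (by norm_num)]
  have hexp : ∑ i, ((√(2 * t * (1 - t)))⁻¹ • x) i ^ 2 = (∑ i, x i ^ 2) / (2 * t * (1 - t)) := by
    simp only [Pi.smul_apply, smul_eq_mul, mul_pow, inv_pow, ← Finset.mul_sum]
    rw [Real.sq_sqrt (by rw [mul_assoc]; positivity), div_eq_inv_mul]
  have hv : (∏ i : Fin p, ∏ j ∈ Finset.Ioi i, (x j - x i) ^ 2) = vdm x ^ 2 := by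
    simp only [vdm, Finset.prod_pow]
  rw [hexp, hv, hs, Real.sqrt_mul (by norm_num : (0 : ℝ) ≤ 2), neg_div, sq_eq_add_two_mul_choose]
  have h2 : (2 : ℝ) ^ p.choose 2 = √2 ^ (2 * p.choose 2) := by
    rw [pow_mul, Real.sq_sqrt (by norm_num)]
  have hτ : 0 < √(t * (1 - t)) := Real.sqrt_pos.2 h0
  have hq : 0 < √(2 : ℝ) := Real.sqrt_pos.2 (by norm_num)
  have hπ : 0 < √Real.pi := Real.sqrt_pos.2 Real.pi_pos
  have hP : (∏ i ∈ Finset.range p, (i.factorial : ℝ)) ≠ 0 :=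
    Finset.prod_ne_zero_iff.2 fun i _ => by exact_mod_cast i.factorial_ne_zero
  rw [h2]
  simp only [mul_pow, mul_inv, inv_pow, ← pow_mul, pow_add, mul_comm _ 2]
  field_simp

theorem measurable_limitDensity_toLp {t : ℝ} (ht : t ∈ Set.Ioo (0 : ℝ) 1) :
    Measurable fun x : Fin p → ℝ => limitDensity p t (WithLp.toLp 2 x) := by
  have h : (fun x : Fin p → ℝ => limitDensity p t (WithLp.toLp 2 x))
      = {x : Fin p → ℝ | StrictMono x}.indicator fun x =>
        (√(2 * t * (1 - t)) ^ p)⁻¹ * gueDensity ((√(2 * t * (1 - t)))⁻¹ • x) := by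
    funext x
    by_cases hx : StrictMono x
    · rw [Set.indicator_of_mem (show x ∈ {x : Fin p → ℝ | StrictMono x} from hx),
        limitDensity_eq_gueDensity ht hx]
    · rw [Set.indicator_of_notMem (show x ∉ {x : Fin p → ℝ | StrictMono x} from hx),
        limitDensity_eq_zero hx]
  rw [h]
  exact ((measurable_gueDensity.comp (measurable_const_smul _)).const_mul _).indicator
    measurableSet_strictMono

theorem orderedEigenvalues_eq (H : HermitianMatrix p) :
    orderedEigenvalues H = WithLp.toLp 2 (coordEigenvalues (hermitianCoord H)) := by
  rw [← hermitianOfCoord_hermitianCoord H]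
  simp only [hermitianOfCoord_hermitianCoord]
  unfold coordEigenvalues
  rw [hermitianOfCoord_hermitianCoord]

theorem aemeasurable_orderedEigenvalues {Ω : Type*} [MeasurableSpace Ω] {P : Measure Ω}
    {H : Ω → HermitianMatrix p} (hH : IsGUE H P) :
    AEMeasurable (fun ω => orderedEigenvalues (H ω)) P := by
  have h : (fun ω => orderedEigenvalues (H ω)) =
      (fun c => WithLp.toLp 2 (coordEigenvalues c)) ∘ fun ω => hermitianCoord (H ω) :=
    funext fun ω => orderedEigenvalues_eq (H ω)
  rw [h]
  exact ((PiLp.volume_preserving_toLp (Fin p)).measurable.comp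
    measurable_coordEigenvalues).comp_aemeasurable hH.aemeasurable

/-- The law of the rescaled eigenvalues has the limit density. -/
theorem hasLaw_smul_orderedEigenvalues {Ω : Type*} [MeasurableSpace Ω] {P : Measure Ω}
    {H : Ω → HermitianMatrix p} (hH : IsGUE H P) {t : ℝ} (ht : t ∈ Set.Ioo (0 : ℝ) 1) :
    HasLaw (fun ω => √(2 * t * (1 - t)) • orderedEigenvalues (H ω))
      (volume.withDensity fun x => ENNReal.ofReal (limitDensity p t x)) P := by
  set s := √(2 * t * (1 - t)) with hs
  have hs0 : 0 < s := Real.sqrt_pos.2 (by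
    rw [mul_assoc]; exact mul_pos two_pos (mul_pos ht.1 (sub_pos.2 ht.2)))
  have hL := PiLp.volume_preserving_toLp (Fin p)
  have hmeas : Measurable fun c : Fin p × Fin p → ℝ => s • WithLp.toLp 2 (coordEigenvalues c) :=
    (hL.measurable.comp measurable_coordEigenvalues).const_smul s
  refine ⟨(aemeasurable_orderedEigenvalues hH).const_smul s, ?_⟩
  have hcomp : (fun ω => s • orderedEigenvalues (H ω)) =
      (fun c => s • WithLp.toLp 2 (coordEigenvalues c)) ∘ fun ω => hermitianCoord (H ω) :=
    funext fun ω => congrArg (s • ·) (orderedEigenvalues_eq (H ω))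
  rw [hcomp, ← AEMeasurable.map_map_of_aemeasurable hmeas.aemeasurable hH.aemeasurable, hH.map_eq]
  ext B hB
  set φ : (Fin p → ℝ) → ENNReal := fun x => B.indicator 1 (WithLp.toLp 2 x) with hφdef
  have hφ : Measurable φ := (measurable_one.indicator hB).comp hL.measurable
  have h1 : (Measure.map (fun c => s • WithLp.toLp 2 (coordEigenvalues c)) (gueMeasure p)) B
      = ∫⁻ c, φ (s • coordEigenvalues c) ∂gueMeasure p := by
    rw [← lintegral_indicator_one hB, lintegral_map (measurable_one.indicator hB) hmeas]
    rfl
  have h2 : ∀ x : Fin p → ℝ, {x : Fin p → ℝ | StrictMono x}.indicator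
      (fun x => ENNReal.ofReal (gueDensity x) * φ (s • x)) x
      = ENNReal.ofReal (s ^ p) * (ENNReal.ofReal (limitDensity p t (WithLp.toLp 2 (s • x))) *
        φ (s • x)) := by
    intro x
    by_cases hx : StrictMono x
    · have hsx : StrictMono (s • x) := fun i j hij => mul_lt_mul_of_pos_left (hx hij) hs0
      rw [Set.indicator_of_mem (show x ∈ {x : Fin p → ℝ | StrictMono x} from hx), ← mul_assoc,
        ← ENNReal.ofReal_mul (by positivity), limitDensity_eq_gueDensity ht hsx, ← hs,
        inv_smul_smul₀ hs0.ne', mul_inv_cancel_left₀ (by positivity)]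
    · have hsx : ¬ StrictMono (s • x) := fun h => hx fun i j hij =>
        lt_of_mul_lt_mul_left (h hij) hs0.le
      rw [Set.indicator_of_notMem (show x ∉ {x : Fin p → ℝ | StrictMono x} from hx),
        limitDensity_eq_zero hsx, ENNReal.ofReal_zero, zero_mul, mul_zero]
  have hlim : Measurable fun x : Fin p → ℝ =>
      ENNReal.ofReal (limitDensity p t (WithLp.toLp 2 x)) * φ x :=
    (measurable_limitDensity_toLp ht).ennreal_ofReal.mul hφ
  have h3 := Measure.map_addHaar_smul (volume : Measure (Fin p → ℝ)) hs0.ne'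
  have h4 : ∫⁻ x : Fin p → ℝ, ENNReal.ofReal (limitDensity p t (WithLp.toLp 2 (s • x))) * φ (s • x)
      = ENNReal.ofReal ((s ^ p)⁻¹) *
        ∫⁻ x : Fin p → ℝ, ENNReal.ofReal (limitDensity p t (WithLp.toLp 2 x)) * φ x := by
    have h5 := lintegral_map (μ := (volume : Measure (Fin p → ℝ))) hlim (measurable_const_smul s)
    rw [h3, lintegral_smul_measure, Module.finrank_fin_fun, abs_of_pos (by positivity)] at h5
    exact h5.symm
  rw [h1]
  refine (lintegral_coordEigenvalues p (hφ.comp (measurable_const_smul s))).trans ?_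
  rw [← lintegral_indicator measurableSet_strictMono]
  refine (lintegral_congr h2).trans ?_
  rw [lintegral_const_mul' _ _ ENNReal.ofReal_ne_top, h4, ← mul_assoc,
    ← ENNReal.ofReal_mul (by positivity), mul_inv_cancel₀ (by positivity), ENNReal.ofReal_one,
    one_mul, withDensity_apply _ hB, ← lintegral_indicator hB,
    ← hL.lintegral_comp_emb (MeasurableEquiv.toLp 2 (Fin p → ℝ)).measurableEmbedding]
  refine lintegral_congr fun x => ?_
  by_cases hx : WithLp.toLp 2 x ∈ B <;> simp [φ, hx]

end Scaling


/-! ### Convergence in distribution -/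

theorem measurable_rescaledWatermelon (p n : ℕ) (t : ℝ) :
    Measurable fun w : Watermelon p (2 * n) => rescaledWatermelon w t :=
  measurable_of_finite _

/-- At the two end times the watermelon is at its deterministic starting position. -/
theorem rescaledWatermelon_endpoint {p n : ℕ} (w : Watermelon p (2 * n)) {t : ℝ}
    (ht : t = 0 ∨ t = 1) :
    rescaledWatermelon w t
      = (√(2 * (n : ℝ)))⁻¹ • WithLp.toLp 2 fun i : Fin p => 2 * ((i : ℕ) : ℝ) := by
  ext i
  have h : branch w.1 i ⌊2 * (n : ℝ) * t⌋₊ = 2 * (i : ℤ) := by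
    rcases ht with rfl | rfl
    · simp [branch, bernoulliPath]
    · rw [mul_one, show (2 * (n : ℝ)) = ((2 * n : ℕ) : ℝ) by push_cast; rfl, Nat.floor_natCast]
      exact w.2.1 i
  simp only [rescaledWatermelon, h, PiLp.smul_apply, smul_eq_mul]
  push_cast
  rw [div_eq_inv_mul]

theorem mainTheorem9 (p : ℕ)
    {Ω : ℕ → Type*} [∀ n, MeasurableSpace (Ω n)]
    (P : ∀ n, Measure (Ω n)) [∀ n, IsProbabilityMeasure (P n)]
    (W : ∀ n, Ω n → Watermelon p (2 * n))
    (hW : ∀ n, HasLaw (W n) (uniformOn Set.univ) (P n))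
    {Ω' : Type*} [MeasurableSpace Ω'] (P' : Measure Ω') [IsProbabilityMeasure P']
    (H : Ω' → HermitianMatrix p) (hH : IsGUE H P')
    (t : ℝ) (ht : t ∈ Set.Icc (0 : ℝ) 1) :
    TendstoInDistribution (fun n ω => rescaledWatermelon (W n ω) t) atTop
        (fun ω => √(2 * t * (1 - t)) • orderedEigenvalues (H ω)) P P' ∧
      (t ∈ Set.Ioo (0 : ℝ) 1 →
        HasLaw (fun ω => √(2 * t * (1 - t)) • orderedEigenvalues (H ω))
          (volume.withDensity fun x => ENNReal.ofReal (limitDensity p t x)) P') := by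
  refine ⟨?_, hasLaw_smul_orderedEigenvalues hH⟩
  have hX : ∀ n, AEMeasurable (fun ω => rescaledWatermelon (W n ω) t) (P n) := fun n =>
    (measurable_rescaledWatermelon p n t).comp_aemeasurable (hW n).aemeasurable
  have hZ : AEMeasurable (fun ω => √(2 * t * (1 - t)) • orderedEigenvalues (H ω)) P' :=
    (aemeasurable_orderedEigenvalues hH).const_smul (√(2 * t * (1 - t)))
  -- by the portmanteau theorem it is enough to bound the probabilities of open sets from below
  refine ⟨hX, hZ, tendsto_of_forall_isOpen_le_liminf' fun G hG => ?_⟩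
  change P'.map _ G ≤ liminf (fun n => (P n).map _ G) atTop
  have hmap : ∀ n, (P n).map (fun ω => rescaledWatermelon (W n ω) t) G
      = uniformOn Set.univ {w : Watermelon p (2 * n) | rescaledWatermelon w t ∈ G} := by
    intro n
    rw [Measure.map_apply_of_aemeasurable (hX n) hG.measurableSet]
    exact (hW n).measure_eq (measurable_rescaledWatermelon p n t hG.measurableSet)
  simp only [hmap]
  by_cases ht' : t ∈ Set.Ioo (0 : ℝ) 1
  · rw [(hasLaw_smul_orderedEigenvalues hH ht').map_eq]
    exact withDensity_le_liminf ht' hG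
  · have hend : t = 0 ∨ t = 1 := by
      by_contra h
      push Not at h
      exact ht' ⟨lt_of_le_of_ne ht.1 (Ne.symm h.1), lt_of_le_of_ne ht.2 h.2⟩
    have hs : √(2 * t * (1 - t)) = 0 := by
      rcases hend with rfl | rfl <;> simp
    simp only [hs, zero_smul]
    rw [Measure.map_const, measure_univ, one_smul, Measure.dirac_apply' _ hG.measurableSet]
    by_cases h0 : (0 : EuclideanSpace ℝ (Fin p)) ∈ G
    · rw [Set.indicator_of_mem h0, Pi.one_apply]
      refine le_liminf_of_le (by isBoundedDefault) ?_
      have hlim : Tendsto (fun n : ℕ => (√(2 * (n : ℝ)))⁻¹ •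
          (WithLp.toLp 2 fun i : Fin p => 2 * ((i : ℕ) : ℝ))) atTop
          (𝓝 (0 : EuclideanSpace ℝ (Fin p))) := by
        have h := (tendsto_inv_atTop_zero.comp tendsto_sqrt_two_mul).smul_const
          (WithLp.toLp 2 fun i : Fin p => 2 * ((i : ℕ) : ℝ))
        rwa [zero_smul] at h
      filter_upwards [hlim.eventually_mem (hG.mem_nhds h0)] with n hn
      have hall : {w : Watermelon p (2 * n) | rescaledWatermelon w t ∈ G} = Set.univ :=
        Set.eq_univ_of_forall fun w => by
          change rescaledWatermelon w t ∈ G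
          rwa [rescaledWatermelon_endpoint w hend]
      have _ : IsProbabilityMeasure (uniformOn (Set.univ : Set (Watermelon p (2 * n)))) :=
        isProbabilityMeasure_uniformOn Set.finite_univ Set.univ_nonempty
      rw [hall, measure_univ]
    · rw [Set.indicator_of_notMem h0]
      exact zero_le
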